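/- Let $\mathbb S$ be a finite set of places of $\mathbb Q$ and let $S=\prod_{p\in\mathbb S,\,p<\infty}p$. For a square class $\xi_v\in\mathbb Q_v^\times/\mathbb Q_v^{\times 2}$ let $\mathbb Q_{v,\xi_v}$ be the quadratic étale algebra $\mathbb Q_v[x]/(x^2-\xi_v)$; it is $\mathbb Q_v\times\mathbb Q_v$ if $\xi_v=1$ and $\mathbb Q_v(\sqrt{\xi_v})$ otherwise. Put $\delta_{\xi_\infty,\infty}=\tfrac12$ and $\delta_{\xi_p,p}=\tfrac12\,|\Delta_{\mathbb Q_{p,\xi_p}/\mathbb Q_p}|_p$, where $\Delta_{\mathbb Q_{p,\xi_p}/\mathbb Q_p}$ is the discriminant. For $\Xi=(\xi_v)_{v\in\mathbb S}\in\prod_{v\in\mathbb S}\mathbb Q_v^\times/\mathbb Q_v^{\times 2}$ put $\delta_\Xi=\prod_{v\in\mathbb S}\delta_{\xi_v,v}$, and for real $Y\ge 1$ let $\mathcal F_\Xi(Y)$ be the set of quadratic fields $K/\mathbb Q$ (up to isomorphism) with $K\otimes_{\mathbb Q}\mathbb Q_v\cong\mathbb Q_{v,\xi_v}$ for all $v\in\mathbb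 S$ and $|\Delta_K|\le Y$, where $\Delta_K$ is the discriminant of $K$. Let $\chi_{\Delta}(m)=\left(\frac{\Delta}{m}\right)$ be the Kronecker symbol. Let $A$ be a real number, and let $g:\mathbb Z_{\ge 1}\to\mathbb C$ be a multiplicative function such that $|g(p)-1|\le A/p$ for all primes $p$, $g(p)=1$ for all primes $p\in\mathbb S$, and $g(4)=g(8)=g(2)$ (for instance, $g(n)$ depends only on the set of primes dividing $n$); write $g(\Delta)=g(|\Delta|)$ for negative $\Delta$. Let $m\ge 1$ be an integer coprime to $S$, and let $Y\ge 1$. (i) If $m$ is not a perfect square, then $$\Bigl|\sum_{K\in\mathcal F_\Xi(Y)}\chi_{\Delta_K}(m)\,g(\Delta_K)\Bigr|\le C_A\,S^{1/4}\,m^{1/4}\sqrt{\log(4mS)}\,\sqrt Y ,$$ where $C_A$ depends only on $A$. (ii) If $m$ is a perfect square, then the infinite product below converges unconditionally, and for every $\epsilon>0$ $$\sum_{K\in\mathcal F_\Xi(Y)}\chi_{\Delta_K}(m)\,g(\Delta_K)=\delta_\Xi\,Y\prod_{p\in\mathbb S}\Bigl(1-\frac1p\Bigr)\prod_{\substack{p\notin\mathbb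 S\\ p\mid m}}\Bigl(1-\frac1p\Bigr)\prod_{\substack{p\notin\mathbb S\\ p\nmid m}}\Bigl(1-\frac1p\Bigr)\Bigl(1+\frac{g(p)}p\Bigr)+E,$$ with $|E|\le C_{A,\epsilon}\,S^{1/4}\,(mS)^{\epsilon}\,Y^{1/2+\epsilon}$, where $C_{A,\epsilon}$ depends only on $A$ and $\epsilon$. The products run over finite primes. In particular, for a fixed set $\mathbb S$ the sum is $O_{A,\mathbb S}\bigl(m^{1/4}\sqrt{\log(4mS)}\sqrt Y\bigr)$ in case (i), and $E=O_{A,\mathbb S,\epsilon}\bigl((mS)^\epsilon Y^{1/2+\epsilon}\bigr)$ in case (ii). -/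

import Mathlib

open scoped TensorProduct

noncomputable section

/-! ### Quadratic étale algebras over a field -/

/-- The group `k^×/k^{×2}` of square classes of a field. -/
abbrev SquareClass (k : Type) [Field k] : Type := kˣ ⧸ (powMonoidHom 2 : kˣ →* kˣ).range

/-- The quadratic étale algebra `k_ξ = k[x]/(x² - u)` attached to a square class `ξ`, where `u` is a
representative of `ξ`. It is the field `k(√u)` if `u` is not a square, and it is isomorphic to
`k × k` if `u` is a square (in characteristic different from `2`); up to isomorphism it does not
depend on the representative. -/
abbrev quadraticAlgebra (k : Type) [Field k] (ξ : SquareClass k) : Type :=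
  AdjoinRoot (Polynomial.X ^ 2 - Polynomial.C ((Quotient.out ξ : kˣ) : k) : Polynomial k)

/-! ### Places of `ℚ` -/

/-- The places of `ℚ`: the archimedean one, and one for every prime number. -/
inductive RatPlace : Type where
  | infinite : RatPlace
  | finite (p : Nat.Primes) : RatPlace

namespace RatPlace

instance factPrime (p : Nat.Primes) : Fact (p : ℕ).Prime := ⟨p.2⟩

/-- The completion `ℚ_v`. -/
def Completion : RatPlace → Type
  | infinite => ℝ
  | finite p => ℚ_[(p : ℕ)]

instance instFieldCompletion : (v : RatPlace) → Field v.Completion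
  | infinite => inferInstanceAs (Field ℝ)
  | finite p => inferInstanceAs (Field ℚ_[(p : ℕ)])

instance instAlgebraCompletion : (v : RatPlace) → Algebra ℚ v.Completion
  | infinite => inferInstanceAs (Algebra ℚ ℝ)
  | finite p => inferInstanceAs (Algebra ℚ ℚ_[(p : ℕ)])

/-- The residue characteristic, with the value `1` at the archimedean place. -/
def residueChar : RatPlace → ℕ
  | infinite => 1
  | finite p => p

end RatPlace

/-- The number `S`: the product of the primes in a finite set of places. -/
def primeProduct (𝕊 : Finset RatPlace) : ℕ := ∏ v ∈ 𝕊, v.residueChar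

/-! ### Local types and the constant `δ_Ξ` -/

/-- A local type `Ξ = (ξ_v)`, with one square class of `ℚ_v` for every `v ∈ 𝕊`. -/
abbrev LocalType (𝕊 : Finset RatPlace) : Type := (v : 𝕊) → SquareClass (v : RatPlace).Completion

/-- The discriminant ideal in `ℤ_p` of the quadratic étale algebra `L` attached to `ξ`: it is
generated by the discriminants of all pairs of elements of `L` that are integral over `ℤ_p`. -/
def localDiscriminant (p : ℕ) [Fact p.Prime] (ξ : SquareClass ℚ_[p]) : Ideal ℤ_[p] :=
  Ideal.span {x : ℤ_[p] | ∃ b : Fin 2 → quadraticAlgebra ℚ_[p] ξ,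
    (∀ i, IsIntegral ℤ_[p] (b i)) ∧ (x : ℚ_[p]) = Algebra.discr ℚ_[p] b}

/-- The local factor `δ_{ξ,v}`: it is `1/2` at the archimedean place, and one half of the `p`-adic
absolute value of the local discriminant at a prime `p`. -/
def localWeight : (v : RatPlace) → SquareClass v.Completion → ℝ
  | .infinite, _ => 1 / 2
  | .finite p, ξ => 1 / 2 * ‖Submodule.IsPrincipal.generator (localDiscriminant (p : ℕ) ξ)‖

/-- The constant `δ_Ξ`. -/
def deltaConst {𝕊 : Finset RatPlace} (Ξ : LocalType 𝕊) : ℝ :=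
  ∏ v : 𝕊, localWeight v (Ξ v)

/-! ### Quadratic fields -/

/-- The quadratic fields, as subfields of a fixed algebraic closure of `ℚ`; every quadratic
extension of `ℚ` is isomorphic to exactly one of them. -/
abbrev QuadraticField : Type :=
  {K : IntermediateField ℚ (AlgebraicClosure ℚ) // Module.finrank ℚ K = 2}

instance QuadraticField.instNumberField (K : QuadraticField) : NumberField K.1 :=
  @NumberField.mk _ _ inferInstance (Module.finite_of_finrank_eq_succ K.2)

/-- The discriminant `Δ_K`. -/
def QuadraticField.disc (K : QuadraticField) : ℤ := NumberField.discr K.1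

/-- The family `F_Ξ(Y)`: the quadratic fields `K` with `K_v = ℚ_v ⊗ K` isomorphic to the algebra
attached to `ξ_v` for all `v ∈ 𝕊`, and with `|Δ_K| ≤ Y`. -/
def fieldFamily {𝕊 : Finset RatPlace} (Ξ : LocalType 𝕊) (Y : ℝ) : Set QuadraticField :=
  {K | (∀ v : 𝕊, Nonempty (((v : RatPlace).Completion ⊗[ℚ] K.1) ≃ₐ[(v : RatPlace).Completion]
      quadraticAlgebra (v : RatPlace).Completion (Ξ v))) ∧ (|K.disc| : ℝ) ≤ Y}

theorem fieldFamily_finite {𝕊 : Finset RatPlace} (Ξ : LocalType 𝕊) (Y : ℝ) :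
    (fieldFamily Ξ Y).Finite := by
  let f : QuadraticField → {F : IntermediateField ℚ (AlgebraicClosure ℚ) // FiniteDimensional ℚ F} :=
    fun K => ⟨K.1, Module.finite_of_finrank_eq_succ K.2⟩
  have hf : Function.Injective f := fun K L h => Subtype.ext (congrArg (fun x => x.1) h)
  refine Set.Finite.subset
    ((NumberField.finite_of_discr_bdd (AlgebraicClosure ℚ) ⌊Y⌋₊).preimage hf.injOn) ?_
  rintro K ⟨-, hK⟩
  have h1 : ((K.disc.natAbs : ℕ) : ℝ) ≤ Y := by
    rw [Nat.cast_natAbs]; exact_mod_cast hK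
  have h2 : K.disc.natAbs ≤ ⌊Y⌋₊ := Nat.le_floor h1
  change |K.disc| ≤ ((⌊Y⌋₊ : ℕ) : ℤ)
  rw [Int.abs_eq_natAbs]
  exact_mod_cast h2

/-! ### The sum and its main term -/

/-- The Kronecker symbol `χ_D(m) = (D/m)` for `m ≥ 1`: the value at `2` is `0`, `1`, `-1` for
`D` even, `D ≡ ±1 (mod 8)`, `D ≡ ±3 (mod 8)`, and the odd part of `m` gives a Jacobi symbol. -/
def kroneckerSymbol (D : ℤ) (m : ℕ) : ℤ :=
  ZMod.χ₈ (D : ZMod 8) ^ m.factorization 2 * jacobiSym D (m / 2 ^ m.factorization 2)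

/-- The sum of `χ_{Δ_K}(m) g(Δ_K)` over `K ∈ F_Ξ(Y)`, where `g(Δ)` stands for `g(|Δ|)`. -/
def discriminantSum {𝕊 : Finset RatPlace} (Ξ : LocalType 𝕊) (g : ArithmeticFunction ℂ) (m : ℕ)
    (Y : ℝ) : ℂ :=
  ∑ K ∈ (fieldFamily_finite Ξ Y).toFinset, (kroneckerSymbol K.disc m : ℂ) * g K.disc.natAbs

/-- The Euler factor `(1 - 1/p)(1 + g(p)/p)` at the primes `p` outside `𝕊` not dividing `m`. -/
def eulerFactor (𝕊 : Finset RatPlace) (g : ArithmeticFunction ℂ) (m : ℕ)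
    (p : {p : Nat.Primes // RatPlace.finite p ∉ 𝕊 ∧ ¬ (p : ℕ) ∣ m}) : ℂ :=
  (1 - 1 / ((p.1 : ℕ) : ℂ)) * (1 + g (p.1 : ℕ) / ((p.1 : ℕ) : ℂ))

/-- The main term
`δ_Ξ Y ∏_{p ∈ 𝕊} (1 - 1/p) ∏_{p ∉ 𝕊, p ∣ m} (1 - 1/p) ∏_{p ∉ 𝕊, p ∤ m} (1 - 1/p)(1 + g(p)/p)`. -/
def mainTerm {𝕊 : Finset RatPlace} (Ξ : LocalType 𝕊) (g : ArithmeticFunction ℂ) (m : ℕ)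
    (Y : ℝ) : ℂ :=
  (deltaConst Ξ : ℂ) * (Y : ℂ)
    * (∏ p ∈ (primeProduct 𝕊).primeFactors, (1 - 1 / (p : ℂ)))
    * (∏ p ∈ m.primeFactors with ¬ p ∣ primeProduct 𝕊, (1 - 1 / (p : ℂ)))
    * ∏' p, eulerFactor 𝕊 g m p

/-- The hypotheses on `g`: it is multiplicative, `|g(p) - 1| ≤ A/p` for all primes `p`,
`g(p) = 1` for the primes `p ∈ 𝕊`, and `g(4) = g(8) = g(2)`. -/
structure IsAdmissible (𝕊 : Finset RatPlace) (A : ℝ) (g : ArithmeticFunction ℂ) : Prop where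
  multiplicative : g.IsMultiplicative
  bound : ∀ p : ℕ, p.Prime → ‖g p - 1‖ ≤ A / p
  eq_one : ∀ p : Nat.Primes, RatPlace.finite p ∈ 𝕊 → g (p : ℕ) = 1
  four : g 4 = g 2
  eight : g 8 = g 2

end

/-!
Every quadratic field is `ℚ(√D)` for a unique squarefree integer `D ≠ 1`, and its discriminant is
`fundDisc D`, which is `D` or `4 D`. The condition at a place `v ∈ 𝕊` says that `D` lies in a
given class of `ℚ_v^× / ℚ_v^{×2}`: at `∞` this is a condition on the sign, and at a prime it is,
by Hensel's lemma, a condition on the power of `p` in `D` and on the residue class of the rest,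
modulo `8` at `p = 2` and in terms of the Legendre symbol at odd `p`. The discriminant of the
local algebra is computed by the same argument as the global one, as both `ℤ` and `ℤ_p` are
integrally closed. Therefore the sum over fields is a sum over `D` (`exists_discriminantSum_eq`),
and then, with `D = s 2^β R n` where `s` is a sign, `R` the product of the odd primes of `𝕊` that
ramify, and `n` is odd, a sum over 16 classes `(s, β, e)` of sums over squarefree `n` coprime to
the product `T` of the odd primes of `𝕊`, with `n` in a given class modulo `8` and with given
symbols `(n / p)` for `p ∣ T` (`sum_squarefree_matches_eq`). The summand is a constant times `g(n)
(n / b)`, where `b` is the odd part of `m`.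

The conditions on `n` are expanded into the characters `ψ` modulo `8` and the Jacobi symbols `(n /
t)` for `t ∣ T`. The weights of this expansion have total mass `1`, so that there is no loss in
the number of primes in `𝕊`, and it remains to estimate `∑ μ²(n) g(n) F(n)` over `n ≤ X` for each
function `F(n) = ψ(n) (n / t b)`. If `F` is not trivial, its partial sums are at most a constant
times `√(T b) log (8 T b)`, by the Pólya–Vinogradov inequality (`norm_sum_dirichletCharacter_le`).
If `F` is trivial, which happens only for `ψ = 1`, `t = 1` and `b` a square, its partial sums are
those of the integers coprime to `2 T b`. In both cases the partial sums are `ρ Z + O(M)`.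

To pass from `F` to `μ² g F`, write `μ² g = 1 * k`. The function `k` is close to the Möbius
function of the squares: it is small at the primes, and it is bounded by the convolution of
`A^{ω(u)} / rad(u)` with the indicator function of the squares `a²`
(`norm_squarefreeCofactor_le`). The error is thus at most a constant times the sum over `u` and
`a` of `A^{ω(u)} / rad(u) · min (X / (u a²)) M`, and summing first over `a` and then over `u`
gives `√(X M)` (`exists_sum_squarefreePart_le`). With `M` of size `√(S m) log (4 S m)` this is the
bound of the first part; the single term `D = 1`, which does not belong to a field, is absorbed by
it.

If `m` is not a square but `b` is, the exponent of `2` in `m` is odd, and the main terms of the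
classes `D ≡ 1` and `D ≡ 5` modulo `8` cancel, because `χ_Δ(2)` takes opposite values there. If
`m` is a square, the main terms add up to the Euler product of `∑ k(n) / n` over `n` coprime to `2
T b`, together with the factors at `2` and at the primes dividing `T b` and with the weights
`δ_{ξ,v}` (`hasProd_eulerFactor`, `mainTerm_eq`). In this case the factor `(n / b)` only says that
`n` is coprime to `b`, which is removed by Möbius inversion at the cost of the number of divisors
of `b`, so that `M` has size `√S log (4 S) d(m)`, and the divisor bound finishes the proof
(`exists_discriminantSum_sub_mainTerm_le`).
-/

noncomputable section

/-! ### Partial sums of completely multiplicative functions -/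

/-- `HasMeanValue F ρ M` says that the partial sums of `F` over `1 ≤ n ≤ Z` are `ρ Z` up to an
error of absolute value at most `M`, for all real `Z ≥ 0`. -/
def HasMeanValue (F : ℕ → ℂ) (ρ : ℂ) (M : ℝ) : Prop :=
  ∀ Z : ℝ, 0 ≤ Z → ‖∑ n ∈ Finset.Icc 1 ⌊Z⌋₊, F n - ρ * Z‖ ≤ M

/-- The completely multiplicative function that agrees with `F` at the integers coprime to `r` and
vanishes at the others. -/
def coprimePart (r : ℕ) (F : ℕ →*₀ ℂ) : ℕ →*₀ ℂ where
  toFun n := if n.Coprime r then F n else 0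
  map_zero' := by simp
  map_one' := by simp
  map_mul' a b := by
    have h : (a * b).Coprime r ↔ a.Coprime r ∧ b.Coprime r := Nat.coprime_mul_iff_left
    split_ifs <;> first | (exfalso; tauto) | simp

theorem coprimePart_apply (r : ℕ) (F : ℕ →*₀ ℂ) (n : ℕ) :
    coprimePart r F n = if n.Coprime r then F n else 0 := rfl

theorem norm_coprimePart_le (r : ℕ) (F : ℕ →*₀ ℂ) (n : ℕ) : ‖coprimePart r F n‖ ≤ ‖F n‖ := by
  rw [coprimePart_apply]; split_ifs <;> simp

/-- The sum over the multiples of `t`, as a sum over the cofactors. -/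
theorem sum_Icc_filter_dvd (f : ℕ → ℂ) {t : ℕ} (ht : 0 < t) (N : ℕ) :
    ∑ n ∈ Finset.Icc 1 N with t ∣ n, f n = ∑ l ∈ Finset.Icc 1 (N / t), f (t * l) := by
  symm
  refine Finset.sum_nbij' (fun l => t * l) (fun n => n / t) ?_ ?_ ?_ ?_ ?_
  · intro l hl
    simp only [Finset.mem_Icc, Finset.mem_filter] at hl ⊢
    refine ⟨⟨Nat.mul_pos ht hl.1, ?_⟩, dvd_mul_right _ _⟩
    rw [mul_comm]; exact (Nat.le_div_iff_mul_le ht).1 hl.2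
  · intro n hn
    simp only [Finset.mem_Icc, Finset.mem_filter] at hn ⊢
    exact ⟨(Nat.div_pos (Nat.le_of_dvd hn.1.1 hn.2) ht), Nat.div_le_div_right hn.1.2⟩
  · intro l _; exact Nat.mul_div_cancel_left l ht
  · intro n hn; exact Nat.mul_div_cancel' (Finset.mem_filter.1 hn).2
  · intro l _; rfl

/-- Möbius inversion, as the detection of coprimality to `r`. -/
theorem sum_moebius_common_divisors {n r : ℕ} (hr : r ≠ 0) :
    ∑ t ∈ r.divisors with t ∣ n, (ArithmeticFunction.moebius t : ℂ) =
      if n.Coprime r then 1 else 0 := by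
  have h1 : {t ∈ r.divisors | t ∣ n} = (n.gcd r).divisors := by
    ext t
    simp only [Finset.mem_filter, Nat.mem_divisors, Nat.dvd_gcd_iff]
    have := Nat.gcd_ne_zero_right (m := n) hr
    tauto
  rw [h1]
  have h2 := congrArg (fun f : ArithmeticFunction ℤ => f (n.gcd r))
    ArithmeticFunction.coe_zeta_mul_moebius
  simp only [ArithmeticFunction.coe_zeta_mul_apply, ArithmeticFunction.one_apply] at h2
  rw [← Int.cast_sum, h2]
  simp [Nat.Coprime]

/-- Removing the integers that are not coprime to `r` costs a factor `d(r)` in the error. -/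
theorem HasMeanValue.coprimePart {F : ℕ →*₀ ℂ} {ρ : ℂ} {M : ℝ} (h : HasMeanValue F ρ M)
    (hF : ∀ n, ‖F n‖ ≤ 1) {r : ℕ} (hr : r ≠ 0) :
    HasMeanValue (coprimePart r F)
      (ρ * ∑ t ∈ r.divisors, (ArithmeticFunction.moebius t : ℂ) * F t / t) (r.divisors.card * M) := by
  intro Z hZ
  have h1 : ∑ n ∈ Finset.Icc 1 ⌊Z⌋₊, _root_.coprimePart r F n =
      ∑ t ∈ r.divisors, (ArithmeticFunction.moebius t : ℂ) * F t *
        ∑ l ∈ Finset.Icc 1 ⌊Z / t⌋₊, F l := by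
    have h2 : ∀ n, _root_.coprimePart r F n =
        ∑ t ∈ r.divisors, if t ∣ n then (ArithmeticFunction.moebius t : ℂ) * F n else 0 := by
      intro n
      rw [← Finset.sum_filter, ← Finset.sum_mul, sum_moebius_common_divisors hr, coprimePart_apply]
      split_ifs <;> simp
    simp_rw [h2]
    rw [Finset.sum_comm]
    refine Finset.sum_congr rfl fun t ht => ?_
    have htpos : 0 < t := Nat.pos_of_mem_divisors ht
    rw [← Finset.sum_filter, sum_Icc_filter_dvd _ htpos, Nat.floor_div_natCast, Finset.mul_sum]
    refine Finset.sum_congr rfl fun l _ => ?_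
    rw [map_mul]; ring
  rw [h1, Finset.mul_sum, Finset.sum_mul, ← Finset.sum_sub_distrib]
  refine (norm_sum_le _ _).trans ?_
  rw [← nsmul_eq_mul]
  refine Finset.sum_le_card_nsmul _ _ _ fun t ht => ?_
  have h3 : (ArithmeticFunction.moebius t : ℂ) * F t * ∑ l ∈ Finset.Icc 1 ⌊Z / t⌋₊, F l -
      ρ * ((ArithmeticFunction.moebius t : ℂ) * F t / t) * Z =
      (ArithmeticFunction.moebius t : ℂ) * F t *
        (∑ l ∈ Finset.Icc 1 ⌊Z / t⌋₊, F l - ρ * ((Z / t : ℝ) : ℂ)) := by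
    push_cast; ring
  rw [h3, norm_mul, norm_mul]
  have hmu : ‖(ArithmeticFunction.moebius t : ℂ)‖ ≤ 1 := by
    rw [Complex.norm_intCast]
    exact_mod_cast ArithmeticFunction.abs_moebius_le_one
  have h4 := h (Z / t) (by positivity)
  have h5 : ‖(ArithmeticFunction.moebius t : ℂ)‖ * ‖F t‖ ≤ 1 :=
    mul_le_one₀ hmu (norm_nonneg _) (hF t)
  calc _ ≤ 1 * M := mul_le_mul h5 h4 (norm_nonneg _) zero_le_one
    _ = M := one_mul M

theorem card_divisors_le_two_mul_sqrt (r : ℕ) : (r.divisors.card : ℝ) ≤ 2 * Real.sqrt r := by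
  -- every divisor, or its cofactor, is at most `√r`
  have h1 : r.divisors ⊆ (Finset.Icc 1 r.sqrt) ∪ (Finset.Icc 1 r.sqrt).image (fun d => r / d) := by
    intro d hd
    have hd0 := Nat.pos_of_mem_divisors hd
    have hdr := Nat.dvd_of_mem_divisors hd
    have hr0 : r ≠ 0 := (Nat.mem_divisors.1 hd).2
    simp only [Finset.mem_union, Finset.mem_image, Finset.mem_Icc]
    by_cases h : d ≤ r.sqrt
    · exact Or.inl ⟨hd0, h⟩
    · right
      refine ⟨r / d, ⟨Nat.div_pos (Nat.le_of_dvd (Nat.pos_of_ne_zero hr0) hdr) hd0, ?_⟩,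
        Nat.div_div_self hdr hr0⟩
      by_contra h2
      push Not at h h2
      have h3 := Nat.mul_le_mul h h2
      rw [Nat.mul_div_cancel' hdr] at h3
      have := Nat.lt_succ_sqrt r
      simp only [Nat.succ_eq_add_one] at h3 this
      omega
  have h2 : r.divisors.card ≤ 2 * r.sqrt := by
    refine (Finset.card_le_card h1).trans ((Finset.card_union_le _ _).trans ?_)
    have := Finset.card_image_le (s := Finset.Icc 1 r.sqrt) (f := fun d => r / d)
    simp only [Nat.card_Icc] at *
    omega
  have h3 : ((r.sqrt : ℕ) : ℝ) ≤ Real.sqrt r := Real.nat_sqrt_le_real_sqrt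
  calc (r.divisors.card : ℝ) ≤ ((2 * r.sqrt : ℕ) : ℝ) := by exact_mod_cast h2
    _ ≤ 2 * Real.sqrt r := by push_cast; linarith

/-! ### The Pólya–Vinogradov inequality -/

/-- The partial sums of a nontrivial additive character of `ℤ/q` are at most
`(q / 2) (1 / k + 1 / (q - k))`. -/
theorem norm_sum_stdAddChar_le {q : ℕ} [NeZero q] {k : ℕ} (hk : 0 < k) (hkq : k < q) (N : ℕ) :
    ‖∑ n ∈ Finset.Icc 1 N, ZMod.stdAddChar (-((k : ZMod q) * (n : ZMod q)))‖ ≤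
      q / 2 * (1 / k + 1 / (q - k : ℕ)) := by
  set z : ℂ := ZMod.stdAddChar (-(k : ZMod q)) with hz
  have hq0 : (0 : ℝ) < q := by exact_mod_cast Nat.pos_of_ne_zero (NeZero.ne q)
  have h1 : ∀ n : ℕ, ZMod.stdAddChar (-((k : ZMod q) * (n : ZMod q))) = z ^ n := by
    intro n
    rw [hz, ← AddChar.map_nsmul_eq_pow]
    congr 1
    rw [nsmul_eq_mul]; ring
  simp_rw [h1]
  have hznorm : ‖z‖ = 1 := by rw [hz]; exact AddChar.norm_apply _ _
  have hz1 : z = (Complex.exp (Complex.I * ((2 * Real.pi * k / q : ℝ) : ℂ)))⁻¹ := by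
    have := ZMod.stdAddChar_coe (N := q) (-(k : ℤ))
    push_cast at this
    rw [hz, this, ← Complex.exp_neg]
    congr 1
    push_cast
    ring
  have hnorm : ‖z - 1‖ = 2 * Real.sin (Real.pi * k / q) := by
    have h2 := Complex.norm_exp_I_mul_ofReal_sub_one (2 * Real.pi * k / q)
    set w := Complex.exp (Complex.I * ((2 * Real.pi * k / q : ℝ) : ℂ)) with hw
    have hwn : ‖w‖ = 1 := by rw [hw, mul_comm]; exact Complex.norm_exp_ofReal_mul_I _
    have hw0 : w ≠ 0 := by intro h; rw [h] at hwn; simp at hwn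
    have h3 : z - 1 = -(w⁻¹ * (w - 1)) := by rw [hz1]; field_simp; ring
    rw [h3, norm_neg, norm_mul, norm_inv, hwn, h2]
    have h4 : 0 ≤ Real.sin (Real.pi * k / q) := by
      refine Real.sin_nonneg_of_nonneg_of_le_pi (by positivity) ?_
      rw [div_le_iff₀ hq0]
      exact mul_le_mul_of_nonneg_left (by exact_mod_cast hkq.le) Real.pi_pos.le
    rw [show 2 * Real.pi * k / q / 2 = Real.pi * k / q by ring, Real.norm_eq_abs,
      abs_of_nonneg (by positivity)]
    simp
  have hk0 : (0 : ℝ) < k := by exact_mod_cast hk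
  have hqk : (0 : ℝ) < (q - k : ℕ) := by exact_mod_cast Nat.sub_pos_of_lt hkq
  have hqk' : ((q - k : ℕ) : ℝ) = q - k := by rw [Nat.cast_sub hkq.le]
  have hpi := Real.pi_pos
  -- Jordan's inequality, at whichever of `k / q` and `1 - k / q` is at most `1 / 2`
  have hsin : 2 * min (k : ℝ) (q - k : ℕ) / q ≤ Real.sin (Real.pi * k / q) := by
    rcases le_total (k : ℝ) ((q - k : ℕ) : ℝ) with h | h
    · rw [min_eq_left h]
      have h5 := Real.mul_le_sin (x := Real.pi * k / q) (by positivity) (by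
        rw [div_le_div_iff₀ hq0 two_pos]; rw [hqk'] at h; nlinarith)
      refine le_trans (le_of_eq ?_) h5
      field_simp
    · rw [min_eq_right h]
      have h5 := Real.mul_le_sin (x := Real.pi * (q - k : ℕ) / q) (by positivity) (by
        rw [div_le_div_iff₀ hq0 two_pos]; rw [hqk'] at h ⊢; nlinarith)
      have h6 : Real.sin (Real.pi * (q - k : ℕ) / q) = Real.sin (Real.pi * k / q) := by
        rw [← Real.sin_pi_sub]; congr 1; rw [hqk']; field_simp; ring
      rw [h6] at h5
      refine le_trans (le_of_eq ?_) h5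
      field_simp
  have hmin : 0 < min (k : ℝ) (q - k : ℕ) := lt_min hk0 hqk
  have hlow : 4 * min (k : ℝ) (q - k : ℕ) / q ≤ ‖z - 1‖ := by
    rw [hnorm]; calc _ = 2 * (2 * min (k : ℝ) (q - k : ℕ) / q) := by ring
      _ ≤ _ := by linarith
  have hzne : z ≠ 1 := by
    intro h
    rw [h] at hlow
    simp only [sub_self, norm_zero] at hlow
    have : 0 < 4 * min (k : ℝ) (q - k : ℕ) / q := by positivity
    linarith
  have hgeom : ‖∑ n ∈ Finset.Icc 1 N, z ^ n‖ ≤ 2 / ‖z - 1‖ := by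
    have h6 : ∑ n ∈ Finset.Icc 1 N, z ^ n = z * ((z ^ N - 1) / (z - 1)) := by
      rw [← geom_sum_eq hzne, Finset.mul_sum, Finset.range_eq_Ico,
        ← Finset.sum_Ico_add_right_sub_eq 0 N 1]
      refine Finset.sum_congr ?_ ?_
      · ext x; simp only [Finset.mem_Icc, Finset.mem_Ico]; omega
      · intro n hn
        rw [Finset.mem_Ico] at hn
        rw [← pow_succ', Nat.sub_add_cancel hn.1]
    rw [h6, norm_mul, norm_div, hznorm, one_mul]
    gcongr
    refine (norm_sub_le _ _).trans ?_
    rw [norm_pow, hznorm]; norm_num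
  refine hgeom.trans ?_
  have h7 : 2 / ‖z - 1‖ ≤ q / 2 * (1 / min (k : ℝ) (q - k : ℕ)) := by
    calc 2 / ‖z - 1‖ ≤ 2 / (4 * min (k : ℝ) (q - k : ℕ) / q) := by gcongr
      _ = _ := by field_simp; ring
  refine h7.trans ?_
  gcongr
  rcases min_choice (k : ℝ) ((q - k : ℕ) : ℝ) with h | h <;> rw [h]
  · have : 0 ≤ 1 / ((q - k : ℕ) : ℝ) := by positivity
    linarith
  · have : 0 ≤ 1 / (k : ℝ) := by positivity
    linarith

theorem norm_gaussSum_of_isPrimitive {q : ℕ} [NeZero q] {χ : DirichletCharacter ℂ q}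
    (hχ : χ.IsPrimitive) : ‖gaussSum χ ZMod.stdAddChar‖ = Real.sqrt q := by
  have hχ' : (χ⁻¹).IsPrimitive := by
    rw [DirichletCharacter.isPrimitive_def, DirichletCharacter.conductor_inv]; exact hχ
  set e : AddChar (ZMod q) ℂ := ZMod.stdAddChar
  have h1 := congrFun (ZMod.dft_dft (χ : ZMod q → ℂ)) 1
  have h2 : ZMod.dft (χ : ZMod q → ℂ) = fun k => gaussSum χ e * χ⁻¹ (-k) := by
    ext k; rw [hχ.fourierTransform_eq_inv_mul_gaussSum, mul_comm]
  have h3 : ZMod.dft (ZMod.dft (χ : ZMod q → ℂ)) 1 = gaussSum χ e * gaussSum χ⁻¹ e := by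
    rw [h2, ZMod.dft_const_mul, ZMod.dft_comp_neg]
    simp only
    rw [hχ'.fourierTransform_eq_inv_mul_gaussSum]
    simp [e]
  rw [h3] at h1
  have h4 : star (gaussSum χ e) = χ (-1) * gaussSum χ⁻¹ e := by
    rw [star_gaussSum_eq]
    have : e⁻¹ = e.mulShift (-1) := by ext x; simp [AddChar.inv_apply, AddChar.mulShift_apply]
    rw [this, gaussSum_mulShift_of_isPrimitive _ hχ']
    simp
  have hm1 : ‖χ (-1)‖ = 1 := by
    have : χ (-1) * χ (-1) = 1 := by rw [← map_mul]; simp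
    have h5 := congrArg norm this
    rw [norm_mul, norm_one] at h5
    nlinarith [norm_nonneg (χ (-1))]
  have h5 : ‖gaussSum χ⁻¹ e‖ = ‖gaussSum χ e‖ := by
    have := congrArg norm h4
    rw [norm_star, norm_mul, hm1, one_mul] at this
    exact this.symm
  have h6 := congrArg norm h1
  rw [norm_mul, h5, smul_eq_mul, norm_mul, hm1, Complex.norm_natCast, mul_one] at h6
  rw [← h6, Real.sqrt_mul_self (norm_nonneg _)]

/-- The Pólya–Vinogradov inequality for primitive characters, by Fourier inversion on `ℤ/q`. -/
theorem norm_sum_isPrimitive_le {q : ℕ} [NeZero q] (hq : 1 < q) {χ : DirichletCharacter ℂ q}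
    (hχ : χ.IsPrimitive) (N : ℕ) :
    ‖∑ n ∈ Finset.Icc 1 N, χ n‖ ≤ Real.sqrt q * (1 + Real.log q) := by
  set τ := gaussSum χ ZMod.stdAddChar with hτ
  have hq0 : (0 : ℝ) < q := by positivity
  have h2 : ZMod.dft (χ : ZMod q → ℂ) = fun k => τ * χ⁻¹ (-k) := by
    ext k; rw [hχ.fourierTransform_eq_inv_mul_gaussSum, mul_comm]
  have h3 : ∀ n : ℕ, (q : ℂ) * χ n =
      τ * ∑ k : ZMod q, ZMod.stdAddChar (-(k * (n : ZMod q))) * χ⁻¹ k := by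
    intro n
    have h1 := congrFun (ZMod.dft_dft (χ : ZMod q → ℂ)) (-(n : ZMod q))
    rw [h2, ZMod.dft_const_mul, ZMod.dft_comp_neg] at h1
    simp only [neg_neg, smul_eq_mul] at h1
    rw [← h1, ZMod.dft_apply]
    simp
  have h4 : (q : ℂ) * ∑ n ∈ Finset.Icc 1 N, χ n =
      τ * ∑ k : ZMod q, χ⁻¹ k * ∑ n ∈ Finset.Icc 1 N, ZMod.stdAddChar (-(k * (n : ZMod q))) := by
    rw [Finset.mul_sum]
    simp_rw [h3]
    rw [← Finset.mul_sum, Finset.sum_comm]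
    congr 1
    refine Finset.sum_congr rfl fun k _ => ?_
    rw [Finset.mul_sum]
    refine Finset.sum_congr rfl fun n _ => ?_
    ring
  have h5 : ‖∑ k : ZMod q, χ⁻¹ k * ∑ n ∈ Finset.Icc 1 N, ZMod.stdAddChar (-(k * (n : ZMod q)))‖ ≤
      q * (1 + Real.log q) := by
    have h6 : ∀ k : ZMod q,
        ‖χ⁻¹ k * ∑ n ∈ Finset.Icc 1 N, ZMod.stdAddChar (-(k * (n : ZMod q)))‖ ≤
        if k.val = 0 then 0 else (q : ℝ) / 2 * (1 / k.val + 1 / (q - k.val : ℕ)) := by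
      intro k
      split_ifs with h
      · have hk : k = 0 := (ZMod.val_eq_zero k).1 h
        rw [hk, DirichletCharacter.map_zero' _ hq.ne', zero_mul, norm_zero]
      · rw [norm_mul]
        have h7 := norm_sum_stdAddChar_le (Nat.pos_of_ne_zero h) (ZMod.val_lt k) N
        rw [ZMod.natCast_zmod_val] at h7
        calc _ ≤ 1 * _ := mul_le_mul_of_nonneg_right (DirichletCharacter.norm_le_one _ _)
              (norm_nonneg _)
          _ ≤ _ := by rw [one_mul]; exact h7
    refine (norm_sum_le _ _).trans ((Finset.sum_le_sum fun k _ => h6 k).trans ?_)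
    have h8 : ∑ k : ZMod q, (if k.val = 0 then (0 : ℝ)
          else (q : ℝ) / 2 * (1 / k.val + 1 / (q - k.val : ℕ))) =
        ∑ k ∈ Finset.range q, if k = 0 then (0 : ℝ)
          else (q : ℝ) / 2 * (1 / k + 1 / (q - k : ℕ)) := by
      refine Finset.sum_nbij' (fun k => k.val) (fun n => (n : ZMod q)) ?_ ?_ ?_ ?_ ?_
      · intro k _; exact Finset.mem_range.2 (ZMod.val_lt k)
      · intro n _; exact Finset.mem_univ _
      · intro k _; exact ZMod.natCast_zmod_val k
      · intro n hn; exact ZMod.val_natCast_of_lt (Finset.mem_range.1 hn)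
      · intro k _; rfl
    obtain ⟨r, rfl⟩ : ∃ r, q = r + 1 := ⟨q - 1, by omega⟩
    rw [h8, Finset.sum_range_succ']
    simp only [Nat.add_eq_zero_iff, one_ne_zero, and_false, if_false, if_true, add_zero]
    rw [← Finset.mul_sum, Finset.sum_add_distrib]
    have h9 : ∑ k ∈ Finset.range r, 1 / ((r + 1 - (k + 1) : ℕ) : ℝ) =
        ∑ k ∈ Finset.range r, 1 / ((k + 1 : ℕ) : ℝ) := by
      rw [← Finset.sum_range_reflect]
      refine Finset.sum_congr rfl fun k hk => ?_
      rw [Finset.mem_range] at hk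
      congr 2; omega
    rw [h9]
    have h10 : ∑ k ∈ Finset.range r, 1 / ((k + 1 : ℕ) : ℝ) ≤ 1 + Real.log (r + 1 : ℕ) := by
      have h11 := harmonic_le_one_add_log r
      have h12 : ((harmonic r : ℚ) : ℝ) = ∑ k ∈ Finset.range r, 1 / ((k + 1 : ℕ) : ℝ) := by
        rw [harmonic]; push_cast; simp
      rw [← h12]
      refine h11.trans ?_
      have : Real.log r ≤ Real.log (r + 1 : ℕ) := by
        refine Real.log_le_log ?_ ?_
        · exact_mod_cast (by omega : 0 < r)
        · push_cast; linarith
      linarith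
    nlinarith
  have h6 := congrArg norm h4
  rw [norm_mul, norm_mul, hτ, norm_gaussSum_of_isPrimitive hχ, Complex.norm_natCast] at h6
  have h7 : (q : ℝ) * ‖∑ n ∈ Finset.Icc 1 N, χ n‖ ≤
      q * (Real.sqrt q * (1 + Real.log q)) := by
    rw [h6]
    calc _ ≤ Real.sqrt q * (q * (1 + Real.log q)) :=
          mul_le_mul_of_nonneg_left h5 (Real.sqrt_nonneg _)
      _ = _ := by ring
  exact le_of_mul_le_mul_left h7 hq0

/-- A Dirichlet character as a function on the natural numbers. -/
def DirichletCharacter.toNatHom {q : ℕ} [NeZero q] [Fact (1 < q)] (χ : DirichletCharacter ℂ q) :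
    ℕ →*₀ ℂ where
  toFun n := χ n
  map_zero' := by
    rw [Nat.cast_zero]; exact DirichletCharacter.map_zero' _ (Fact.out : 1 < q).ne'
  map_one' := by simp
  map_mul' a b := by simp

/-- The Pólya–Vinogradov inequality for all characters `χ ≠ 1` modulo `q`. If `χ` is induced by the
primitive character `χ*` modulo `q*`, then `χ` is `χ*` restricted to the integers coprime to
`q / q*`, which costs a factor `d(q / q*) ≤ 2 √(q / q*)`. -/
theorem norm_sum_dirichletCharacter_le {q : ℕ} [NeZero q] {χ : DirichletCharacter ℂ q}
    (hχ : χ ≠ 1) (N : ℕ) :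
    ‖∑ n ∈ Finset.Icc 1 N, χ n‖ ≤ 2 * Real.sqrt q * (1 + Real.log q) := by
  set c := χ.conductor with hc
  have hc0 : c ≠ 0 := χ.conductor_ne_zero
  have hc1 : 1 < c := by
    have : c ≠ 1 := fun h => hχ (DirichletCharacter.eq_one_iff_conductor_eq_one.2 h)
    omega
  have : NeZero c := ⟨hc0⟩
  have : Fact (1 < c) := ⟨hc1⟩
  obtain ⟨r, hr⟩ : c ∣ q := χ.conductor_dvd_level
  have hr0 : r ≠ 0 := by rintro rfl; exact NeZero.ne q (by simpa using hr)
  set F : ℕ →*₀ ℂ := DirichletCharacter.toNatHom (q := c) χ.primitiveCharacter with hFdef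
  have hFapp : ∀ n, F n = χ.primitiveCharacter (n : ZMod χ.conductor) := fun n => rfl
  have hlog : 0 ≤ Real.log c := Real.log_natCast_nonneg _
  have hF : HasMeanValue F 0 (Real.sqrt c * (1 + Real.log c)) := by
    intro Z _
    rw [zero_mul, sub_zero]
    exact norm_sum_isPrimitive_le (q := c) hc1 χ.primitiveCharacter_isPrimitive _
  have h1 := hF.coprimePart (fun n => DirichletCharacter.norm_le_one _ _) hr0 N (by positivity)
  have h2 : ∀ n : ℕ, coprimePart r F n = χ n := by
    intro n
    rw [coprimePart_apply]
    by_cases hn : n.Coprime q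
    · have hn2 : n.Coprime r := Nat.Coprime.coprime_dvd_right ⟨c, by rw [hr]; ring⟩ hn
      rw [if_pos hn2, hFapp]
      have := DirichletCharacter.primitiveCharacter_apply_of_isCoprime χ (a := (n : ℤ))
        (Nat.isCoprime_iff_coprime.2 hn)
      simpa using this
    · have h3 : χ n = 0 := by
        have := (DirichletCharacter.apply_eq_zero_iff χ (n : ℤ)).2
          (by rwa [Nat.isCoprime_iff_coprime])
        simpa using this
      rw [h3]
      split_ifs with h4
      · have h5 : ¬ n.Coprime c := fun h5 => hn (by rw [hr]; exact Nat.Coprime.mul_right h5 h4)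
        have := (DirichletCharacter.apply_eq_zero_iff χ.primitiveCharacter (n : ℤ)).2
          (by rwa [Nat.isCoprime_iff_coprime])
        rw [hFapp]; simpa using this
      · rfl
  simp only [zero_mul, sub_zero, Nat.floor_natCast, h2] at h1
  refine h1.trans ?_
  have h4 : Real.sqrt q = Real.sqrt c * Real.sqrt r := by
    rw [hr]; push_cast; rw [Real.sqrt_mul (by positivity)]
  have h5 : Real.log c ≤ Real.log q := by
    refine Real.log_le_log (by positivity) ?_
    exact_mod_cast Nat.le_of_dvd (Nat.pos_of_ne_zero (NeZero.ne q)) ⟨r, hr⟩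
  calc (r.divisors.card : ℝ) * (Real.sqrt c * (1 + Real.log c))
      ≤ (2 * Real.sqrt r) * (Real.sqrt c * (1 + Real.log q)) := by
        refine mul_le_mul (card_divisors_le_two_mul_sqrt r) ?_ (by positivity) (by positivity)
        gcongr
    _ = _ := by rw [h4]; ring


/-! ### Multiplicative functions on squarefree integers -/

namespace ArithmeticFunction

/-- The product `μ² g`, the restriction of `g` to the squarefree integers. -/
def squarefreePart (g : ArithmeticFunction ℂ) : ArithmeticFunction ℂ :=
  ⟨fun n => if Squarefree n then g n else 0, by simp⟩

theorem squarefreePart_apply (g : ArithmeticFunction ℂ) (n : ℕ) :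
    squarefreePart g n = if Squarefree n then g n else 0 := rfl

theorem IsMultiplicative.squarefreePart {g : ArithmeticFunction ℂ} (hg : g.IsMultiplicative) :
    (squarefreePart g).IsMultiplicative := by
  refine ⟨by simp [squarefreePart_apply, hg.1], fun {m n} h => ?_⟩
  simp only [squarefreePart_apply, Nat.squarefree_mul h, hg.2 h]
  by_cases hm : Squarefree m <;> by_cases hn : Squarefree n <;> simp [hm, hn]

/-- The function `k = (μ² g) * μ`, for which `μ² g = 1 * k`. -/
def squarefreeCofactor (g : ArithmeticFunction ℂ) : ArithmeticFunction ℂ :=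
  squarefreePart g * (moebius : ArithmeticFunction ℂ)

theorem IsMultiplicative.squarefreeCofactor {g : ArithmeticFunction ℂ} (hg : g.IsMultiplicative) :
    (squarefreeCofactor g).IsMultiplicative :=
  hg.squarefreePart.mul isMultiplicative_moebius.intCast

theorem sum_divisors_squarefreeCofactor (g : ArithmeticFunction ℂ) (n : ℕ) :
    ∑ b ∈ n.divisors, squarefreeCofactor g b = squarefreePart g n := by
  rw [← coe_zeta_mul_apply, squarefreeCofactor, mul_comm, mul_assoc, coe_moebius_mul_coe_zeta,
    mul_one]

theorem squarefreeCofactor_prime_pow_succ (g : ArithmeticFunction ℂ) {p : ℕ} (hp : p.Prime)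
    (e : ℕ) : squarefreeCofactor g (p ^ (e + 1)) =
      squarefreePart g (p ^ (e + 1)) - squarefreePart g (p ^ e) := by
  rw [← sum_divisors_squarefreeCofactor, ← sum_divisors_squarefreeCofactor,
    Nat.sum_divisors_prime_pow hp, Nat.sum_divisors_prime_pow hp, Finset.sum_range_succ]
  ring

theorem squarefreePart_prime_pow (g : ArithmeticFunction ℂ) {p : ℕ} (hp : p.Prime) (e : ℕ) :
    squarefreePart g (p ^ (e + 2)) = 0 := by
  rw [squarefreePart_apply, if_neg]
  rw [Nat.squarefree_pow_iff hp.one_lt.ne' (by omega)]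
  omega

theorem squarefreeCofactor_prime {g : ArithmeticFunction ℂ} (hg : g.IsMultiplicative) {p : ℕ}
    (hp : p.Prime) : squarefreeCofactor g p = g p - 1 := by
  have := squarefreeCofactor_prime_pow_succ g hp 0
  simpa [squarefreePart_apply, hp.prime.squarefree, hg.1] using this

theorem squarefreeCofactor_prime_sq (g : ArithmeticFunction ℂ) {p : ℕ} (hp : p.Prime) :
    squarefreeCofactor g (p ^ 2) = -g p := by
  have := squarefreeCofactor_prime_pow_succ g hp 1
  rw [squarefreePart_prime_pow g hp 0] at this
  simpa [squarefreePart_apply, hp.prime.squarefree] using this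

theorem squarefreeCofactor_prime_pow (g : ArithmeticFunction ℂ) {p : ℕ} (hp : p.Prime) (e : ℕ) :
    squarefreeCofactor g (p ^ (e + 3)) = 0 := by
  rw [squarefreeCofactor_prime_pow_succ g hp (e + 2), squarefreePart_prime_pow g hp (e + 1),
    squarefreePart_prime_pow g hp e, sub_zero]

/-- The indicator function of the positive squares. -/
def squareIndicator : ArithmeticFunction ℝ :=
  open Classical in ⟨fun n => if n ≠ 0 ∧ IsSquare n then 1 else 0, by simp⟩

theorem squareIndicator_sq {a : ℕ} (ha : a ≠ 0) : squareIndicator (a ^ 2) = 1 := by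
  simp [squareIndicator, ha, IsSquare.sq a]

theorem squareIndicator_nonneg (n : ℕ) : 0 ≤ squareIndicator n := by
  change 0 ≤ ite _ _ _
  split_ifs <;> norm_num

theorem squareIndicator_of_not_isSquare {n : ℕ} (h : ¬ IsSquare n) : squareIndicator n = 0 := by
  simp [squareIndicator, h]

theorem isMultiplicative_squareIndicator : squareIndicator.IsMultiplicative := by
  refine ⟨by simp [squareIndicator], fun {m n} h => ?_⟩
  have h1 : IsSquare (m * n) ↔ IsSquare m ∧ IsSquare n := by
    refine ⟨fun ⟨c, hc⟩ => ?_, fun h => h.1.mul h.2⟩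
    rw [← sq] at hc
    obtain ⟨d, hd⟩ := exists_eq_pow_of_mul_eq_pow (Nat.isUnit_iff.2 h) hc
    obtain ⟨e, he⟩ := exists_eq_pow_of_mul_eq_pow (Nat.isUnit_iff.2 h.symm)
      ((mul_comm n m).trans hc)
    exact ⟨⟨d, by rw [hd, sq]⟩, ⟨e, by rw [he, sq]⟩⟩
  classical
  simp only [squareIndicator, coe_mk, h1, ne_eq, mul_eq_zero, not_or]
  by_cases h2 : m = 0 <;> by_cases h3 : n = 0 <;> by_cases h4 : IsSquare m <;>
    by_cases h5 : IsSquare n <;> simp [h2, h3, h4, h5]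

/-- The multiplicative function with the value `A / p` at all powers of `p`. -/
def radicalWeight (A : ℝ) : ArithmeticFunction ℝ := prodPrimeFactors fun p => A / p

theorem radicalWeight_prime_pow (A : ℝ) {p : ℕ} (hp : p.Prime) (e : ℕ) :
    radicalWeight A (p ^ (e + 1)) = A / p := by
  rw [radicalWeight, prodPrimeFactors_apply (pow_ne_zero _ hp.ne_zero),
    Nat.primeFactors_prime_pow (by omega) hp, Finset.prod_singleton]

theorem radicalWeight_nonneg {A : ℝ} (hA : 0 ≤ A) (n : ℕ) : 0 ≤ radicalWeight A n := by
  rcases eq_or_ne n 0 with rfl | hn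
  · simp
  · rw [radicalWeight, prodPrimeFactors_apply hn]
    exact Finset.prod_nonneg fun p _ => by positivity

theorem isMultiplicative_radicalWeight (A : ℝ) : (radicalWeight A).IsMultiplicative :=
  IsMultiplicative.prodPrimeFactors _

/-- Majorant of the cofactor `k`: it is enough to compare the two sides at prime powers, where
`k(p) = g(p) - 1`, `k(p²) = -g(p)`, and `k` vanishes at the higher powers. -/
theorem norm_squarefreeCofactor_le {A : ℝ} (hA : 0 ≤ A) {g : ArithmeticFunction ℂ}
    (hg : g.IsMultiplicative) (hgA : ∀ p : ℕ, p.Prime → ‖g p - 1‖ ≤ A / p) (n : ℕ) :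
    ‖squarefreeCofactor g n‖ ≤ (radicalWeight A * squareIndicator) n := by
  rcases eq_or_ne n 0 with rfl | hn
  · simp
  have hmul : (radicalWeight A * squareIndicator).IsMultiplicative :=
    (isMultiplicative_radicalWeight A).mul isMultiplicative_squareIndicator
  rw [hg.squarefreeCofactor.multiplicative_factorization _ hn,
    hmul.multiplicative_factorization _ hn, Finsupp.prod, Finsupp.prod, norm_prod]
  refine Finset.prod_le_prod (fun _ _ => norm_nonneg _) fun p hp => ?_
  have hp' : p.Prime := Nat.prime_of_mem_primeFactors hp
  have hpos : ∀ x ∈ (p ^ n.factorization p).divisorsAntidiagonal,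
      0 ≤ radicalWeight A x.1 * squareIndicator x.2 := fun x _ =>
    mul_nonneg (radicalWeight_nonneg hA _) (squareIndicator_nonneg _)
  rw [mul_apply]
  have hterm : ∀ x ∈ (p ^ n.factorization p).divisorsAntidiagonal,
      radicalWeight A x.1 * squareIndicator x.2 ≤
        ∑ x ∈ (p ^ n.factorization p).divisorsAntidiagonal,
          radicalWeight A x.1 * squareIndicator x.2 :=
    fun x hx => Finset.single_le_sum hpos hx
  have hone : squareIndicator 1 = 1 := isMultiplicative_squareIndicator.1
  have hrone : radicalWeight A 1 = 1 := (isMultiplicative_radicalWeight A).1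
  obtain h | h | h | ⟨e, h⟩ : n.factorization p = 0 ∨ n.factorization p = 1 ∨
      n.factorization p = 2 ∨ ∃ e, n.factorization p = e + 3 := by
    rcases h : n.factorization p with _ | _ | _ | e <;> simp
  · rw [h] at hterm ⊢
    simp [hg.squarefreeCofactor.1, hone, hrone]
  · rw [h] at hterm ⊢
    refine le_trans ?_ (hterm (p, 1) (by simp [hp'.ne_zero]))
    have := radicalWeight_prime_pow A hp' 0
    rw [zero_add, pow_one] at this
    rw [pow_one, squarefreeCofactor_prime hg hp', hone, this, mul_one]
    exact hgA p hp'
  · rw [h] at hpos ⊢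
    have hsub : ({(p ^ 2, 1), (1, p ^ 2)} : Finset (ℕ × ℕ)) ⊆ (p ^ 2).divisorsAntidiagonal := by
      intro x hx
      simp only [Finset.mem_insert, Finset.mem_singleton] at hx
      rw [Nat.mem_divisorsAntidiagonal]
      rcases hx with rfl | rfl <;> simp [hp'.ne_zero]
    refine le_trans ?_ (Finset.sum_le_sum_of_subset_of_nonneg hsub fun x hx _ => hpos x hx)
    rw [Finset.sum_pair (by
      intro h
      have := congrArg Prod.snd h
      have h2 := Nat.one_lt_pow (n := 2) (by norm_num) hp'.one_lt
      simp only at this; omega)]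
    have := radicalWeight_prime_pow A hp' 1
    simp only [squareIndicator_sq hp'.ne_zero, hone, this, hrone, squarefreeCofactor_prime_sq g hp',
      norm_neg, mul_one]
    calc ‖g p‖ = ‖(g p - 1) + 1‖ := by ring_nf
      _ ≤ ‖g p - 1‖ + ‖(1 : ℂ)‖ := norm_add_le _ _
      _ ≤ A / p + 1 := by rw [norm_one]; linarith [hgA p hp']
  · rw [h] at hpos ⊢
    rw [squarefreeCofactor_prime_pow g hp' e, norm_zero]
    exact Finset.sum_nonneg hpos

/-- The sum `∑ A^{ω(u)} / (rad(u) √u)` is bounded by its Euler product. -/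
theorem exists_sum_radicalWeight_le (A : ℝ) (hA : 0 ≤ A) : ∃ C : ℝ, 0 < C ∧ ∀ B : ℕ,
    ∑ u ∈ Finset.Icc 1 B, radicalWeight A u / Real.sqrt u ≤ C := by
  set f : ℕ → ℝ := fun u => radicalWeight A u / Real.sqrt u with hf
  have hnn : ∀ u, 0 ≤ f u := fun u => div_nonneg (radicalWeight_nonneg hA u) (Real.sqrt_nonneg _)
  have hf1 : f 1 = 1 := by simp [hf, (isMultiplicative_radicalWeight A).1]
  have hfm : ∀ {m n : ℕ}, m.Coprime n → f (m * n) = f m * f n := by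
    intro m n h
    simp only [hf, (isMultiplicative_radicalWeight A).2 h, Nat.cast_mul,
      Real.sqrt_mul (Nat.cast_nonneg m)]
    rw [mul_div_mul_comm]
  -- the local factor at `p` is `1 + O(p ^ (-3/2))`
  have hloc : ∀ {p : ℕ}, p.Prime → HasSum (fun e => f (p ^ e))
      (A / p * ((Real.sqrt p)⁻¹ * (1 - (Real.sqrt p)⁻¹)⁻¹) + 1) ∧
      A / p * ((Real.sqrt p)⁻¹ * (1 - (Real.sqrt p)⁻¹)⁻¹) ≤ 4 * A * ((p : ℝ) ^ (3 / 2 : ℝ))⁻¹ := by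
    intro p hp
    have hp2 : (2 : ℝ) ≤ p := by exact_mod_cast hp.two_le
    have hs : (4 / 3 : ℝ) ≤ Real.sqrt p := by
      refine Real.le_sqrt_of_sq_le ?_; norm_num; linarith
    have hs0 : 0 < Real.sqrt p := by linarith
    have hinv : (Real.sqrt p)⁻¹ ≤ 3 / 4 := by
      rw [inv_le_comm₀ hs0 (by norm_num)]; norm_num; linarith
    have hinv0 : 0 ≤ (Real.sqrt p)⁻¹ := by positivity
    refine ⟨?_, ?_⟩
    · have h1 : HasSum (fun e : ℕ => f (p ^ (e + 1)))
          (A / p * ((Real.sqrt p)⁻¹ * (1 - (Real.sqrt p)⁻¹)⁻¹)) := by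
        have h2 := (hasSum_geometric_of_lt_one hinv0 (by linarith)).mul_left
          (A / p * (Real.sqrt p)⁻¹)
        rw [mul_assoc] at h2
        refine h2.congr_fun ?_ |> id
        intro e
        have h3 : Real.sqrt ((p : ℝ) ^ (e + 1)) = Real.sqrt p ^ (e + 1) := by
          rw [Real.sqrt_eq_iff_mul_self_eq (by positivity) (by positivity), ← mul_pow,
            Real.mul_self_sqrt (by positivity)]
        simp only [hf, radicalWeight_prime_pow A hp e, Nat.cast_pow, h3]
        rw [pow_succ', inv_pow]
        field_simp
      have h4 := (hasSum_nat_add_iff (f := fun e => f (p ^ e)) 1).1 h1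
      simpa [hf1] using h4
    · have h5 : (1 - (Real.sqrt p)⁻¹)⁻¹ ≤ 4 := by
        rw [inv_le_comm₀ (by linarith) (by norm_num)]; linarith
      have h6 : ((p : ℝ) ^ (3 / 2 : ℝ))⁻¹ = (p : ℝ)⁻¹ * (Real.sqrt p)⁻¹ := by
        rw [← mul_inv, Real.sqrt_eq_rpow, ← Real.rpow_one_add' (by positivity) (by norm_num)]
        norm_num
      rw [h6]
      calc A / p * ((Real.sqrt p)⁻¹ * (1 - (Real.sqrt p)⁻¹)⁻¹)
          ≤ A / p * ((Real.sqrt p)⁻¹ * 4) := by gcongr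
        _ = _ := by field_simp
  have hsum : Summable fun n : ℕ => 4 * A * ((n : ℝ) ^ (3 / 2 : ℝ))⁻¹ :=
    (Real.summable_nat_rpow_inv.2 (by norm_num)).mul_left _
  refine ⟨Real.exp (∑' n : ℕ, 4 * A * ((n : ℝ) ^ (3 / 2 : ℝ))⁻¹), Real.exp_pos _, fun B => ?_⟩
  obtain ⟨h1, h2⟩ := EulerProduct.summable_and_hasSum_smoothNumbers_prod_primesBelow_tsum hf1 hfm
    (fun hp => by
      have := (hloc hp).1.summable
      simpa only [Real.norm_of_nonneg (hnn _)] using this) (B + 1)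
  have h3 : ∑ u ∈ Finset.Icc 1 B, f u ≤ ∑' m : (B + 1).smoothNumbers, f m := by
    have h4 : ∀ u ∈ Finset.Icc 1 B, u ∈ (B + 1).smoothNumbers := by
      intro u hu
      rw [Finset.mem_Icc] at hu
      rw [Nat.mem_smoothNumbers']
      intro p _ hpu
      have := Nat.le_of_dvd (by omega) hpu
      omega
    have h5 : ∑ u ∈ Finset.Icc 1 B, f u = ∑ x ∈ (Finset.Icc 1 B).subtype (· ∈ (B + 1).smoothNumbers),
        f x := by
      rw [Finset.sum_subtype_of_mem _ h4]
    rw [h5]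
    exact h2.summable.sum_le_tsum _ fun x _ => hnn _
  refine h3.trans ?_
  rw [h2.tsum_eq]
  calc ∏ p ∈ (B + 1).primesBelow, ∑' n : ℕ, f (p ^ n)
      ≤ ∏ p ∈ (B + 1).primesBelow, Real.exp (4 * A * ((p : ℝ) ^ (3 / 2 : ℝ))⁻¹) := by
        refine Finset.prod_le_prod (fun p _ => tsum_nonneg fun e => hnn _) fun p hp => ?_
        obtain ⟨h6, h7⟩ := hloc (Nat.prime_of_mem_primesBelow hp)
        rw [h6.tsum_eq]
        exact (add_le_add_left h7 1).trans (Real.add_one_le_exp _)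
    _ = Real.exp (∑ p ∈ (B + 1).primesBelow, 4 * A * ((p : ℝ) ^ (3 / 2 : ℝ))⁻¹) :=
        (Real.exp_sum _ _).symm
    _ ≤ _ := Real.exp_le_exp.2 (hsum.sum_le_tsum _ fun _ _ => by positivity)

/-- The terms are compared with the differences of `4 M T a / (T + a)`, where `T = √(X / M)`. -/
theorem sum_min_div_sq_le {X M : ℝ} (hX : 0 ≤ X) (hM : 0 ≤ M) (B : ℕ) :
    ∑ a ∈ Finset.Icc 1 B, min (X / (a : ℝ) ^ 2) M ≤ 4 * Real.sqrt (X * M) := by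
  rcases hX.eq_or_lt with rfl | hX
  · simp [min_eq_left hM]
  rcases hM.eq_or_lt with rfl | hM
  · rw [mul_zero, Real.sqrt_zero, mul_zero]
    exact Finset.sum_nonpos fun a _ => min_le_right _ _
  set T := Real.sqrt (X / M) with hT
  have hT0 : 0 < T := Real.sqrt_pos.2 (by positivity)
  have hT2 : T ^ 2 = X / M := Real.sq_sqrt (by positivity)
  have hXT : X = M * T ^ 2 := by rw [hT2]; field_simp
  have hMT : Real.sqrt (X * M) = M * T := by
    rw [Real.sqrt_eq_iff_mul_self_eq (by positivity) (by positivity), hXT]; ring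
  have key : ∑ a ∈ Finset.Icc 1 B, min (X / (a : ℝ) ^ 2) M ≤ 4 * (M * T) * (B / (T + B)) := by
    induction B with
    | zero => simp
    | succ b ih =>
      rw [Finset.sum_Icc_succ_top (by omega)]
      have hb : (0 : ℝ) ≤ b := by positivity
      have h1 : min (X / ((b + 1 : ℕ) : ℝ) ^ 2) M ≤
          4 * (M * T) * (T / ((T + b) * (T + (b + 1)))) := by
        have h2 : 4 * (M * T) * (T / ((T + b) * (T + (b + 1)))) =
            4 * M * T ^ 2 / ((T + b) * (T + (b + 1))) := by ring
        rw [h2]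
        rcases le_total T (b + 1) with h | h
        · refine (min_le_left _ _).trans ?_
          rw [hXT, div_le_div_iff₀ (by positivity) (by positivity)]
          push_cast
          have h3 : (T + b) * (T + (b + 1)) ≤ 4 * ((b : ℝ) + 1) ^ 2 := by nlinarith
          calc M * T ^ 2 * ((T + b) * (T + (b + 1)))
              ≤ M * T ^ 2 * (4 * ((b : ℝ) + 1) ^ 2) := by gcongr
            _ = _ := by ring
        · refine (min_le_right _ _).trans ?_
          rw [le_div_iff₀ (by positivity)]
          have h3 : (T + b) * (T + (b + 1)) ≤ 4 * T ^ 2 := by nlinarith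
          calc M * ((T + b) * (T + (b + 1))) ≤ M * (4 * T ^ 2) := by gcongr
            _ = _ := by ring
      refine (add_le_add ih h1).trans (le_of_eq ?_)
      rw [← mul_add]
      congr 1
      push_cast
      field_simp
      ring
  refine key.trans ?_
  rw [hMT]
  have h1 : (B : ℝ) / (T + B) ≤ 1 := by
    rw [div_le_one (by positivity)]; linarith
  have h2 : 0 ≤ 4 * (M * T) := by positivity
  calc 4 * (M * T) * (B / (T + B)) ≤ 4 * (M * T) * 1 := mul_le_mul_of_nonneg_left h1 h2
    _ = _ := by ring

/-- The error of the convolution method. By the majorant for the cofactor, `b = u a²` with weight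
`radicalWeight A u`; the sum over `a` gives `√(X M / u)`, and the sum over `u` then converges. -/
theorem exists_sum_squarefreeCofactor_le (A : ℝ) (hA : 0 ≤ A) : ∃ C : ℝ, 0 < C ∧
    ∀ g : ArithmeticFunction ℂ, g.IsMultiplicative → (∀ p : ℕ, p.Prime → ‖g p - 1‖ ≤ A / p) →
    ∀ X M : ℝ, 0 ≤ X → 0 ≤ M → ∀ B : ℕ,
      ∑ b ∈ Finset.Icc 1 B, ‖squarefreeCofactor g b‖ * min (X / b) M ≤ C * Real.sqrt (X * M) := by
  obtain ⟨C, hC, hCb⟩ := exists_sum_radicalWeight_le A hA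
  refine ⟨C * 4, by positivity, fun g hg hgA X M hX hM B => ?_⟩
  have hmin : ∀ x : ℝ, 0 ≤ x → 0 ≤ min (X / x) M := fun x hx => le_min (by positivity) hM
  calc ∑ b ∈ Finset.Icc 1 B, ‖squarefreeCofactor g b‖ * min (X / b) M
      ≤ ∑ b ∈ Finset.Icc 1 B, (∑ x ∈ b.divisorsAntidiagonal,
          radicalWeight A x.1 * squareIndicator x.2) * min (X / b) M := by
        refine Finset.sum_le_sum fun b _ => mul_le_mul_of_nonneg_right ?_ (hmin _ (by positivity))
        exact (norm_squarefreeCofactor_le hA hg hgA b).trans (le_of_eq (mul_apply))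
    _ = ∑ y ∈ (Finset.Icc 1 B).sigma fun b => b.divisorsAntidiagonal,
          radicalWeight A y.2.1 * squareIndicator y.2.2 * min (X / y.1) M := by
        rw [Finset.sum_sigma]
        simp_rw [Finset.sum_mul]
    _ = ∑ y ∈ ((Finset.Icc 1 B).sigma fun b => b.divisorsAntidiagonal) with IsSquare y.2.2,
          radicalWeight A y.2.1 * squareIndicator y.2.2 * min (X / y.1) M := by
        symm
        refine Finset.sum_filter_of_ne fun y _ hy => ?_
        by_contra h
        exact hy (by rw [squareIndicator_of_not_isSquare h]; ring)
    _ ≤ ∑ y ∈ Finset.Icc 1 B ×ˢ Finset.Icc 1 B,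
          radicalWeight A y.1 * min (X / y.1 / (y.2 : ℝ) ^ 2) M := by
        have hinj : ∀ y ∈ ((Finset.Icc 1 B).sigma fun b => b.divisorsAntidiagonal).filter
            (fun y => IsSquare y.2.2), y.1 = y.2.1 * y.2.2 ∧ y.2.2 = y.2.2.sqrt ^ 2 ∧ 0 < y.1 ∧
              y.1 ≤ B := by
          intro y hy
          rw [Finset.mem_filter, Finset.mem_sigma, Nat.mem_divisorsAntidiagonal,
            Finset.mem_Icc] at hy
          obtain ⟨a, ha⟩ := hy.2
          exact ⟨hy.1.2.1.symm, by rw [ha, Nat.sqrt_eq, sq], hy.1.1.1, hy.1.1.2⟩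
        have hterm : ∀ y ∈ ((Finset.Icc 1 B).sigma fun b => b.divisorsAntidiagonal).filter
            (fun y => IsSquare y.2.2),
            radicalWeight A y.2.1 * squareIndicator y.2.2 * min (X / y.1) M =
            (fun z : ℕ × ℕ => radicalWeight A z.1 * min (X / z.1 / (z.2 : ℝ) ^ 2) M)
              (y.2.1, y.2.2.sqrt) := by
          intro y hy
          obtain ⟨h1, h2, h3, -⟩ := hinj y hy
          have h4 : y.2.2.sqrt ≠ 0 := by
            intro h; rw [h] at h2; rw [h1, h2] at h3; simp at h3
          have h5 : squareIndicator y.2.2 = 1 := by rw [h2]; exact squareIndicator_sq h4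
          simp only
          rw [h5, mul_one, div_div]
          congr 3
          rw [h1]
          conv_lhs => rw [h2]
          push_cast
          ring
        rw [Finset.sum_congr rfl hterm, ← Finset.sum_image (f := fun z : ℕ × ℕ =>
          radicalWeight A z.1 * min (X / z.1 / (z.2 : ℝ) ^ 2) M)
          (g := fun y : (_ : ℕ) × ℕ × ℕ => (y.2.1, y.2.2.sqrt))]
        · refine Finset.sum_le_sum_of_subset_of_nonneg ?_ fun z _ _ =>
            mul_nonneg (radicalWeight_nonneg hA _) (le_min (by positivity) hM)
          intro z hz
          obtain ⟨y, hy, rfl⟩ := Finset.mem_image.1 hz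
          obtain ⟨h1, h2, h3, h4⟩ := hinj y hy
          have h5 : 0 < y.2.1 := Nat.pos_of_ne_zero fun h => by rw [h1, h] at h3; simp at h3
          have h6 : 0 < y.2.2 := Nat.pos_of_ne_zero fun h => by rw [h1, h] at h3; simp at h3
          have h7 : y.2.1 ≤ y.1 := by rw [h1]; exact Nat.le_mul_of_pos_right _ h6
          have h8 : y.2.2 ≤ y.1 := by rw [h1]; exact Nat.le_mul_of_pos_left _ h5
          simp only [Finset.mem_product, Finset.mem_Icc]
          exact ⟨⟨h5, h7.trans h4⟩, Nat.sqrt_pos.2 h6, (Nat.sqrt_le_self _).trans (h8.trans h4)⟩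
        · rintro ⟨b, u, v⟩ hy ⟨b', u', v'⟩ hy' h
          obtain ⟨h1, h2, -, -⟩ := hinj _ hy
          obtain ⟨h1', h2', -, -⟩ := hinj _ hy'
          simp only [Prod.mk.injEq] at h h1 h2 h1' h2'
          have hu := h.1
          have hv : v = v' := by rw [h2, h2', h.2]
          subst hu hv
          rw [h1, h1']
    _ = ∑ u ∈ Finset.Icc 1 B, radicalWeight A u *
          ∑ a ∈ Finset.Icc 1 B, min (X / u / (a : ℝ) ^ 2) M := by
        rw [Finset.sum_product]
        simp_rw [Finset.mul_sum]
    _ ≤ ∑ u ∈ Finset.Icc 1 B, radicalWeight A u * (4 * Real.sqrt (X / u * M)) := by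
        refine Finset.sum_le_sum fun u _ =>
          mul_le_mul_of_nonneg_left ?_ (radicalWeight_nonneg hA u)
        exact sum_min_div_sq_le (by positivity) hM B
    _ = (∑ u ∈ Finset.Icc 1 B, radicalWeight A u / Real.sqrt u) * (4 * Real.sqrt (X * M)) := by
        rw [Finset.sum_mul]
        refine Finset.sum_congr rfl fun u _ => ?_
        rw [div_mul_eq_mul_div X, Real.sqrt_div (by positivity)]
        ring
    _ ≤ C * (4 * Real.sqrt (X * M)) := by gcongr; exact hCb B
    _ = _ := by ring

end ArithmeticFunction

open ArithmeticFunction in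
/-- The hyperbola-free form of the convolution method: writing `μ² g = 1 * k`, every `b` contributes
`k(b) F(b)` times a partial sum of `F` of length `X / b`, which differs from its mean value by at
most `min (2 X / b) M`. -/
theorem exists_sum_squarefreePart_le (A : ℝ) (hA : 0 ≤ A) : ∃ C : ℝ, 0 < C ∧
    ∀ g : ArithmeticFunction ℂ, g.IsMultiplicative → (∀ p : ℕ, p.Prime → ‖g p - 1‖ ≤ A / p) →
      (Summable fun b : ℕ => ‖squarefreeCofactor g b‖ / b) ∧
      ∀ (F : ℕ →*₀ ℂ) (ρ : ℂ) (M : ℝ), (∀ n, ‖F n‖ ≤ 1) → ‖ρ‖ ≤ 1 → HasMeanValue F ρ M →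
      ∀ X : ℝ, 0 ≤ X →
        ‖∑ n ∈ Finset.Icc 1 ⌊X⌋₊, squarefreePart g n * F n -
          ρ * X * ∑' b : ℕ, squarefreeCofactor g b * F b / b‖ ≤ C * Real.sqrt (X * M) := by
  obtain ⟨C, hC, hCb⟩ := exists_sum_squarefreeCofactor_le A hA
  refine ⟨C * Real.sqrt 2, by positivity, fun g hg hgA => ?_⟩
  set k := squarefreeCofactor g with hk
  have hIcc : ∀ (E : Type) [AddCommMonoid E] (f : ℕ → E), f 0 = 0 → ∀ B : ℕ,
      ∑ b ∈ Finset.range (B + 1), f b = ∑ b ∈ Finset.Icc 1 B, f b := by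
    intro E _ f hf B
    rw [Finset.sum_range_succ', hf, add_zero, Finset.range_eq_Ico,
      Finset.sum_Ico_add' f 0 B 1]
    refine Finset.sum_congr ?_ fun _ _ => rfl
    ext x; simp only [Finset.mem_Icc, Finset.mem_Ico]; omega
  have hsum : Summable fun b : ℕ => ‖k b‖ / b := by
    refine summable_of_sum_range_le (c := C) (fun b => by positivity) fun n => ?_
    have h1 := hCb g hg hgA 1 1 zero_le_one zero_le_one n
    rw [mul_one, Real.sqrt_one, mul_one] at h1
    refine le_trans ?_ h1
    refine (Finset.sum_le_sum_of_subset_of_nonneg (Finset.range_mono (Nat.le_succ n))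
      fun b _ _ => by positivity).trans ?_
    rw [hIcc ℝ (fun b : ℕ => ‖k b‖ / b) (by simp) n]
    refine Finset.sum_le_sum fun b hb => ?_
    rw [Finset.mem_Icc] at hb
    have hb1 : (1 : ℝ) ≤ b := by exact_mod_cast hb.1
    rw [min_eq_left (by rw [div_le_one (by positivity)]; exact hb1), mul_one_div]
  refine ⟨hsum, fun F ρ M hF hρ hFM X hX => ?_⟩
  have hM : 0 ≤ M := (norm_nonneg _).trans (hFM 0 le_rfl)
  have hsumF : Summable fun b : ℕ => k b * F b / b := by
    refine Summable.of_norm_bounded hsum fun b => ?_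
    rw [norm_div, norm_mul, Complex.norm_natCast]
    have : ‖k b‖ * ‖F b‖ ≤ ‖k b‖ := mul_le_of_le_one_right (norm_nonneg _) (hF b)
    gcongr
  -- the sum over `n`, rearranged according to the divisor `b` in `μ² g = 1 * k`
  have hconv : ∀ B : ℕ, ⌊X⌋₊ ≤ B → ∑ n ∈ Finset.Icc 1 ⌊X⌋₊, squarefreePart g n * F n =
      ∑ b ∈ Finset.Icc 1 B, k b * F b * ∑ l ∈ Finset.Icc 1 ⌊X / b⌋₊, F l := by
    intro B hB
    have h1 : ∀ n ∈ Finset.Icc 1 ⌊X⌋₊, squarefreePart g n * F n =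
        ∑ b ∈ Finset.Icc 1 B, if b ∣ n then k b * F n else 0 := by
      intro n hn
      rw [Finset.mem_Icc] at hn
      rw [← sum_divisors_squarefreeCofactor, ← Finset.sum_filter, ← Finset.sum_mul]
      congr 1
      refine Finset.sum_congr ?_ fun _ _ => rfl
      ext b
      simp only [Nat.mem_divisors, Finset.mem_filter, Finset.mem_Icc]
      refine ⟨fun h => ⟨⟨Nat.pos_of_dvd_of_pos h.1 hn.1, ?_⟩, h.1⟩, fun h => ⟨h.2, by omega⟩⟩
      exact (Nat.le_of_dvd hn.1 h.1).trans (hn.2.trans hB)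
    rw [Finset.sum_congr rfl h1, Finset.sum_comm]
    refine Finset.sum_congr rfl fun b hb => ?_
    rw [Finset.mem_Icc] at hb
    rw [← Finset.sum_filter, sum_Icc_filter_dvd _ hb.1, Nat.floor_div_natCast, Finset.mul_sum]
    refine Finset.sum_congr rfl fun l _ => ?_
    rw [map_mul, mul_assoc]
  have hbound : ∀ B : ℕ, ⌊X⌋₊ ≤ B → ‖∑ n ∈ Finset.Icc 1 ⌊X⌋₊, squarefreePart g n * F n -
      ρ * X * ∑ b ∈ Finset.range (B + 1), k b * F b / b‖ ≤ C * Real.sqrt 2 * Real.sqrt (X * M) := by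
    intro B hB
    rw [hconv B hB, hIcc ℂ (fun b : ℕ => k b * F b / b) (by simp) B, Finset.mul_sum,
      ← Finset.sum_sub_distrib]
    refine (norm_sum_le _ _).trans ?_
    have h2 := hCb g hg hgA (2 * X) M (by positivity) hM B
    rw [mul_assoc 2, Real.sqrt_mul (by norm_num), ← mul_assoc] at h2
    refine le_trans (Finset.sum_le_sum fun b hb => ?_) h2
    rw [Finset.mem_Icc] at hb
    have h3 : k b * F b * ∑ l ∈ Finset.Icc 1 ⌊X / b⌋₊, F l - ρ * X * (k b * F b / b) =
        k b * (F b * (∑ l ∈ Finset.Icc 1 ⌊X / b⌋₊, F l - ρ * ((X / b : ℝ) : ℂ))) := by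
      push_cast; ring
    rw [h3, norm_mul]
    refine mul_le_mul_of_nonneg_left ?_ (norm_nonneg _)
    rw [norm_mul]
    refine (mul_le_of_le_one_left (norm_nonneg _) (hF b)).trans (le_min ?_ (hFM _ (by positivity)))
    have h4 : ‖∑ l ∈ Finset.Icc 1 ⌊X / b⌋₊, F l‖ ≤ X / b := by
      calc _ ≤ ∑ l ∈ Finset.Icc 1 ⌊X / b⌋₊, ‖F l‖ := norm_sum_le _ _
        _ ≤ ∑ l ∈ Finset.Icc 1 ⌊X / b⌋₊, (1 : ℝ) := Finset.sum_le_sum fun l _ => hF l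
        _ = ⌊X / b⌋₊ := by simp
        _ ≤ X / b := Nat.floor_le (by positivity)
    have h5 : ‖ρ * ((X / b : ℝ) : ℂ)‖ ≤ X / b := by
      rw [norm_mul, Complex.norm_real, Real.norm_of_nonneg (by positivity)]
      exact mul_le_of_le_one_left (by positivity) hρ
    calc _ ≤ X / b + X / b := (norm_sub_le _ _).trans (add_le_add h4 h5)
      _ = 2 * X / b := by ring
  -- the bound does not depend on the range `B` of the sum over `b`, so `B` may tend to infinity
  have hlim : Filter.Tendsto (fun B : ℕ => ‖∑ n ∈ Finset.Icc 1 ⌊X⌋₊, squarefreePart g n * F n -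
      ρ * X * ∑ b ∈ Finset.range (B + 1), k b * F b / b‖) Filter.atTop
      (nhds ‖∑ n ∈ Finset.Icc 1 ⌊X⌋₊, squarefreePart g n * F n -
        ρ * X * ∑' b : ℕ, k b * F b / b‖) := by
    have h6 := (hsumF.hasSum.tendsto_sum_nat).comp (Filter.tendsto_add_atTop_nat 1)
    exact ((h6.const_mul (ρ * X)).const_sub _).norm
  refine le_of_tendsto hlim ?_
  filter_upwards [Filter.eventually_ge_atTop ⌊X⌋₊] with B hB using hbound B hB

/-! ### Integers coprime to `P` -/

/-- The function that is `1` at all positive integers. -/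
def natOne : ℕ →*₀ ℂ where
  toFun n := if n = 0 then 0 else 1
  map_zero' := by simp
  map_one' := by simp
  map_mul' a b := by by_cases ha : a = 0 <;> by_cases hb : b = 0 <;> simp [ha, hb]

theorem coprimePart_natOne_apply {P : ℕ} (hP : P ≠ 1) (n : ℕ) :
    coprimePart P natOne n = if n.Coprime P then 1 else 0 := by
  rw [coprimePart_apply]
  split_ifs with h
  · have : n ≠ 0 := by rintro rfl; exact hP (by simpa using h)
    simp [natOne, this]
  · rfl

theorem hasMeanValue_natOne : HasMeanValue natOne 1 1 := by
  intro Z hZ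
  have h1 : ∑ n ∈ Finset.Icc 1 ⌊Z⌋₊, natOne n = (⌊Z⌋₊ : ℂ) := by
    rw [Finset.sum_congr rfl (g := fun _ => (1 : ℂ))]
    · simp
    · intro n hn
      rw [Finset.mem_Icc] at hn
      simp [natOne, show n ≠ 0 by omega]
  rw [h1, one_mul]
  have h2 : ((⌊Z⌋₊ : ℂ) - (Z : ℂ)) = (((⌊Z⌋₊ : ℝ) - Z : ℝ) : ℂ) := by push_cast; rfl
  rw [h2, Complex.norm_real, Real.norm_eq_abs, abs_le]
  constructor <;> linarith [Nat.floor_le hZ, Nat.lt_floor_add_one Z]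

/-- The density of the integers coprime to `P`. -/
def coprimeDensity (P : ℕ) : ℂ := ∏ p ∈ P.primeFactors, (1 - 1 / (p : ℂ))

theorem norm_coprimeDensity_le (P : ℕ) : ‖coprimeDensity P‖ ≤ 1 := by
  rw [coprimeDensity, norm_prod]
  refine Finset.prod_le_one (fun _ _ => norm_nonneg _) fun p hp => ?_
  have hp1 : (1 : ℝ) ≤ p := by exact_mod_cast (Nat.prime_of_mem_primeFactors hp).one_le
  have h1 : (1 - 1 / (p : ℂ)) = ((1 - 1 / (p : ℝ) : ℝ) : ℂ) := by push_cast; rfl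
  have h2 : 1 / (p : ℝ) ≤ 1 := by rw [div_le_one (by positivity)]; exact hp1
  have h3 : 0 ≤ 1 / (p : ℝ) := by positivity
  rw [h1, Complex.norm_real, Real.norm_eq_abs, abs_le]
  constructor <;> linarith

/-- Legendre's sieve, with the trivial bound for the remainder. -/
theorem hasMeanValue_coprimePart_natOne {P : ℕ} (hP : P ≠ 0) :
    HasMeanValue (coprimePart P natOne) (coprimeDensity P) P.divisors.card := by
  -- pass to the radical of `P`, for which the density is a sum over divisors
  set R := ∏ p ∈ P.primeFactors, p with hR
  have hRdvd : R ∣ P := Nat.prod_primeFactors_dvd P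
  have hR0 : R ≠ 0 := by rintro h; rw [h] at hRdvd; exact hP (by simpa using hRdvd)
  have hRpf : R.primeFactors = P.primeFactors :=
    Nat.primeFactors_prod fun p hp => Nat.prime_of_mem_primeFactors hp
  have hRsq : Squarefree R := by
    rw [hR]
    refine Finset.squarefree_prod_of_pairwise_isCoprime ?_ fun p hp =>
      (Nat.prime_of_mem_primeFactors hp).prime.squarefree
    intro p hp q hq hpq
    exact (Nat.coprime_iff_isRelPrime.1 ((Nat.coprime_primes (Nat.prime_of_mem_primeFactors hp)
      (Nat.prime_of_mem_primeFactors hq)).2 hpq))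
  have h1 := hasMeanValue_natOne.coprimePart (r := R)
    (fun n => by by_cases h : n = 0 <;> simp [natOne, h]) hR0
  have h2 : (1 : ℂ) * ∑ t ∈ R.divisors, (ArithmeticFunction.moebius t : ℂ) * natOne t / t =
      coprimeDensity P := by
    have h3 := ArithmeticFunction.IsMultiplicative.prodPrimeFactors_one_sub_of_squarefree
      (R := ℂ) (f := (⟨fun n => 1 / (n : ℂ), by simp⟩ : ArithmeticFunction ℂ))
      ⟨by simp, fun {m n} _ => by simp [mul_comm]⟩ hRsq
    rw [hRpf] at h3
    rw [one_mul, coprimeDensity]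
    refine Eq.trans (Finset.sum_congr rfl fun t ht => ?_) h3.symm
    have ht0 : t ≠ 0 := (Nat.pos_of_mem_divisors ht).ne'
    simp [natOne, ht0, div_eq_mul_inv]
  rw [h2, mul_one] at h1
  intro Z hZ
  have h4 : ∀ n, coprimePart P natOne n = coprimePart R natOne n := by
    intro n
    rw [coprimePart_apply, coprimePart_apply]
    rcases eq_or_ne n 0 with rfl | hn
    · simp
    congr 1
    rw [← Nat.disjoint_primeFactors hn hP, ← Nat.disjoint_primeFactors hn hR0, hRpf]
  simp_rw [h4]
  refine (h1 Z hZ).trans ?_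
  exact_mod_cast Finset.card_le_card (Nat.divisors_subset_of_dvd hP hRdvd)

/-! ### The Euler product of the cofactor series -/

/-- The Euler factor `(1 - 1/p)(1 + g(p)/p)`. -/
def localFactor (g : ArithmeticFunction ℂ) (p : ℕ) : ℂ := (1 - 1 / (p : ℂ)) * (1 + g p / p)

open ArithmeticFunction in
/-- The local factor at `p ∤ P` is `1 + k(p)/p + k(p²)/p²`, which is `(1 - 1/p)(1 + g(p)/p)`. -/
theorem hasProd_squarefreeCofactor {g : ArithmeticFunction ℂ} (hg : g.IsMultiplicative)
    (hsum : Summable fun b : ℕ => ‖squarefreeCofactor g b‖ / b) (P : ℕ) :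
    HasProd (fun p : Nat.Primes => if (p : ℕ) ∣ P then 1 else localFactor g p)
      (∑' b : ℕ, squarefreeCofactor g b * coprimePart P natOne b / b) := by
  set f : ℕ → ℂ := fun b => squarefreeCofactor g b * coprimePart P natOne b / b with hf
  have hone : squarefreeCofactor g 1 = 1 := hg.squarefreeCofactor.1
  have hn1 : ∀ n, ‖natOne n‖ ≤ 1 := fun n => by by_cases h : n = 0 <;> simp [natOne, h]
  have h1 : HasProd (fun p : Nat.Primes => ∑' e : ℕ, f ((p : ℕ) ^ e)) (∑' b, f b) := by
    refine EulerProduct.eulerProduct_hasProd ?_ ?_ ?_ ?_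
    · simp [hf, hone]
    · intro m n h
      simp only [hf, hg.squarefreeCofactor.2 h, map_mul, Nat.cast_mul]
      rw [mul_mul_mul_comm, mul_div_mul_comm]
    · refine Summable.of_nonneg_of_le (fun _ => norm_nonneg _) (fun b => ?_) hsum
      rw [hf, norm_div, norm_mul, Complex.norm_natCast]
      have : ‖coprimePart P natOne b‖ ≤ 1 := (norm_coprimePart_le _ _ _).trans (hn1 b)
      have := mul_le_of_le_one_right (norm_nonneg (squarefreeCofactor g b)) this
      gcongr
    · simp [hf]
  convert h1 using 2 with p
  have hp := p.2
  have hp0 : (p : ℂ) ≠ 0 := by exact_mod_cast hp.ne_zero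
  split_ifs with h
  · rw [tsum_eq_single 0]
    · simp [hf, hone]
    · intro e he
      have : ¬ ((p : ℕ) ^ e).Coprime P := by
        rw [Nat.coprime_pow_left_iff (Nat.pos_of_ne_zero he), hp.coprime_iff_not_dvd]
        exact fun h' => h' h
      simp [hf, coprimePart_apply, this]
  · have hcop : ∀ e : ℕ, coprimePart P natOne ((p : ℕ) ^ e) = 1 := by
      intro e
      rw [map_pow, coprimePart_apply, if_pos ((hp.coprime_iff_not_dvd).2 h)]
      simp [natOne, hp.ne_zero]
    rw [tsum_eq_sum (s := Finset.range 3)]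
    · simp only [Finset.sum_range_succ, Finset.sum_range_zero, hf, hcop, pow_zero, hone, pow_one,
        squarefreeCofactor_prime hg hp, squarefreeCofactor_prime_sq g hp, localFactor]
      push_cast
      field_simp
      ring
    · intro e he
      obtain ⟨j, rfl⟩ : ∃ j, e = j + 3 := ⟨e - 3, by rw [Finset.mem_range] at he; omega⟩
      simp [hf, squarefreeCofactor_prime_pow g hp j]


/-! ### Twisted Jacobi symbols as characters -/

/-- The Pólya–Vinogradov inequality for a completely multiplicative function that comes from a
nontrivial character modulo `q`. -/
theorem hasMeanValue_of_periodic {q : ℕ} (hq : 1 < q) (F : ℕ →*₀ ℂ)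
    (hper : ∀ a b : ℕ, a ≡ b [MOD q] → F a = F b) (hzero : ∀ n : ℕ, ¬ n.Coprime q → F n = 0)
    (hne : ∃ n : ℕ, n.Coprime q ∧ F n ≠ 1) :
    HasMeanValue F 0 (2 * Real.sqrt q * (1 + Real.log q)) := by
  have : NeZero q := ⟨by omega⟩
  let χ : DirichletCharacter ℂ q :=
    { toFun := fun a => F a.val
      map_one' := by
        rw [← map_one F]
        refine hper _ _ ?_
        rw [← ZMod.natCast_eq_natCast_iff, ZMod.natCast_zmod_val, Nat.cast_one]
      map_mul' := fun a b => by
        rw [← map_mul]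
        refine hper _ _ ?_
        rw [← ZMod.natCast_eq_natCast_iff]
        simp
      map_nonunit' := fun a ha => by
        refine hzero _ fun h => ha ?_
        rw [← ZMod.natCast_zmod_val a]
        exact (ZMod.isUnit_iff_coprime _ _).2 h }
  have hχ : ∀ n : ℕ, χ n = F n := fun n => hper _ _ (by
    rw [← ZMod.natCast_eq_natCast_iff, ZMod.natCast_zmod_val])
  have hχ1 : χ ≠ 1 := by
    obtain ⟨n, hn, hFn⟩ := hne
    intro h
    apply hFn
    rw [← hχ n, h]
    exact MulChar.one_apply ((ZMod.isUnit_iff_coprime _ _).2 hn)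
  intro Z _
  rw [zero_mul, sub_zero]
  simp_rw [← hχ]
  exact norm_sum_dirichletCharacter_le hχ1 _

/-- The function `n ↦ ψ(n) (n / b)`, for a character `ψ` modulo `8`. -/
def jacobiTwist (ψ : DirichletCharacter ℂ 8) (b : ℕ) : ℕ →*₀ ℂ where
  toFun n := ψ n * (jacobiSym n b : ℂ)
  map_zero' := by
    rw [Nat.cast_zero, DirichletCharacter.map_zero' _ (by norm_num), zero_mul]
  map_one' := by simp
  map_mul' m n := by
    push_cast
    rw [map_mul, jacobiSym.mul_left]
    push_cast
    ring

theorem jacobiTwist_apply (ψ : DirichletCharacter ℂ 8) (b n : ℕ) :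
    jacobiTwist ψ b n = ψ n * (jacobiSym n b : ℂ) := rfl

theorem norm_jacobiSym_le (a : ℤ) (b : ℕ) : ‖(jacobiSym a b : ℂ)‖ ≤ 1 := by
  rcases jacobiSym.trichotomy a b with h | h | h <;> simp [h]

theorem norm_jacobiTwist_le (ψ : DirichletCharacter ℂ 8) (b n : ℕ) : ‖jacobiTwist ψ b n‖ ≤ 1 := by
  rw [jacobiTwist_apply, norm_mul]
  exact mul_le_one₀ (DirichletCharacter.norm_le_one _ _) (norm_nonneg _) (norm_jacobiSym_le _ _)

theorem jacobiSym_natCast_congr {m n b : ℕ} (h : m ≡ n [MOD b]) : jacobiSym m b = jacobiSym n b := by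
  refine jacobiSym.mod_left' ?_
  exact_mod_cast congrArg (fun x : ℕ => (x : ℤ)) h

/-- The twisted Jacobi symbol is not the trivial character if `b` is not a square: there is an
integer that is a nonresidue modulo one prime with odd exponent in `b`, and `1` modulo everything
else. -/
theorem exists_jacobiTwist_ne_one_of_not_isSquare (ψ : DirichletCharacter ℂ 8) {b Q : ℕ}
    (hQ : Odd Q) (hbQ : b ∣ Q) (hb : ¬ IsSquare b) :
    ∃ n : ℕ, n.Coprime (8 * Q) ∧ jacobiTwist ψ b n ≠ 1 := by
  obtain ⟨a, c, hac, hasq⟩ := Nat.sq_mul_squarefree b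
  have hQ0 : Q ≠ 0 := by rintro rfl; simp at hQ
  have hb0 : b ≠ 0 := by rintro rfl; exact hQ0 (by simpa using hbQ)
  have ha1 : a ≠ 1 := by rintro rfl; exact hb ⟨c, by rw [← hac]; ring⟩
  obtain ⟨p, hp, hpa⟩ := Nat.exists_prime_and_dvd ha1
  obtain ⟨a', rfl⟩ := hpa
  have hpa' : p.Coprime a' := (Nat.squarefree_mul_iff.1 hasq).1
  have hc0 : c ≠ 0 := by rintro rfl; exact hb0 (by rw [← hac]; ring)
  have ha'0 : a' ≠ 0 := by rintro rfl; exact hb0 (by rw [← hac]; ring)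
  have hpb : p ∣ b := ⟨c ^ 2 * a', by rw [← hac]; ring⟩
  have hpodd : Odd p := hQ.of_dvd_nat (hpb.trans hbQ)
  have hp2 : p ≠ 2 := by rintro rfl; exact absurd hpodd (by decide)
  have : Fact p.Prime := ⟨hp⟩
  obtain ⟨e, M, hpM, hM⟩ := Nat.exists_eq_pow_mul_and_not_dvd (n := 8 * Q) (by positivity) p hp.one_lt.ne'
  have hcop : p.Coprime M := (hp.coprime_iff_not_dvd).2 hpM
  obtain ⟨x, hx⟩ := FiniteField.exists_nonsquare (F := ZMod p) (by rw [ZMod.ringChar_zmod_n]; exact hp2)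
  obtain ⟨n, hn1, hn2⟩ := Nat.chineseRemainder hcop x.val 1
  have hnM : n.Coprime M := by
    rw [Nat.coprime_iff_gcd_eq_one, hn2.gcd_eq]; simp
  have hxcast : ((n : ℤ) : ZMod p) = x := by
    rw [Int.cast_natCast, ← ZMod.natCast_zmod_val x]
    exact (ZMod.natCast_eq_natCast_iff _ _ _).2 hn1
  have hnp : jacobiSym n p = -1 := by
    rw [ZMod.nonsquare_iff_jacobiSym_eq_neg_one, hxcast]; exact hx
  have hncop : n.Coprime p := by
    rw [Nat.coprime_comm, hp.coprime_iff_not_dvd]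
    intro h
    have : x = 0 := by rw [← hxcast, Int.cast_natCast]; exact (ZMod.natCast_eq_zero_iff _ _).2 h
    exact hx (this ▸ IsSquare.zero)
  have hcop8 : n.Coprime (8 * Q) := by
    rw [hM]; exact Nat.Coprime.mul_right (Nat.Coprime.pow_right _ hncop) hnM
  have h8M : 8 ∣ M := by
    have h1 : Nat.Coprime 8 (p ^ e) := by
      refine Nat.Coprime.pow_right _ ?_
      exact Nat.Coprime.pow_left 3 (Nat.coprime_two_left.2 hpodd)
    exact h1.dvd_of_dvd_mul_left (hM ▸ dvd_mul_right 8 Q)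
  have ha'M : a' ∣ M := by
    refine (Nat.Coprime.pow_right e hpa'.symm).dvd_of_dvd_mul_left (hM ▸ ?_)
    exact (Dvd.intro_left (c ^ 2 * p) (by rw [← hac]; ring)).trans (hbQ.trans (dvd_mul_left Q 8))
  have hnc : n.Coprime c := Nat.Coprime.coprime_dvd_right
    ((Dvd.intro (c * (p * a')) (by rw [← hac]; ring)).trans (hbQ.trans (dvd_mul_left Q 8))) hcop8
  refine ⟨n, hcop8, ?_⟩
  have h8 : ((n : ℕ) : ZMod 8) = 1 := by
    rw [← Nat.cast_one]
    exact (ZMod.natCast_eq_natCast_iff _ _ _).2 (hn2.of_dvd h8M)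
  have hJ : jacobiSym n b = -1 := by
    rw [← hac, jacobiSym.mul_right' _ (pow_ne_zero 2 hc0) (mul_ne_zero hp.ne_zero ha'0),
      jacobiSym.mul_right' _ hp.ne_zero ha'0, jacobiSym.pow_right, hnp,
      jacobiSym_natCast_congr (hn2.of_dvd ha'M), jacobiSym.sq_one (by simpa using hnc)]
    simp
  rw [jacobiTwist_apply, h8, map_one, hJ]
  norm_num

theorem jacobiSym_isSquare_right {b n : ℕ} (hb : IsSquare b) (hn : n.Coprime b) :
    jacobiSym n b = 1 := by
  obtain ⟨c, rfl⟩ := hb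
  rw [← sq, jacobiSym.pow_right]
  exact jacobiSym.sq_one (by simpa using hn.coprime_mul_left_right)

/-- If `b` is a square, the nontriviality comes from `ψ`: take `n` with `ψ(n) ≠ 1` and `n ≡ 1`
modulo `Q`. -/
theorem exists_jacobiTwist_ne_one_of_ne_one {ψ : DirichletCharacter ℂ 8} (hψ : ψ ≠ 1) {b Q : ℕ}
    (hQ : Odd Q) (hbQ : b ∣ Q) (hb : IsSquare b) :
    ∃ n : ℕ, n.Coprime (8 * Q) ∧ jacobiTwist ψ b n ≠ 1 := by
  obtain ⟨u, hu⟩ : ∃ u : (ZMod 8)ˣ, ψ u ≠ 1 := by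
    by_contra! h
    exact hψ (MulChar.ext fun u => by rw [h u, MulChar.one_apply_coe])
  have hcop : Nat.Coprime 8 Q := Nat.Coprime.pow_left 3 (Nat.coprime_two_left.2 hQ)
  obtain ⟨n, hn1, hn2⟩ := Nat.chineseRemainder hcop (u : ZMod 8).val 1
  have hnQ : n.Coprime Q := by rw [Nat.coprime_iff_gcd_eq_one, hn2.gcd_eq]; simp
  have hn8 : (n : ZMod 8) = u := by
    rw [← ZMod.natCast_zmod_val (u : ZMod 8)]
    exact (ZMod.natCast_eq_natCast_iff _ _ _).2 hn1
  have hnu : n.Coprime 8 := (ZMod.isUnit_iff_coprime _ _).1 (hn8 ▸ u.isUnit)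
  refine ⟨n, Nat.Coprime.mul_right hnu hnQ, ?_⟩
  rw [jacobiTwist_apply, hn8, jacobiSym_isSquare_right hb (hnQ.coprime_dvd_right hbQ)]
  simpa using hu

/-- The Pólya–Vinogradov inequality for the twisted Jacobi symbols, restricted to the integers
coprime to `r`. -/
theorem hasMeanValue_jacobiTwist {ψ : DirichletCharacter ℂ 8} {b r Q : ℕ} (hQ : Odd Q)
    (hbQ : b ∣ Q) (hrQ : r ∣ Q) (hcop : ∀ n : ℕ, n.Coprime b → n.Coprime r → n.Coprime Q)
    (h : ψ ≠ 1 ∨ ¬ IsSquare b) :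
    HasMeanValue (coprimePart r (jacobiTwist ψ b)) 0
      (2 * Real.sqrt (8 * Q : ℕ) * (1 + Real.log (8 * Q : ℕ))) := by
  have hQ0 : Q ≠ 0 := by rintro rfl; simp at hQ
  have hb0 : b ≠ 0 := by rintro rfl; exact hQ0 (by simpa using hbQ)
  refine hasMeanValue_of_periodic (by omega) _ ?_ ?_ ?_
  · intro m n hmn
    have h1 : (m : ZMod 8) = n :=
      (ZMod.natCast_eq_natCast_iff _ _ _).2 (hmn.of_dvd (dvd_mul_right 8 Q))
    have h2 : m ≡ n [MOD Q] := hmn.of_dvd (dvd_mul_left Q 8)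
    have h3 : m.Coprime r ↔ n.Coprime r := by
      rw [Nat.coprime_iff_gcd_eq_one, Nat.coprime_iff_gcd_eq_one, (h2.of_dvd hrQ).gcd_eq]
    rw [coprimePart_apply, coprimePart_apply, jacobiTwist_apply, jacobiTwist_apply, h1,
      jacobiSym_natCast_congr (h2.of_dvd hbQ)]
    by_cases h4 : m.Coprime r
    · rw [if_pos h4, if_pos (h3.1 h4)]
    · rw [if_neg h4, if_neg (fun h => h4 (h3.2 h))]
  · intro n hn
    rw [coprimePart_apply]
    split_ifs with hnr
    · rw [jacobiTwist_apply]
      by_cases hnb : n.Coprime b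
      · have hn8 : ¬ n.Coprime 8 := fun h => hn (Nat.Coprime.mul_right h (hcop n hnb hnr))
        rw [MulChar.map_nonunit _ (fun h => hn8 ((ZMod.isUnit_iff_coprime _ _).1 h)), zero_mul]
      · have : NeZero b := ⟨hb0⟩
        rw [jacobiSym.eq_zero_iff_not_coprime.2 (by simpa using hnb)]
        simp
    · rfl
  · obtain ⟨n, hn, hn1⟩ : ∃ n : ℕ, n.Coprime (8 * Q) ∧ jacobiTwist ψ b n ≠ 1 := by
      by_cases hb : IsSquare b
      · exact exists_jacobiTwist_ne_one_of_ne_one (h.resolve_right (not_not.2 hb)) hQ hbQ hb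
      · exact exists_jacobiTwist_ne_one_of_not_isSquare ψ hQ hbQ hb
    refine ⟨n, hn, ?_⟩
    rw [coprimePart_apply, if_pos (hn.coprime_dvd_right (hrQ.trans (dvd_mul_left Q 8)))]
    exact hn1


/-! ### Squarefree integers with prescribed residue symbols -/

/-- The sum of `g(n) (n / b)` over the squarefree `n ≤ X` with `n ≡ r (mod 8)` and `(n / p) = ε_p`
for all primes `p` dividing `T`. -/
def residueSum (g : ArithmeticFunction ℂ) (T b : ℕ) (ε : ℕ → ℤ) (r : ZMod 8) (X : ℝ) : ℂ :=
  open Classical in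
  ∑ n ∈ (Finset.Icc 1 ⌊X⌋₊).filter (fun n : ℕ => Squarefree n ∧ (n : ZMod 8) = r ∧
    ∀ p ∈ T.primeFactors, jacobiSym n p = ε p), g n * (jacobiSym n b : ℂ)

/-- The series `∑ k(n) / n` over the `n` coprime to `P`, for the cofactor `k` with `μ² g = 1 * k`. -/
def cofactorSeries (g : ArithmeticFunction ℂ) (P : ℕ) : ℂ :=
  ∑' k : ℕ, ArithmeticFunction.squarefreeCofactor g k * coprimePart P natOne k / k

theorem jacobiSym_prod_right (a : ℤ) (s : Finset ℕ) (hs : ∀ p ∈ s, p ≠ 0) :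
    jacobiSym a (∏ p ∈ s, p) = ∏ p ∈ s, jacobiSym a p := by
  classical
  induction s using Finset.induction_on with
  | empty => simp
  | insert p s hp ih =>
    have h1 := hs p (Finset.mem_insert_self p s)
    have h2 : ∀ q ∈ s, q ≠ 0 := fun q hq => hs q (Finset.mem_insert_of_mem hq)
    rw [Finset.prod_insert hp, Finset.prod_insert hp,
      jacobiSym.mul_right' _ h1 (Finset.prod_ne_zero_iff.2 h2), ih h2]

/-- The conditions `(n / p) = ε_p` for `p ∣ T`, as a sum of Jacobi symbols: the product of the
factors `(1 + ε_p (n / p)) / 2`, restricted to the `n` coprime to `T`. -/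
theorem indicator_jacobiSym_eq {T : ℕ} (hT : T ≠ 0) {ε : ℕ → ℤ}
    (hε : ∀ p ∈ T.primeFactors, ε p = 1 ∨ ε p = -1) (n : ℕ)
    [Decidable (∀ p ∈ T.primeFactors, jacobiSym n p = ε p)] :
    (if ∀ p ∈ T.primeFactors, jacobiSym n p = ε p then (1 : ℂ) else 0) =
      (if n.Coprime T then 1 else 0) * (1 / 2 ^ T.primeFactors.card *
        ∑ s ∈ T.primeFactors.powerset, (∏ p ∈ s, (ε p : ℂ)) * (jacobiSym n (∏ p ∈ s, p) : ℂ)) := by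
  have h1 : ∑ s ∈ T.primeFactors.powerset, (∏ p ∈ s, (ε p : ℂ)) * (jacobiSym n (∏ p ∈ s, p) : ℂ) =
      ∏ p ∈ T.primeFactors, (1 + (ε p : ℂ) * (jacobiSym n p : ℂ)) := by
    rw [Finset.prod_one_add]
    refine Finset.sum_congr rfl fun s hs => ?_
    rw [jacobiSym_prod_right _ s fun p hp =>
      (Nat.prime_of_mem_primeFactors (Finset.mem_powerset.1 hs hp)).ne_zero]
    push_cast
    rw [Finset.prod_mul_distrib]
  rw [h1]
  have hcop : ∀ p ∈ T.primeFactors, n.Coprime p → jacobiSym n p = 1 ∨ jacobiSym n p = -1 :=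
    fun p _ h => jacobiSym.eq_one_or_neg_one (by simpa using h)
  split_ifs with h2 h3 h3
  · have h4 : ∀ p ∈ T.primeFactors, (1 + (ε p : ℂ) * (jacobiSym n p : ℂ)) = 2 := by
      intro p hp
      rw [h2 p hp]
      rcases hε p hp with h | h <;> rw [h] <;> norm_num
    rw [Finset.prod_congr rfl h4, Finset.prod_const]
    field_simp
  · exfalso
    apply h3
    refine (Nat.coprime_of_dvd fun p hp hpn hpT => ?_)
    have hp' : p ∈ T.primeFactors := Nat.mem_primeFactors.2 ⟨hp, hpT, hT⟩
    have : NeZero p := ⟨hp.ne_zero⟩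
    have h5 : jacobiSym n p = 0 := by
      rw [jacobiSym.eq_zero_iff_not_coprime]
      have : Nat.gcd n p = p := Nat.gcd_eq_right hpn
      simpa [this] using hp.one_lt.ne'
    have := h2 p hp'
    rcases hε p hp' with h | h <;> omega
  · push Not at h2
    obtain ⟨p, hp, hne⟩ := h2
    have h4 : (1 + (ε p : ℂ) * (jacobiSym n p : ℂ)) = 0 := by
      have h5 := hcop p hp (h3.coprime_dvd_right (Nat.dvd_of_mem_primeFactors hp))
      rcases hε p hp with h | h <;> rcases h5 with h' | h' <;> rw [h, h'] at hne ⊢ <;>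
        first | exact absurd rfl hne | norm_num
    rw [Finset.prod_eq_zero hp h4]
    ring
  · ring

theorem isSquare_prod_mul_iff {T b : ℕ} (hTb : T.Coprime b) (hT : Squarefree T)
    {s : Finset ℕ} (hs : s ⊆ T.primeFactors) :
    IsSquare ((∏ p ∈ s, p) * b) ↔ s = ∅ ∧ IsSquare b := by
  have hdT : (∏ p ∈ s, p) ∣ T :=
    (Finset.prod_dvd_prod_of_subset _ _ _ hs).trans (Nat.prod_primeFactors_dvd T)
  constructor
  · rintro ⟨c, hc⟩
    rw [← sq] at hc
    have hcop : Nat.Coprime (∏ p ∈ s, p) b := hTb.coprime_dvd_left hdT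
    obtain ⟨e, he⟩ := exists_eq_pow_of_mul_eq_pow (Nat.isUnit_iff.2 hcop) hc
    obtain ⟨f, hf⟩ := exists_eq_pow_of_mul_eq_pow (Nat.isUnit_iff.2 hcop.symm)
      ((mul_comm b _).trans hc)
    refine ⟨?_, ⟨f, by rw [hf, sq]⟩⟩
    have hsq : Squarefree (∏ p ∈ s, p) := hT.squarefree_of_dvd hdT
    have he1 : e = 1 := by
      have := hsq e ⟨1, by rw [he]; ring⟩
      simpa using this
    by_contra hne
    obtain ⟨p, hp⟩ := Finset.nonempty_iff_ne_empty.2 hne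
    have h2 : p ∣ ∏ p ∈ s, p := Finset.dvd_prod_of_mem _ hp
    rw [he, he1] at h2
    exact (Nat.prime_of_mem_primeFactors (hs hp)).one_lt.ne' (by simpa using h2)
  · rintro ⟨rfl, h⟩
    simpa using h

/-- The sum over residue classes, expanded into twisted Jacobi symbols: only the trivial character
contributes a main term, and it occurs only if `b` is a square. -/
theorem exists_residueSum_le (A : ℝ) (hA : 0 ≤ A) : ∃ C : ℝ, 0 < C ∧
    ∀ g : ArithmeticFunction ℂ, g.IsMultiplicative → (∀ p : ℕ, p.Prime → ‖g p - 1‖ ≤ A / p) →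
    ∀ (T b : ℕ), Odd b → Squarefree T → T.Coprime b →
    ∀ M : ℝ, (∀ (ψ : DirichletCharacter ℂ 8) (s : Finset ℕ), s ⊆ T.primeFactors →
        (ψ ≠ 1 ∨ ¬ IsSquare ((∏ p ∈ s, p) * b)) →
        HasMeanValue (coprimePart T (jacobiTwist ψ ((∏ p ∈ s, p) * b))) 0 M) →
      ((2 * T * b).divisors.card : ℝ) ≤ M →
    ∀ (ε : ℕ → ℤ), (∀ p ∈ T.primeFactors, ε p = 1 ∨ ε p = -1) →
    ∀ r : ZMod 8, IsUnit r → ∀ X : ℝ, 0 ≤ X →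
      ‖residueSum g T b ε r X - (if IsSquare b then 1 / 4 * (1 / 2 ^ T.primeFactors.card) *
        (X * coprimeDensity (2 * T * b) * cofactorSeries g (2 * T * b)) else 0)‖ ≤
        C * Real.sqrt (X * M) := by
  obtain ⟨C, hC, hCb⟩ := exists_sum_squarefreePart_le A hA
  refine ⟨C, hC, fun g hg hgA T b hb hT hTb M hM1 hM2 ε hε r hr X hX => ?_⟩
  obtain ⟨-, hmain⟩ := hCb g hg hgA
  have hT0 : T ≠ 0 := hT.ne_zero
  have hb0 : b ≠ 0 := by rintro rfl; simp at hb
  set ω := T.primeFactors.card with hω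
  set F : DirichletCharacter ℂ 8 → Finset ℕ → ℕ →*₀ ℂ :=
    fun ψ s => coprimePart T (jacobiTwist ψ ((∏ p ∈ s, p) * b)) with hF
  have hexp : residueSum g T b ε r X = ∑ ψ : DirichletCharacter ℂ 8,
      ∑ s ∈ T.primeFactors.powerset, 1 / 4 * (1 / 2 ^ ω) * (ψ r⁻¹ * ∏ p ∈ s, (ε p : ℂ)) *
        ∑ n ∈ Finset.Icc 1 ⌊X⌋₊, ArithmeticFunction.squarefreePart g n * F ψ s n := by
    classical
    rw [residueSum, Finset.sum_filter]
    simp_rw [Finset.mul_sum]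
    simp_rw [Finset.sum_comm (s := T.primeFactors.powerset)]
    rw [Finset.sum_comm (s := Finset.univ)]
    refine Finset.sum_congr rfl fun n _ => ?_
    have h1 : (if (n : ZMod 8) = r then (1 : ℂ) else 0) =
        1 / 4 * ∑ ψ : DirichletCharacter ℂ 8, ψ r⁻¹ * ψ n := by
      rw [DirichletCharacter.sum_char_inv_mul_char_eq ℂ hr (n : ZMod 8)]
      have : Nat.totient 8 = 4 := by decide
      rw [this]
      by_cases h : (n : ZMod 8) = r
      · rw [if_pos h, if_pos h.symm]; norm_num
      · rw [if_neg h, if_neg (Ne.symm h)]; norm_num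
    have h2 := indicator_jacobiSym_eq hT0 hε n
    have h3 : (if Squarefree n ∧ (n : ZMod 8) = r ∧ ∀ p ∈ T.primeFactors, jacobiSym n p = ε p
        then g n * (jacobiSym n b : ℂ) else 0) =
        ArithmeticFunction.squarefreePart g n * (jacobiSym n b : ℂ) *
        (if (n : ZMod 8) = r then (1 : ℂ) else 0) *
        (if ∀ p ∈ T.primeFactors, jacobiSym n p = ε p then (1 : ℂ) else 0) := by
      rw [ArithmeticFunction.squarefreePart_apply]
      by_cases h4 : Squarefree n <;> by_cases h5 : (n : ZMod 8) = r <;> simp [h4, h5]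
    simp only [h3, h1, h2, Finset.mul_sum]
    simp only [Finset.sum_mul]
    rw [Finset.sum_comm]
    refine Finset.sum_congr rfl fun ψ _ => ?_
    refine Finset.sum_congr rfl fun s hs => ?_
    have hs0 : (∏ p ∈ s, p) ≠ 0 := Finset.prod_ne_zero_iff.2 fun p hp =>
      (Nat.prime_of_mem_primeFactors (Finset.mem_powerset.1 hs hp)).ne_zero
    rw [hF]
    simp only
    rw [coprimePart_apply, jacobiTwist_apply, jacobiSym.mul_right' _ hs0 hb0]
    push_cast
    split_ifs <;> ring
  -- the main term belongs to the trivial character and the empty set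
  have hmainterm : (if IsSquare b then 1 / 4 * (1 / 2 ^ ω) *
        (X * coprimeDensity (2 * T * b) * cofactorSeries g (2 * T * b)) else 0) =
      ∑ ψ : DirichletCharacter ℂ 8, ∑ s ∈ T.primeFactors.powerset,
        1 / 4 * (1 / 2 ^ ω) * (ψ r⁻¹ * ∏ p ∈ s, (ε p : ℂ)) *
        (if ψ = 1 ∧ IsSquare ((∏ p ∈ s, p) * b) then
          coprimeDensity (2 * T * b) * X * cofactorSeries g (2 * T * b) else 0) := by
    rw [Fintype.sum_eq_single 1, Finset.sum_eq_single ∅]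
    · have hr1 : (1 : DirichletCharacter ℂ 8) r⁻¹ = 1 := by
        refine MulChar.one_apply ?_
        exact IsUnit.of_mul_eq_one r (ZMod.inv_mul_of_unit r hr)
      by_cases h : IsSquare b
      · simp only [h, if_true, hr1, Finset.prod_empty, one_mul, and_self]; ring
      · simp [h]
    · intro s hs hne
      rw [if_neg, mul_zero]
      rw [isSquare_prod_mul_iff hTb hT (Finset.mem_powerset.1 hs)]
      tauto
    · intro h; exact absurd (Finset.empty_mem_powerset _) h
    · intro ψ hψ
      refine Finset.sum_eq_zero fun s _ => ?_
      rw [if_neg (fun h => hψ h.1), mul_zero]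
  rw [hexp, hmainterm, ← Finset.sum_sub_distrib]
  simp_rw [← Finset.sum_sub_distrib, ← mul_sub]
  have hbound : ∀ (ψ : DirichletCharacter ℂ 8), ∀ s ∈ T.primeFactors.powerset,
      ‖1 / 4 * (1 / 2 ^ ω) * (ψ r⁻¹ * ∏ p ∈ s, (ε p : ℂ)) *
        (∑ n ∈ Finset.Icc 1 ⌊X⌋₊, ArithmeticFunction.squarefreePart g n * F ψ s n -
          (if ψ = 1 ∧ IsSquare ((∏ p ∈ s, p) * b) then
            coprimeDensity (2 * T * b) * X * cofactorSeries g (2 * T * b) else 0))‖ ≤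
      1 / 4 * (1 / 2 ^ ω) * (C * Real.sqrt (X * M)) := by
    intro ψ s hs
    have hsub := Finset.mem_powerset.1 hs
    have hε1 : ‖∏ p ∈ s, (ε p : ℂ)‖ ≤ 1 := by
      rw [norm_prod]
      refine Finset.prod_le_one (fun _ _ => norm_nonneg _) fun p hp => ?_
      rcases hε p (hsub hp) with h | h <;> simp [h]
    have hFn : ∀ n, ‖F ψ s n‖ ≤ 1 := fun n =>
      (norm_coprimePart_le _ _ _).trans (norm_jacobiTwist_le _ _ _)
    have hdiff : ‖∑ n ∈ Finset.Icc 1 ⌊X⌋₊, ArithmeticFunction.squarefreePart g n * F ψ s n -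
          (if ψ = 1 ∧ IsSquare ((∏ p ∈ s, p) * b) then
            coprimeDensity (2 * T * b) * X * cofactorSeries g (2 * T * b) else 0)‖ ≤
        C * Real.sqrt (X * M) := by
      split_ifs with h
      · obtain ⟨rfl, hsq⟩ := h
        obtain ⟨rfl, hbsq⟩ := (isSquare_prod_mul_iff hTb hT hsub).1 hsq
        -- for the trivial character, the indicator of the integers coprime to `2 T b`
        have hFeq : F 1 ∅ = coprimePart (2 * T * b) natOne := by
          ext n
          have h2Tb : 2 * T * b ≠ 1 := by
            intro h
            have := Nat.eq_one_of_mul_eq_one_right h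
            omega
          rw [coprimePart_natOne_apply h2Tb, hF]
          simp only
          rw [coprimePart_apply, jacobiTwist_apply, Finset.prod_empty, one_mul]
          have hiff : n.Coprime (2 * T * b) ↔ n.Coprime 8 ∧ n.Coprime T ∧ n.Coprime b := by
            rw [Nat.coprime_mul_iff_right, Nat.coprime_mul_iff_right, and_assoc,
              show 8 = 2 ^ 3 by norm_num, Nat.coprime_pow_right_iff (by norm_num)]
          by_cases hn8 : n.Coprime 8
          · rw [MulChar.one_apply ((ZMod.isUnit_iff_coprime _ _).2 hn8)]
            by_cases hnT : n.Coprime T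
            · rw [if_pos hnT]
              by_cases hnb : n.Coprime b
              · rw [if_pos (hiff.2 ⟨hn8, hnT, hnb⟩), jacobiSym_isSquare_right hbsq hnb]; simp
              · have : NeZero b := ⟨hb0⟩
                rw [if_neg (fun h => hnb (hiff.1 h).2.2),
                  jacobiSym.eq_zero_iff_not_coprime.2 (by simpa using hnb)]
                simp
            · rw [if_neg hnT, if_neg (fun h => hnT (hiff.1 h).2.1)]
          · rw [MulChar.map_nonunit _ (fun h => hn8 ((ZMod.isUnit_iff_coprime _ _).1 h)), zero_mul,
              if_neg (fun h => hn8 (hiff.1 h).1)]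
            simp
        have hP0 : 2 * T * b ≠ 0 := by positivity
        have hmean := hasMeanValue_coprimePart_natOne hP0
        have h5 := hmain (F 1 ∅) (coprimeDensity (2 * T * b)) M (hFn ·)
          (norm_coprimeDensity_le _) (fun Z hZ => by
            rw [hFeq]; exact (hmean Z hZ).trans hM2) X hX
        rw [hFeq] at h5 ⊢
        exact h5
      · have h4 : ψ ≠ 1 ∨ ¬ IsSquare ((∏ p ∈ s, p) * b) := by tauto
        have h5 := hmain (F ψ s) 0 M hFn (by simp) (hM1 ψ s hsub h4) X hX
        simpa using h5
    have hcoef : ‖(1 / 4 * (1 / 2 ^ ω) * (ψ r⁻¹ * ∏ p ∈ s, (ε p : ℂ)) : ℂ)‖ ≤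
        1 / 4 * (1 / 2 ^ ω) := by
      rw [norm_mul, norm_mul (ψ r⁻¹)]
      have h6 : ‖(1 / 4 * (1 / 2 ^ ω) : ℂ)‖ = 1 / 4 * (1 / 2 ^ ω) := by simp
      rw [h6]
      refine mul_le_of_le_one_right (by positivity) ?_
      exact mul_le_one₀ (DirichletCharacter.norm_le_one _ _) (norm_nonneg _) hε1
    rw [norm_mul]
    exact mul_le_mul hcoef hdiff (norm_nonneg _) (by positivity)
  refine (norm_sum_le _ _).trans ?_
  have hcard : Fintype.card (DirichletCharacter ℂ 8) = 4 := by
    rw [← Nat.card_eq_fintype_card, DirichletCharacter.card_eq_totient_of_hasEnoughRootsOfUnity]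
    decide
  calc _ ≤ ∑ ψ : DirichletCharacter ℂ 8, ∑ s ∈ T.primeFactors.powerset,
        1 / 4 * (1 / 2 ^ ω) * (C * Real.sqrt (X * M)) :=
        Finset.sum_le_sum fun ψ _ => (norm_sum_le _ _).trans (Finset.sum_le_sum (hbound ψ))
    _ = C * Real.sqrt (X * M) := by
        rw [Finset.sum_const, Finset.sum_const, Finset.card_univ, hcard, Finset.card_powerset,
          ← hω]
        simp only [nsmul_eq_mul]
        push_cast
        field_simp


/-! ### The quadratic algebra `k(√D)` and its discriminant -/

namespace QuadraticAlgebra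

variable {k : Type*} [Field k]

/-- The homomorphism from `k(√D)` that sends `√D` to a given square root of `D`. -/
def liftSqrt {A : Type*} [Ring A] [Algebra k A] {D : k} (s : A) (hs : s * s = algebraMap k A D) :
    QuadraticAlgebra k D 0 →ₐ[k] A :=
  lift ⟨s, by rw [hs, zero_smul, add_zero, Algebra.algebraMap_eq_smul_one]⟩

theorem liftSqrt_apply {A : Type*} [Ring A] [Algebra k A] {D : k} (s : A)
    (hs : s * s = algebraMap k A D) (z : QuadraticAlgebra k D 0) :
    liftSqrt s hs z = algebraMap k A z.re + z.im • s := by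
  rw [Algebra.algebraMap_eq_smul_one]; rfl

theorem liftSqrt_omega {A : Type*} [Ring A] [Algebra k A] {D : k} (s : A)
    (hs : s * s = algebraMap k A D) : liftSqrt s hs omega = s := by
  simp [liftSqrt_apply]

theorem omega_mul_self (D : k) :
    (omega : QuadraticAlgebra k D 0) * omega = algebraMap k _ D := by
  ext <;> simp

theorem liftSqrt_injective {A : Type*} [Ring A] [Nontrivial A] [Algebra k A] {D : k} (s : A)
    (hs : s * s = algebraMap k A D) (hne : s ∉ Set.range (algebraMap k A)) :
    Function.Injective (liftSqrt s hs) := by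
  rw [injective_iff_map_eq_zero]
  intro z hz
  rw [liftSqrt_apply] at hz
  have him : z.im = 0 := by
    by_contra h
    refine hne ⟨-(z.im⁻¹ * z.re), ?_⟩
    have h1 : z.im • s = -algebraMap k A z.re := by
      rw [eq_neg_iff_add_eq_zero, add_comm]; exact hz
    have h2 := congrArg (fun w => z.im⁻¹ • w) h1
    simp only [smul_smul, inv_mul_cancel₀ h, one_smul] at h2
    rw [h2, map_neg, map_mul, smul_neg, Algebra.smul_def]
  rw [him, zero_smul, add_zero] at hz
  have hre : z.re = 0 := by
    have := (algebraMap k A).injective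
    exact this (by rw [hz, map_zero])
  ext <;> simp [him, hre]

/-- A two-dimensional algebra that contains a square root of `D` outside of `k` is `k(√D)`. -/
def equivOfSqrt {A : Type*} [Ring A] [Nontrivial A] [Algebra k A] {D : k} (s : A)
    (hs : s * s = algebraMap k A D) (hne : s ∉ Set.range (algebraMap k A))
    (hfin : Module.finrank k A = 2) : QuadraticAlgebra k D 0 ≃ₐ[k] A :=
  AlgEquiv.ofBijective (liftSqrt s hs) (by
    have : Module.Finite k A := Module.finite_of_finrank_eq_succ hfin
    have hinj := liftSqrt_injective s hs hne
    refine ⟨hinj, ?_⟩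
    have := (LinearMap.injective_iff_surjective_of_finrank_eq_finrank
      (f := (liftSqrt s hs).toLinearMap) (by rw [finrank_eq_two, hfin])).1 hinj
    exact this)

theorem trace_eq {D : k} (z : QuadraticAlgebra k D 0) : Algebra.trace k _ z = 2 * z.re := by
  rw [Algebra.trace_eq_matrix_trace (basis D 0), Matrix.trace_fin_two,
    Algebra.leftMulMatrix_eq_repr_mul, Algebra.leftMulMatrix_eq_repr_mul]
  simp [basis, linearEquivTuple, equivProd]
  ring

theorem discr_eq {D : k} (b : Fin 2 → QuadraticAlgebra k D 0) :
    Algebra.discr k b = 4 * D * ((b 0).re * (b 1).im - (b 1).re * (b 0).im) ^ 2 := by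
  rw [Algebra.discr_def, Matrix.det_fin_two]
  simp only [Algebra.traceMatrix_apply, Algebra.traceForm_apply, trace_eq, re_mul]
  ring

/-- An integral element of `k(√D)` has its trace and its norm in `R`. -/
theorem exists_of_isIntegral {R : Type*} [CommRing R] [IsDomain R] [IsIntegrallyClosed R] [Algebra R k]
    [IsFractionRing R k] {D : R} {z : QuadraticAlgebra k (algebraMap R k D) 0}
    (hz : IsIntegral R z) :
    (∃ X : R, algebraMap R k X = 2 * z.re) ∧
      ∃ N : R, algebraMap R k N = z.re ^ 2 - algebraMap R k D * z.im ^ 2 := by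
  -- the conjugation, through which trace and norm are expressed
  set σ : QuadraticAlgebra k (algebraMap R k D) 0 →ₐ[k] QuadraticAlgebra k (algebraMap R k D) 0 :=
    liftSqrt (-omega) (by rw [neg_mul_neg, omega_mul_self]) with hσdef
  have hσ : IsIntegral R (σ z) := hz.map (σ.restrictScalars R)
  have hσre : (σ z).re = z.re := by simp [hσdef, liftSqrt_apply]
  have hσim : (σ z).im = -z.im := by simp [hσdef, liftSqrt_apply]
  have hinj : Function.Injective
      (algebraMap k (QuadraticAlgebra k (algebraMap R k D) 0)) := algebraMap_injective
  constructor
  · rw [← IsIntegrallyClosed.isIntegral_iff, ← isIntegral_algebraMap_iff hinj]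
    have h : algebraMap k (QuadraticAlgebra k (algebraMap R k D) 0) (2 * z.re) = z + σ z := by
      ext
      · simp [hσre]; ring
      · simp [hσim]
    rw [h]
    exact hz.add hσ
  · rw [← IsIntegrallyClosed.isIntegral_iff, ← isIntegral_algebraMap_iff hinj]
    have h : algebraMap k (QuadraticAlgebra k (algebraMap R k D) 0)
        (z.re ^ 2 - algebraMap R k D * z.im ^ 2) = z * σ z := by
      rw [algebraMap_eq]
      ext
      · simp [hσre, hσim]; ring
      · simp [hσre, hσim]; ring
    rw [h]
    exact hz.mul hσ

end QuadraticAlgebra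

/-- `Δ` generates the discriminant of the algebra `k(√D)` over `R`: it is the discriminant of a
pair of integral elements, and the discriminant of any such pair is `Δ` times a square of `R`. -/
def IsQuadraticDiscr (R k : Type*) [CommRing R] [Field k] [Algebra R k] (D Δ : R) : Prop :=
  (∀ b : Fin 2 → QuadraticAlgebra k (algebraMap R k D) 0, (∀ i, IsIntegral R (b i)) →
    ∃ t : R, Algebra.discr k b = algebraMap R k (Δ * t ^ 2)) ∧
  ∃ b : Fin 2 → QuadraticAlgebra k (algebraMap R k D) 0, (∀ i, IsIntegral R (b i)) ∧
    Algebra.discr k b = algebraMap R k Δ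

section Discr

variable {R k : Type*} [CommRing R] [IsDomain R] [IsIntegrallyClosed R] [Field k]
  [Algebra R k] [IsFractionRing R k]

open QuadraticAlgebra in
/-- The hypothesis `hsq` holds if `D` is not divisible by the square of a prime. -/
theorem exists_two_mul_of_isIntegral {D : R}
    (hsq : ∀ y : k, (∃ r : R, algebraMap R k r = algebraMap R k D * y ^ 2) →
      ∃ Y : R, algebraMap R k Y = y)
    {z : QuadraticAlgebra k (algebraMap R k D) 0} (hz : IsIntegral R z) :
    ∃ X Y : R, algebraMap R k X = 2 * z.re ∧ algebraMap R k Y = 2 * z.im ∧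
      (4 : R) ∣ X ^ 2 - D * Y ^ 2 := by
  obtain ⟨⟨X, hX⟩, N, hN⟩ := exists_of_isIntegral hz
  obtain ⟨Y, hY⟩ := hsq (2 * z.im) ⟨X ^ 2 - 4 * N, by
    simp only [map_sub, map_mul, map_pow, hX, hN, map_ofNat]; ring⟩
  refine ⟨X, Y, hX, hY, N, IsFractionRing.injective R k ?_⟩
  simp only [map_sub, map_mul, map_pow, hX, hN, hY, map_ofNat]; ring

open QuadraticAlgebra in
/-- The case in which the integral elements are `x + y √D` with `x`, `y` in `R`. -/
theorem isQuadraticDiscr_four_mul [CharZero k] {D : R}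
    (hsq : ∀ y : k, (∃ r : R, algebraMap R k r = algebraMap R k D * y ^ 2) →
      ∃ Y : R, algebraMap R k Y = y)
    (h4 : ∀ X Y : R, (4 : R) ∣ X ^ 2 - D * Y ^ 2 → 2 ∣ X ∧ 2 ∣ Y) :
    IsQuadraticDiscr R k D (4 * D) := by
  have hint : ∀ z : QuadraticAlgebra k (algebraMap R k D) 0, IsIntegral R z →
      ∃ x y : R, algebraMap R k x = z.re ∧ algebraMap R k y = z.im := by
    intro z hz
    obtain ⟨X, Y, hX, hY, hdvd⟩ := exists_two_mul_of_isIntegral hsq hz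
    obtain ⟨⟨x, rfl⟩, y, rfl⟩ := h4 X Y hdvd
    refine ⟨x, y, ?_, ?_⟩
    · have := hX; rw [map_mul, map_ofNat] at this
      exact mul_left_cancel₀ two_ne_zero this
    · have := hY; rw [map_mul, map_ofNat] at this
      exact mul_left_cancel₀ two_ne_zero this
  constructor
  · intro b hb
    obtain ⟨x0, y0, hx0, hy0⟩ := hint _ (hb 0)
    obtain ⟨x1, y1, hx1, hy1⟩ := hint _ (hb 1)
    refine ⟨x0 * y1 - x1 * y0, ?_⟩
    rw [discr_eq, ← hx0, ← hx1, ← hy0, ← hy1]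
    simp only [map_sub, map_mul, map_pow, map_ofNat]
  · refine ⟨![1, omega], ?_, ?_⟩
    · intro i
      fin_cases i
      · exact isIntegral_one
      · refine IsIntegral.of_pow (n := 2) two_pos ?_
        simp only [Fin.mk_one, Matrix.cons_val_one, Matrix.cons_val_fin_one, sq]
        rw [omega_mul_self, ← IsScalarTower.algebraMap_apply]
        exact isIntegral_algebraMap
    · rw [discr_eq, map_mul, map_ofNat]; simp

open QuadraticAlgebra in
/-- The case in which `(1 + √D) / 2` is integral. -/
theorem isQuadraticDiscr_self [CharZero k] {D E : R} (hD : D = 1 + 4 * E)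
    (hsq : ∀ y : k, (∃ r : R, algebraMap R k r = algebraMap R k D * y ^ 2) →
      ∃ Y : R, algebraMap R k Y = y)
    (h1 : ∀ X Y : R, (4 : R) ∣ X ^ 2 - D * Y ^ 2 → 2 ∣ X - Y) :
    IsQuadraticDiscr R k D D := by
  have hint : ∀ z : QuadraticAlgebra k (algebraMap R k D) 0, IsIntegral R z →
      ∃ x Y : R, 2 * algebraMap R k x + algebraMap R k Y = 2 * z.re ∧
        algebraMap R k Y = 2 * z.im := by
    intro z hz
    obtain ⟨X, Y, hX, hY, hdvd⟩ := exists_two_mul_of_isIntegral hsq hz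
    obtain ⟨x, hx⟩ := h1 X Y hdvd
    refine ⟨x, Y, ?_, hY⟩
    rw [← hX, show X = 2 * x + Y by rw [← hx]; ring, map_add, map_mul, map_ofNat]
  constructor
  · intro b hb
    obtain ⟨x0, y0, hx0, hy0⟩ := hint _ (hb 0)
    obtain ⟨x1, y1, hx1, hy1⟩ := hint _ (hb 1)
    refine ⟨x0 * y1 - x1 * y0, ?_⟩
    have e0 : (b 0).re = algebraMap R k x0 + algebraMap R k y0 / 2 := by
      linear_combination -hx0 / 2
    have e1 : (b 1).re = algebraMap R k x1 + algebraMap R k y1 / 2 := by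
      linear_combination -hx1 / 2
    have f0 : (b 0).im = algebraMap R k y0 / 2 := by linear_combination -hy0 / 2
    have f1 : (b 1).im = algebraMap R k y1 / 2 := by linear_combination -hy1 / 2
    rw [discr_eq, e0, e1, f0, f1]
    simp only [map_sub, map_mul, map_pow]
    ring
  · refine ⟨![1, ⟨1 / 2, 1 / 2⟩], ?_, ?_⟩
    · intro i
      fin_cases i
      · exact isIntegral_one
      · simp only [Fin.mk_one, Matrix.cons_val_one, Matrix.cons_val_fin_one]
        -- a root of `X² - X - E`
        refine ⟨Polynomial.X ^ 2 + (-Polynomial.X - Polynomial.C E), ?_, ?_⟩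
        · refine Polynomial.monic_X_pow_add (n := 2) ?_
          refine lt_of_le_of_lt (Polynomial.degree_sub_le _ _) ?_
          rw [Polynomial.degree_neg, Polynomial.degree_X]
          refine max_lt (by norm_num) (lt_of_le_of_lt Polynomial.degree_C_le (by norm_num))
        · have hE : algebraMap R (QuadraticAlgebra k (algebraMap R k D) 0) E =
              algebraMap k _ (algebraMap R k E) := IsScalarTower.algebraMap_apply _ _ _ _
          simp only [Polynomial.eval₂_add, Polynomial.eval₂_sub, Polynomial.eval₂_pow,
            Polynomial.eval₂_X, Polynomial.eval₂_C, Polynomial.eval₂_neg, hE]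
          have hD' : algebraMap R k D = 1 + 4 * algebraMap R k E := by
            rw [hD, map_add, map_mul, map_one, map_ofNat]
          ext
          · simp [sq, hD']; ring
          · simp [sq]; ring
    · rw [discr_eq]
      simp
      ring

end Discr

/-! ### Square classes -/

theorem squareClass_eq_iff {k : Type} [Field k] (u v : kˣ) :
    (QuotientGroup.mk u : SquareClass k) = QuotientGroup.mk v ↔ ∃ y : k, (u : k) = v * y ^ 2 := by
  rw [QuotientGroup.eq]
  constructor
  · rintro ⟨w, hw⟩
    refine ⟨((w⁻¹ : kˣ) : k), ?_⟩
    have h1 : v = u * w ^ 2 := by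
      rw [powMonoidHom_apply] at hw; rw [hw]; group
    rw [h1]
    have := w.ne_zero
    push_cast
    field_simp
  · rintro ⟨y, hy⟩
    have hy0 : y ≠ 0 := by
      rintro rfl
      exact u.ne_zero (by rw [hy]; ring)
    refine ⟨(Units.mk0 y hy0)⁻¹, ?_⟩
    rw [powMonoidHom_apply]
    ext
    push_cast
    rw [hy]
    have := v.ne_zero
    simp only [Units.val_mk0]
    field_simp

open QuadraticAlgebra in
/-- The quadratic étale algebra attached to a square class is `k(√u)` for its representative. -/
def quadraticAlgebraEquiv (k : Type) [Field k] (ξ : SquareClass k) :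
    QuadraticAlgebra k ((Quotient.out ξ : kˣ) : k) 0 ≃ₐ[k] quadraticAlgebra k ξ :=
  AlgEquiv.ofAlgHom
    (liftSqrt (AdjoinRoot.root _) (by
      have h := AdjoinRoot.eval₂_root
        (Polynomial.X ^ 2 - Polynomial.C ((Quotient.out ξ : kˣ) : k) : Polynomial k)
      simp only [Polynomial.eval₂_sub, Polynomial.eval₂_pow, Polynomial.eval₂_X,
        Polynomial.eval₂_C] at h
      rw [← sq, sub_eq_zero.1 h]
      rfl))
    (AdjoinRoot.liftAlgHom _ (Algebra.ofId k _) omega (by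
      simp only [Polynomial.eval₂_sub, Polynomial.eval₂_pow, Polynomial.eval₂_X,
        Polynomial.eval₂_C]
      rw [sq, omega_mul_self, sub_eq_zero]
      rfl))
    (by
      refine AdjoinRoot.algHom_ext ?_
      simp [liftSqrt_omega])
    (by
      refine algHom_ext ?_
      simp [liftSqrt_omega])

open QuadraticAlgebra in
/-- An isomorphism sends `√u` to an element of trace `0`, that is, to a multiple of `√v`. -/
theorem nonempty_algEquiv_iff {k : Type} [Field k] [CharZero k] (u v : kˣ) :
    Nonempty (QuadraticAlgebra k (u : k) 0 ≃ₐ[k] QuadraticAlgebra k (v : k) 0) ↔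
      ∃ y : k, (u : k) = v * y ^ 2 := by
  constructor
  · rintro ⟨f⟩
    set t := f omega with ht
    have h1 : t * t = algebraMap k _ (u : k) := by
      rw [ht, ← map_mul, omega_mul_self, AlgEquiv.commutes]
    have hre : t.re * t.re + v * t.im * t.im = u := by
      have := congrArg QuadraticAlgebra.re h1; simpa using this
    have him : t.re * t.im + t.im * t.re = 0 := by
      have := congrArg QuadraticAlgebra.im h1; simpa using this
    have him0 : t.im ≠ 0 := by
      intro h
      have h2 : t = algebraMap k _ t.re := by ext <;> simp [h]
      have h3 : (omega : QuadraticAlgebra k (u : k) 0) = algebraMap k _ t.re := by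
        apply f.injective
        rw [AlgEquiv.commutes, ← h2]
      have := congrArg QuadraticAlgebra.im h3
      simp at this
    have hre0 : t.re = 0 := by
      have h2 : 2 * (t.re * t.im) = 0 := by linear_combination him
      simpa [him0] using h2
    refine ⟨t.im, ?_⟩
    rw [hre0] at hre
    linear_combination -hre
  · rintro ⟨y, hy⟩
    have hy0 : y ≠ 0 := by
      rintro rfl
      exact u.ne_zero (by rw [hy]; ring)
    refine ⟨equivOfSqrt (y • omega) ?_ ?_ (finrank_eq_two _ _)⟩
    · rw [smul_mul_smul_comm, omega_mul_self, hy, Algebra.smul_def, ← map_mul]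
      congr 1; ring
    · rintro ⟨x, hx⟩
      have := congrArg QuadraticAlgebra.im hx
      simp at this
      exact hy0 this.symm

theorem nonempty_algEquiv_quadraticAlgebra_iff {k : Type} [Field k] [CharZero k] (u : kˣ)
    (ξ : SquareClass k) :
    Nonempty (QuadraticAlgebra k (u : k) 0 ≃ₐ[k] quadraticAlgebra k ξ) ↔
      (QuotientGroup.mk u : SquareClass k) = ξ := by
  have h1 : (QuotientGroup.mk (Quotient.out ξ) : SquareClass k) = ξ := Quotient.out_eq ξ
  conv_rhs => rw [← h1]
  rw [squareClass_eq_iff, ← nonempty_algEquiv_iff]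
  exact ⟨fun ⟨f⟩ => ⟨f.trans (quadraticAlgebraEquiv k ξ).symm⟩,
    fun ⟨f⟩ => ⟨f.trans (quadraticAlgebraEquiv k ξ)⟩⟩

open QuadraticAlgebra in
/-- Base change of `F(√D)`. -/
def tensorQuadraticEquiv {F k : Type*} [Field F] [Field k] [Algebra F k] (D : F) :
    (k ⊗[F] QuadraticAlgebra F D 0) ≃ₐ[k] QuadraticAlgebra k (algebraMap F k D) 0 :=
  AlgEquiv.ofAlgHom
    (Algebra.TensorProduct.lift (Algebra.ofId k _) (liftSqrt omega (by
      rw [omega_mul_self, ← IsScalarTower.algebraMap_apply])) fun _ _ => Commute.all _ _)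
    (liftSqrt (1 ⊗ₜ omega) (by
      rw [Algebra.TensorProduct.tmul_mul_tmul, omega_mul_self, mul_one,
        Algebra.TensorProduct.algebraMap_apply, Algebra.algebraMap_eq_smul_one,
        Algebra.algebraMap_self_apply, Algebra.algebraMap_eq_smul_one,
        TensorProduct.smul_tmul]))
    (by
      refine algHom_ext ?_
      simp [liftSqrt_omega])
    (by
      refine Algebra.TensorProduct.ext (by ext) ?_
      refine algHom_ext ?_
      simp [liftSqrt_omega])


/-! ### Quadratic fields and squarefree integers -/

/-- The fundamental discriminant attached to `D`: for squarefree `D ≠ 1` it is the discriminant of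
`ℚ(√D)`. -/
def fundDisc (D : ℤ) : ℤ := if D % 4 = 1 then D else 4 * D

theorem fundDisc_ne_zero {D : ℤ} (hD : D ≠ 0) : fundDisc D ≠ 0 := by
  rw [fundDisc]; split_ifs <;> omega

theorem Int.not_four_dvd_of_squarefree {D : ℤ} (hD : Squarefree D) : ¬ (4 : ℤ) ∣ D := fun h => by
  have := hD 2 (by simpa using h)
  exact absurd (Int.isUnit_iff.1 this) (by norm_num)

theorem fundDisc_injOn {D D' : ℤ} (hD : Squarefree D) (hD' : Squarefree D')
    (h : fundDisc D = fundDisc D') : D = D' := by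
  have h1 := Int.not_four_dvd_of_squarefree hD
  have h2 := Int.not_four_dvd_of_squarefree hD'
  rw [fundDisc, fundDisc] at h
  split_ifs at h <;> omega

theorem Int.sq_emod_four (x : ℤ) : x ^ 2 % 4 = if x % 2 = 0 then 0 else 1 := by
  obtain ⟨y, rfl | rfl⟩ := Int.even_or_odd' x
  · rw [if_pos (by omega), show (2 * y) ^ 2 = 4 * y ^ 2 by ring]; omega
  · rw [if_neg (by omega), show (2 * y + 1) ^ 2 = 4 * (y ^ 2 + y) + 1 by ring]; omega

theorem Int.four_dvd_sq_sub_iff {D X Y : ℤ} (h : (4 : ℤ) ∣ X ^ 2 - D * Y ^ 2) :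
    (D % 4 = 1 → 2 ∣ X - Y) ∧ (D % 4 ≠ 0 → D % 4 ≠ 1 → 2 ∣ X ∧ 2 ∣ Y) := by
  have hX := Int.sq_emod_four X
  have hY := Int.sq_emod_four Y
  have h1 : (X ^ 2 - (D % 4) * (Y ^ 2 % 4)) % 4 = 0 := by
    have h2 : (X ^ 2 - D * Y ^ 2) % 4 = 0 := Int.emod_eq_zero_of_dvd h
    rw [Int.sub_emod, Int.mul_emod] at h2
    rw [Int.sub_emod, Int.mul_emod, Int.emod_emod, Int.emod_emod]
    exact h2
  rw [hY] at h1
  have h4 : 0 ≤ D % 4 ∧ D % 4 < 4 := ⟨Int.emod_nonneg _ (by norm_num), Int.emod_lt_of_pos _ (by norm_num)⟩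
  obtain h5 | h5 | h5 | h5 : D % 4 = 0 ∨ D % 4 = 1 ∨ D % 4 = 2 ∨ D % 4 = 3 := by omega
  all_goals
    rw [h5] at h1 ⊢
    split_ifs at hX h1 <;> constructor <;> intros <;> omega

theorem isQuadraticDiscr_fundDisc {D : ℤ} (hD : Squarefree D) :
    IsQuadraticDiscr ℤ ℚ D (fundDisc D) := by
  have hsq : ∀ y : ℚ, (∃ r : ℤ, algebraMap ℤ ℚ r = algebraMap ℤ ℚ D * y ^ 2) →
      ∃ Y : ℤ, algebraMap ℤ ℚ Y = y := by
    rintro y ⟨r, hr⟩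
    refine ⟨y.num, ?_⟩
    have hd0 : (y.den : ℚ) ≠ 0 := by exact_mod_cast y.den_nz
    have h1 : r * (y.den : ℤ) ^ 2 = D * y.num ^ 2 := by
      have h2 : (y : ℚ) = y.num / y.den := (Rat.num_div_den y).symm
      rw [h2] at hr
      simp only [algebraMap_int_eq, eq_intCast] at hr
      field_simp at hr
      exact_mod_cast hr
    have hcop : IsCoprime ((y.den : ℤ) ^ 2) (y.num ^ 2) := by
      refine IsCoprime.pow ?_
      rw [Int.isCoprime_iff_gcd_eq_one, Int.gcd_comm]
      exact y.reduced
    have h3 : (y.den : ℤ) * y.den ∣ D := by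
      rw [← sq]
      exact hcop.dvd_of_dvd_mul_right ⟨r, by rw [← h1]; ring⟩
    have h4 : y.den = 1 := by
      have := Int.isUnit_iff.1 (hD _ h3)
      omega
    simp only [algebraMap_int_eq, eq_intCast]
    exact Rat.coe_int_num_of_den_eq_one h4
  have hD4 := Int.not_four_dvd_of_squarefree hD
  rw [fundDisc]
  split_ifs with h
  · exact isQuadraticDiscr_self (E := D / 4) (by omega) hsq fun X Y hXY =>
      (Int.four_dvd_sq_sub_iff hXY).1 h
  · exact isQuadraticDiscr_four_mul hsq fun X Y hXY =>
      (Int.four_dvd_sq_sub_iff hXY).2 (by omega) h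

/-- The discriminant of an integral basis is `Δ` times a square, and `Δ`, as the discriminant of a
pair of integral elements, is the discriminant of the basis times a square; so they agree. -/
theorem discr_eq_of_isQuadraticDiscr {K : Type*} [Field K] [NumberField K] {D Δ : ℤ} (hΔ : Δ ≠ 0)
    (h : IsQuadraticDiscr ℤ ℚ D Δ) (e : K ≃ₐ[ℚ] QuadraticAlgebra ℚ (algebraMap ℤ ℚ D) 0) :
    NumberField.discr K = Δ := by
  have hfin : Module.finrank ℚ K = 2 := by
    rw [e.toLinearEquiv.finrank_eq, QuadraticAlgebra.finrank_eq_two]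
  have hcard : Fintype.card (Module.Free.ChooseBasisIndex ℤ (NumberField.RingOfIntegers K)) = 2 := by
    rw [← Module.finrank_eq_card_basis (NumberField.integralBasis K), hfin]
  set ε := Fintype.equivFinOfCardEq hcard
  set B := (NumberField.integralBasis K).reindex ε with hB
  have hBdisc : ((NumberField.discr K : ℤ) : ℚ) = Algebra.discr ℚ B := by
    rw [NumberField.coe_discr, hB, Module.Basis.coe_reindex, Algebra.discr_reindex]
  have hBint : ∀ i, IsIntegral ℤ (B i) := by
    intro i
    rw [hB, Module.Basis.reindex_apply, NumberField.integralBasis_apply]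
    exact NumberField.RingOfIntegers.isIntegral_coe _
  obtain ⟨t, ht⟩ := h.1 (e ∘ B) fun i => (hBint i).map (e.toAlgHom.restrictScalars ℤ)
  rw [← Algebra.discr_eq_discr_of_algEquiv, ← hBdisc] at ht
  obtain ⟨b, hb, hbΔ⟩ := h.2
  set v : Fin 2 → K := e.symm ∘ b with hv
  have hvint : ∀ i, IsIntegral ℤ (v i) := fun i =>
    (hb i).map (e.symm.toAlgHom.restrictScalars ℤ)
  have hvdisc : Algebra.discr ℚ v = algebraMap ℤ ℚ Δ := by
    rw [hv, ← Algebra.discr_eq_discr_of_algEquiv, hbΔ]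
  have hrepr : ∀ i j, ∃ n : ℤ, (n : ℚ) = B.toMatrix v i j := by
    intro i j
    obtain ⟨x, hx⟩ : ∃ x : NumberField.RingOfIntegers K, algebraMap _ K x = v j :=
      ⟨⟨v j, hvint j⟩, rfl⟩
    refine ⟨(NumberField.RingOfIntegers.basis K).repr x (ε.symm i), ?_⟩
    rw [Module.Basis.toMatrix_apply, hB, Module.Basis.repr_reindex_apply, ← hx,
      NumberField.integralBasis_repr_apply]
    simp
  choose P hP using hrepr
  have hdet : B.toMatrix v = (Matrix.of P).map (Int.castRingHom ℚ) := by
    ext i j; simp [hP]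
  have h2 := Algebra.discr_of_matrix_vecMul (A := ℚ) B (B.toMatrix v)
  rw [Module.Basis.toMatrix_map_vecMul, hvdisc, ← hBdisc, hdet, ← RingHom.mapMatrix_apply,
    ← RingHom.map_det] at h2
  have h3 : Δ = (Matrix.of P).det ^ 2 * NumberField.discr K := by
    simp only [algebraMap_int_eq, eq_intCast] at h2
    exact_mod_cast h2
  have h4 : NumberField.discr K = Δ * t ^ 2 := by
    simp only [algebraMap_int_eq, eq_intCast] at ht
    exact_mod_cast ht
  set u := (Matrix.of P).det
  have h5 : u ^ 2 * t ^ 2 = 1 := by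
    have : Δ * (u ^ 2 * t ^ 2) = Δ * 1 := by
      conv_rhs => rw [mul_one, h3, h4]
      ring
    exact mul_left_cancel₀ hΔ this
  have h6 : t ^ 2 = 1 := by
    have h7 : IsUnit (t ^ 2) := IsUnit.of_mul_eq_one (u ^ 2) (by rw [mul_comm]; exact h5)
    rcases Int.isUnit_iff.1 h7 with h | h
    · exact h
    · nlinarith [sq_nonneg t]
  rw [h4, h6, mul_one]

/-- Every nonzero rational number is a squarefree integer times a square. -/
theorem exists_squarefree_mul_sq {c : ℚ} (hc : c ≠ 0) :
    ∃ (D : ℤ) (r : ℚ), Squarefree D ∧ r ≠ 0 ∧ c = D * r ^ 2 := by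
  obtain ⟨a, b, hab, ha⟩ := Nat.sq_mul_squarefree (c.num.natAbs * c.den)
  have hnum : c.num ≠ 0 := Rat.num_ne_zero.2 hc
  have hb0 : b ≠ 0 := by
    rintro rfl
    have : c.num.natAbs * c.den = 0 := by rw [← hab]; ring
    rcases Nat.mul_eq_zero.1 this with h | h
    · exact hnum (Int.natAbs_eq_zero.1 h)
    · exact c.den_nz h
  have hden : (c.den : ℚ) ≠ 0 := by exact_mod_cast c.den_nz
  have hbQ : (b : ℚ) ≠ 0 := by exact_mod_cast hb0
  refine ⟨c.num.sign * a, b / c.den, ?_, div_ne_zero hbQ hden, ?_⟩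
  · rw [← Int.squarefree_natAbs, Int.natAbs_mul, Int.natAbs_sign_of_ne_zero hnum, one_mul,
      Int.natAbs_natCast]
    exact ha
  · have h1 : ((c.num.sign * (c.num.natAbs : ℤ) : ℤ) : ℚ) = c.num := by
      rw [Int.sign_mul_natAbs]
    have h2 : (b : ℚ) ^ 2 * a = c.num.natAbs * c.den := by exact_mod_cast hab
    have h3 : c = c.num / c.den := (Rat.num_div_den c).symm
    push_cast at h1 ⊢
    calc c = c.num / c.den := h3
      _ = (c.num.sign : ℚ) * ((c.num.natAbs : ℚ) * c.den) / c.den ^ 2 := by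
          rw [← h1, Nat.cast_natAbs, Int.cast_abs]; field_simp
      _ = _ := by rw [← h2]; field_simp

theorem Int.not_isSquare_of_squarefree {D : ℤ} (hD : Squarefree D) (h1 : D ≠ 1) (r : ℚ) :
    (D : ℚ) ≠ r ^ 2 := by
  intro h
  have h2 : IsSquare (D : ℚ) := ⟨r, by rw [h, sq]⟩
  obtain ⟨c, hc⟩ := Rat.isSquare_intCast_iff.1 h2
  have := Int.isUnit_iff.1 (hD c ⟨1, by rw [hc]; ring⟩)
  rcases this with rfl | rfl <;> exact h1 (by rw [hc]; norm_num)

open QuadraticAlgebra in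
theorem QuadraticField.exists_equiv (K : QuadraticField) :
    ∃ D : ℤ, Squarefree D ∧ D ≠ 1 ∧
      Nonempty (K.1 ≃ₐ[ℚ] QuadraticAlgebra ℚ (algebraMap ℤ ℚ D) 0) := by
  have : Module.Finite ℚ K.1 := Module.finite_of_finrank_eq_succ K.2
  obtain ⟨α, hα⟩ : ∃ α : K.1, α ∉ Set.range (algebraMap ℚ K.1) := by
    by_contra! h
    have h1 : Module.finrank ℚ K.1 = 1 := by
      refine finrank_eq_one (1 : K.1) one_ne_zero fun w => ?_
      obtain ⟨c, hc⟩ := h w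
      exact ⟨c, by rw [← hc, Algebra.algebraMap_eq_smul_one]⟩
    rw [K.2] at h1; omega
  have hli : LinearIndependent ℚ ![(1 : K.1), α] := by
    rw [LinearIndependent.pair_iff' one_ne_zero]
    intro a ha
    exact hα ⟨a, by rw [← ha, Algebra.algebraMap_eq_smul_one]⟩
  have hspan := hli.span_eq_top_of_card_eq_finrank (by rw [K.2]; rfl)
  have hmem : α * α ∈ Submodule.span ℚ (Set.range ![(1 : K.1), α]) := by rw [hspan]; trivial
  rw [Matrix.range_cons, Matrix.range_cons, Matrix.range_empty, Set.union_empty,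
    Set.singleton_union, Submodule.mem_span_pair] at hmem
  obtain ⟨x, y, hxy⟩ := hmem
  -- complete the square
  set s := α - algebraMap ℚ K.1 (y / 2) with hs
  have hss : s * s = algebraMap ℚ K.1 (x + y ^ 2 / 4) := by
    have h2 : α * α = algebraMap ℚ K.1 x + algebraMap ℚ K.1 y * α := by
      rw [← hxy, Algebra.smul_def, Algebra.smul_def, mul_one]
    have h3 : algebraMap ℚ K.1 y = 2 * algebraMap ℚ K.1 (y / 2) := by
      rw [← map_ofNat (algebraMap ℚ K.1) 2, ← map_mul]; congr 1; ring
    have h4 : algebraMap ℚ K.1 (y ^ 2 / 4) = algebraMap ℚ K.1 (y / 2) ^ 2 := by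
      rw [← map_pow]; congr 1; ring
    rw [hs, map_add, h4]
    linear_combination h2 + α * h3
  have hsr : s ∉ Set.range (algebraMap ℚ K.1) := by
    rintro ⟨c, hc⟩
    refine hα ⟨c + y / 2, ?_⟩
    rw [map_add, hc, hs]; ring
  have hc0 : x + y ^ 2 / 4 ≠ 0 := by
    intro h
    rw [h, map_zero, mul_self_eq_zero] at hss
    exact hsr ⟨0, by rw [hss, map_zero]⟩
  obtain ⟨D, r, hD, hr, hDr⟩ := exists_squarefree_mul_sq hc0
  have hs' : (r⁻¹ • s) * (r⁻¹ • s) = algebraMap ℚ K.1 (algebraMap ℤ ℚ D) := by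
    rw [smul_mul_smul_comm, hss, Algebra.smul_def, ← map_mul, hDr]
    congr 1
    simp only [algebraMap_int_eq, eq_intCast]
    field_simp
  have hsr' : r⁻¹ • s ∉ Set.range (algebraMap ℚ K.1) := by
    rintro ⟨c, hc⟩
    refine hsr ⟨r * c, ?_⟩
    rw [map_mul, hc, ← Algebra.smul_def, smul_smul, mul_inv_cancel₀ hr, one_smul]
  refine ⟨D, hD, ?_, ⟨(equivOfSqrt (r⁻¹ • s) hs' hsr' K.2).symm⟩⟩
  rintro rfl
  rw [map_one, map_one] at hs'
  rcases mul_self_eq_one_iff.1 hs' with h | h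
  · exact hsr' ⟨1, by rw [h, map_one]⟩
  · exact hsr' ⟨-1, by rw [h, map_neg, map_one]⟩

theorem exists_sqrt_algebraicClosure (D : ℤ) : ∃ s : AlgebraicClosure ℚ,
    s * s = algebraMap ℚ _ (algebraMap ℤ ℚ D) := by
  obtain ⟨s, hs⟩ := IsAlgClosed.exists_pow_nat_eq
    (algebraMap ℚ (AlgebraicClosure ℚ) (algebraMap ℤ ℚ D)) (n := 2) two_pos
  exact ⟨s, by rw [← sq, hs]⟩

/-- The embedding of `ℚ(√D)` into the algebraic closure of `ℚ`. -/
def sqrtEmbedding (D : ℤ) :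
    QuadraticAlgebra ℚ (algebraMap ℤ ℚ D) 0 →ₐ[ℚ] AlgebraicClosure ℚ :=
  QuadraticAlgebra.liftSqrt _ (exists_sqrt_algebraicClosure D).choose_spec

open QuadraticAlgebra in
theorem exists_quadraticField {D : ℤ} (hD : Squarefree D) (h1 : D ≠ 1) :
    ∃ K : QuadraticField, Nonempty (K.1 ≃ₐ[ℚ] QuadraticAlgebra ℚ (algebraMap ℤ ℚ D) 0) := by
  have : Fact (∀ r : ℚ, r ^ 2 ≠ algebraMap ℤ ℚ D + 0 * r) := ⟨fun r h =>
    Int.not_isSquare_of_squarefree hD h1 r (by rw [h]; simp)⟩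
  have e := AlgEquiv.ofInjectiveField (sqrtEmbedding D)
  refine ⟨⟨(sqrtEmbedding D).fieldRange, ?_⟩, ⟨?_⟩⟩
  · exact e.toLinearEquiv.finrank_eq.symm.trans (finrank_eq_two _ _)
  · exact e.symm

open QuadraticAlgebra in
/-- Two quadratic fields in the algebraic closure that contain a square root of `D` are equal. -/
theorem QuadraticField.eq_of_equiv {D : ℤ} {K L : QuadraticField}
    (e : K.1 ≃ₐ[ℚ] QuadraticAlgebra ℚ (algebraMap ℤ ℚ D) 0)
    (f : L.1 ≃ₐ[ℚ] QuadraticAlgebra ℚ (algebraMap ℤ ℚ D) 0) : K = L := by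
  have key : ∀ {K L : QuadraticField}, (K.1 ≃ₐ[ℚ] QuadraticAlgebra ℚ (algebraMap ℤ ℚ D) 0) →
      (L.1 ≃ₐ[ℚ] QuadraticAlgebra ℚ (algebraMap ℤ ℚ D) 0) → K.1 ≤ L.1 := by
    intro K L e f x hx
    set s : K.1 := e.symm omega
    set t : L.1 := f.symm omega
    have hs : s * s = algebraMap ℚ _ (algebraMap ℤ ℚ D) := by
      rw [← map_mul, omega_mul_self, AlgEquiv.commutes]
    have ht : t * t = algebraMap ℚ _ (algebraMap ℤ ℚ D) := by
      rw [← map_mul, omega_mul_self, AlgEquiv.commutes]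
    have hst : (s : AlgebraicClosure ℚ) ∈ L.1 := by
      have h1 : (s : AlgebraicClosure ℚ) * s = t * t := by
        have h2 := congrArg (algebraMap K.1 (AlgebraicClosure ℚ)) hs
        have h3 := congrArg (algebraMap L.1 (AlgebraicClosure ℚ)) ht
        rw [← IsScalarTower.algebraMap_apply, map_mul] at h2 h3
        exact h2.trans h3.symm
      rcases mul_self_eq_mul_self_iff.1 h1 with h | h
      · rw [h]; exact t.2
      · rw [h]; exact neg_mem t.2
    have hx' : (⟨x, hx⟩ : K.1) = algebraMap ℚ _ (e ⟨x, hx⟩).re + (e ⟨x, hx⟩).im • s := by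
      apply e.injective
      rw [map_add, AlgEquiv.commutes, map_smul, AlgEquiv.apply_symm_apply]
      ext <;> simp
    have hx2 := congrArg (algebraMap K.1 (AlgebraicClosure ℚ)) hx'
    rw [map_add, ← IsScalarTower.algebraMap_apply, Algebra.smul_def, map_mul,
      ← IsScalarTower.algebraMap_apply] at hx2
    change x = _ at hx2
    rw [hx2]
    exact add_mem (L.1.algebraMap_mem _) (mul_mem (L.1.algebraMap_mem _) hst)
  exact Subtype.ext (le_antisymm (key e f) (key f e))

theorem QuadraticField.disc_eq {D : ℤ} (hD : Squarefree D) {K : QuadraticField}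
    (e : K.1 ≃ₐ[ℚ] QuadraticAlgebra ℚ (algebraMap ℤ ℚ D) 0) : K.disc = fundDisc D :=
  discr_eq_of_isQuadraticDiscr (fundDisc_ne_zero hD.ne_zero) (isQuadraticDiscr_fundDisc hD) e


/-! ### Squares and discriminants over the `p`-adic numbers -/

namespace Padic

variable {p : ℕ} [hp : Fact p.Prime]

open Polynomial in
/-- Hensel's lemma for `X² - z` at `1`. -/
theorem _root_.PadicInt.isSquare_of_norm_sub_one_lt {z : ℤ_[p]}
    (hz : ‖z - 1‖ < ‖(2 : ℤ_[p])‖ ^ 2) : ∃ w : ℤ_[p], z = w ^ 2 := by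
  have h := hensels_lemma (p := p) (F := (X ^ 2 - C z : ℤ_[p][X])) (a := (1 : ℤ_[p])) (by
    simp only [map_sub, map_pow, aeval_X, aeval_C, Algebra.algebraMap_self, RingHom.id_apply,
      derivative_X_pow, derivative_C, one_pow, map_mul]
    simpa [norm_sub_rev] using hz)
  obtain ⟨w, hw, -⟩ := h
  refine ⟨w, ?_⟩
  simp only [map_sub, map_pow, aeval_X, aeval_C, Algebra.algebraMap_self, RingHom.id_apply] at hw
  exact (sub_eq_zero.1 hw).symm

/-- Numbers whose quotient is close to `1` have the same square class. -/
theorem exists_sq_of_norm_sub_lt {x y : ℚ_[p]} (h : ‖x - y‖ < ‖y‖ * ‖(2 : ℚ_[p])‖ ^ 2) :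
    ∃ w : ℚ_[p], x = y * w ^ 2 := by
  have hy : y ≠ 0 := by
    rintro rfl
    rw [norm_zero, zero_mul] at h
    exact absurd h (not_lt.2 (norm_nonneg _))
  have hy' : 0 < ‖y‖ := norm_pos_iff.2 hy
  have h2 : ‖(2 : ℚ_[p])‖ ≤ 1 := by exact_mod_cast Padic.norm_int_le_one (p := p) 2
  have h1 : ‖x / y - 1‖ < ‖(2 : ℚ_[p])‖ ^ 2 := by
    rw [div_sub_one hy, norm_div, div_lt_iff₀ hy', mul_comm]
    exact h
  have h3 : ‖x / y‖ ≤ 1 := by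
    have h4 : x / y = (x / y - 1) + 1 := by ring
    rw [h4]
    refine (Padic.nonarchimedean _ _).trans (max_le ?_ (by simp))
    exact h1.le.trans (pow_le_one₀ (norm_nonneg _) h2)
  obtain ⟨w, hw⟩ := PadicInt.isSquare_of_norm_sub_one_lt (z := (⟨x / y, h3⟩ : ℤ_[p])) (by
    rw [PadicInt.norm_def, PadicInt.norm_def]
    exact h1)
  refine ⟨w, ?_⟩
  have h5 : x / y = (w : ℚ_[p]) ^ 2 := by
    have := congrArg (fun t : ℤ_[p] => (t : ℚ_[p])) hw
    simpa using this
  rw [← h5]; field_simp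

theorem exists_int_norm_sub_lt (x : ℚ_[p]) (hx : ‖x‖ ≤ 1) {ε : ℝ} (hε : 0 < ε) :
    ∃ a : ℤ, ‖x - a‖ < ε := by
  obtain ⟨z, rfl⟩ : ∃ z : ℤ_[p], (z : ℚ_[p]) = x := ⟨⟨x, hx⟩, rfl⟩
  obtain ⟨a, ha⟩ := PadicInt.denseRange_intCast.exists_dist_lt z hε
  refine ⟨a, ?_⟩
  rw [dist_eq_norm, PadicInt.norm_def] at ha
  simpa using ha

theorem norm_two_pos : 0 < ‖(2 : ℚ_[p])‖ := norm_pos_iff.2 two_ne_zero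

/-- The valuation of an integer that is not divisible by `p²` is `0` or `1`. -/
theorem valuation_intCast_le_one {a : ℤ} (ha : ¬ (p : ℤ) ^ 2 ∣ a) :
    (a : ℚ_[p]).valuation = if (p : ℤ) ∣ a then 1 else 0 := by
  have ha0 : a ≠ 0 := by rintro rfl; exact ha (dvd_zero _)
  have h2 := (not_congr (padicValInt_dvd_iff (p := p) 2 a)).1 ha
  have h1 := padicValInt_dvd_iff (p := p) 1 a
  rw [pow_one] at h1
  rw [Padic.valuation_intCast]
  split_ifs with h
  · have := h1.1 h; omega
  · have := (not_congr h1).1 h; omega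

theorem intCast_ne_zero_of_not_dvd {a : ℤ} (ha : ¬ (p : ℤ) ^ 2 ∣ a) : (a : ℚ_[p]) ≠ 0 := by
  have ha0 : a ≠ 0 := by rintro rfl; exact ha (dvd_zero _)
  exact_mod_cast ha0

/-- Every class of `p`-adic numbers modulo squares contains an integer that is not divisible by
`p²`. -/
theorem exists_int_mul_sq {u : ℚ_[p]} (hu : u ≠ 0) :
    ∃ a : ℤ, ¬ (p : ℤ) ^ 2 ∣ a ∧ ∃ y : ℚ_[p], u = a * y ^ 2 := by
  have hp1 : (1 : ℝ) < p := by exact_mod_cast hp.out.one_lt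
  have hp0 : (p : ℚ_[p]) ≠ 0 := by exact_mod_cast hp.out.ne_zero
  -- after removing an even power of `p`, the valuation is `0` or `1`, and a close enough integer
  -- lies in the same square class
  set j := u.valuation / 2 with hj
  set u' := u * (p : ℚ_[p]) ^ (-(2 * j)) with hu'
  have hu'0 : u' ≠ 0 := mul_ne_zero hu (zpow_ne_zero _ hp0)
  have hval : u'.valuation = u.valuation % 2 := by
    rw [hu', Padic.valuation_mul hu (zpow_ne_zero _ hp0), Padic.valuation_zpow,
      Padic.valuation_p]
    omega
  have hnorm := Padic.norm_eq_zpow_neg_valuation hu'0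
  have hle : ‖u'‖ ≤ 1 := by
    rw [Padic.norm_le_one_iff_val_nonneg, hval]; omega
  obtain ⟨a, ha⟩ := exists_int_norm_sub_lt u' hle
    (mul_pos (norm_pos_iff.2 hu'0) (pow_pos (norm_two_pos (p := p)) 2))
  have h2 : ‖(2 : ℚ_[p])‖ ≤ 1 := by exact_mod_cast Padic.norm_int_le_one (p := p) 2
  have haeq : ‖u'‖ = ‖(a : ℚ_[p])‖ := by
    refine Padic.norm_eq_of_norm_sub_lt_left (ha.trans_le ?_)
    exact mul_le_of_le_one_right (norm_nonneg _) (pow_le_one₀ (norm_nonneg _) h2)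
  refine ⟨a, ?_, ?_⟩
  · rw [← Padic.norm_int_le_pow_iff_dvd, ← haeq, hnorm, not_le]
    refine zpow_lt_zpow_right₀ hp1 ?_
    push_cast
    omega
  · rw [haeq] at ha
    obtain ⟨w, hw⟩ := exists_sq_of_norm_sub_lt ha
    refine ⟨w * (p : ℚ_[p]) ^ j, ?_⟩
    rw [mul_pow, ← mul_assoc, ← hw, hu', mul_assoc, ← zpow_natCast, ← zpow_mul, ← zpow_add₀ hp0]
    simp [mul_comm]

/-- For integers not divisible by `p²`, a relation `D = a y²` over `ℚ_p` is visible modulo `p⁴`. -/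
theorem exists_int_of_eq_mul_sq {D a : ℤ} (hD : ¬ (p : ℤ) ^ 2 ∣ D) (ha : ¬ (p : ℤ) ^ 2 ∣ a)
    {y : ℚ_[p]} (h : (D : ℚ_[p]) = a * y ^ 2) :
    ∃ t : ℤ, ¬ (p : ℤ) ∣ t ∧ (p : ℤ) ^ 4 ∣ D - a * t ^ 2 := by
  have hp1 : (1 : ℝ) < p := by exact_mod_cast hp.out.one_lt
  have hD0 := intCast_ne_zero_of_not_dvd hD
  have ha0 := intCast_ne_zero_of_not_dvd ha
  have hy0 : y ≠ 0 := by
    rintro rfl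
    exact hD0 (by rw [h]; ring)
  have hv := congrArg Padic.valuation h
  rw [Padic.valuation_mul ha0 (pow_ne_zero 2 hy0), Padic.valuation_pow,
    valuation_intCast_le_one hD, valuation_intCast_le_one ha] at hv
  -- the valuations of `D` and `a` are `0` or `1`, and they differ by an even number
  have hv0 : y.valuation = 0 := by
    push_cast at hv
    split_ifs at hv <;> omega
  have hy1 : ‖y‖ = 1 := by
    rw [Padic.norm_eq_zpow_neg_valuation hy0, hv0]; simp
  obtain ⟨t, ht⟩ := exists_int_norm_sub_lt y hy1.le
    (show (0 : ℝ) < (p : ℝ) ^ (-(4 : ℕ) : ℤ) by positivity)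
  have hlt1 : (p : ℝ) ^ (-(4 : ℕ) : ℤ) < 1 := zpow_lt_one_of_neg₀ hp1 (by norm_num)
  have ht1 : ‖(t : ℚ_[p])‖ = 1 := by
    rw [← hy1]
    exact (Padic.norm_eq_of_norm_sub_lt_left (by rw [hy1]; exact ht.trans hlt1)).symm
  refine ⟨t, fun hdvd => ?_, ?_⟩
  · have := (Padic.norm_intCast_lt_one_iff (p := p)).2 hdvd
    rw [ht1] at this
    exact lt_irrefl _ this
  · have := (Padic.norm_int_le_pow_iff_dvd (p := p) (D - a * t ^ 2) 4).1 (by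
      push_cast
      rw [h, show (a : ℚ_[p]) * y ^ 2 - a * t ^ 2 = a * ((y - t) * (y + t)) by ring, norm_mul,
        norm_mul]
      have h3 : ‖y + t‖ ≤ 1 := (Padic.nonarchimedean _ _).trans (max_le hy1.le ht1.le)
      calc ‖(a : ℚ_[p])‖ * (‖y - t‖ * ‖y + t‖) ≤ 1 * (‖y - t‖ * 1) := by
            gcongr
            exact Padic.norm_int_le_one a
        _ ≤ _ := by rw [one_mul, mul_one]; exact_mod_cast ht.le)
    exact_mod_cast this

end Padic

/-- At an odd prime `2` is a unit, so that both cases of `fundDisc` give generators; at `2` the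
divisibility conditions are checked on integers congruent modulo `4` to the given elements. -/
theorem isQuadraticDiscr_padic {p : ℕ} [hp : Fact p.Prime] {D : ℤ} (hD : ¬ (p : ℤ) ^ 2 ∣ D) :
    IsQuadraticDiscr ℤ_[p] ℚ_[p] (D : ℤ_[p]) ((fundDisc D : ℤ) : ℤ_[p]) := by
  have hD0 := Padic.intCast_ne_zero_of_not_dvd hD
  have hsq : ∀ y : ℚ_[p], (∃ r : ℤ_[p], algebraMap ℤ_[p] ℚ_[p] r =
      algebraMap ℤ_[p] ℚ_[p] D * y ^ 2) → ∃ Y : ℤ_[p], algebraMap ℤ_[p] ℚ_[p] Y = y := by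
    rintro y ⟨r, hr⟩
    refine ⟨⟨y, ?_⟩, rfl⟩
    rcases eq_or_ne y 0 with rfl | hy
    · simp
    have h1 : ‖(D : ℚ_[p]) * y ^ 2‖ ≤ 1 := by
      have h2 : (D : ℚ_[p]) * y ^ 2 = r := by
        simpa using hr.symm
      rw [h2]; exact r.2
    rw [Padic.norm_le_one_iff_val_nonneg] at h1 ⊢
    rw [Padic.valuation_mul hD0 (pow_ne_zero 2 hy), Padic.valuation_pow,
      Padic.valuation_intCast_le_one hD] at h1
    push_cast at h1
    split_ifs at h1 <;> omega
  rcases eq_or_ne p 2 with rfl | hp2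
  · have happrox : ∀ X : ℤ_[2], ∃ (x : ℤ) (z : ℤ_[2]), X = x + 4 * z := by
      intro X
      have h := PadicInt.appr_spec 2 X
      rw [Ideal.mem_span_singleton] at h
      obtain ⟨z, hz⟩ := h
      refine ⟨X.appr 2, z, ?_⟩
      push_cast at hz ⊢
      linear_combination hz
    have hdvd4 : ∀ x : ℤ, (4 : ℤ_[2]) ∣ x → (4 : ℤ) ∣ x := by
      intro x hx
      have := (PadicInt.pow_p_dvd_int_iff (p := 2) 2 x).1 (by
        convert hx using 1; push_cast; norm_num)
      simpa using this
    have hred : ∀ {X Y : ℤ_[2]} {x y : ℤ} {z w : ℤ_[2]}, X = x + 4 * z → Y = y + 4 * w →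
        (4 : ℤ_[2]) ∣ X ^ 2 - D * Y ^ 2 → (4 : ℤ) ∣ x ^ 2 - D * y ^ 2 := by
      rintro X Y x y z w rfl rfl ⟨c, hc⟩
      apply hdvd4
      refine ⟨c - (2 * x * z + 4 * z ^ 2 - D * (2 * y * w + 4 * w ^ 2)), ?_⟩
      push_cast
      linear_combination hc
    have hcast : ∀ {x : ℤ}, 2 ∣ x → (2 : ℤ_[2]) ∣ x := by
      rintro x ⟨c, rfl⟩
      exact ⟨c, by push_cast; ring⟩
    have hD4 : ¬ (4 : ℤ) ∣ D := by simpa using hD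
    rw [fundDisc]
    split_ifs with h
    · refine isQuadraticDiscr_self (E := ((D / 4 : ℤ) : ℤ_[2])) ?_ hsq fun X Y hXY => ?_
      · have : D = 1 + 4 * (D / 4) := by omega
        exact_mod_cast congrArg (Int.cast : ℤ → ℤ_[2]) this
      · obtain ⟨x, z, hX⟩ := happrox X
        obtain ⟨y, w, hY⟩ := happrox Y
        obtain ⟨c, hc⟩ := (Int.four_dvd_sq_sub_iff (hred hX hY hXY)).1 h
        refine ⟨c + 2 * z - 2 * w, ?_⟩
        rw [hX, hY]
        have : (x : ℤ_[2]) - y = 2 * c := by exact_mod_cast congrArg (Int.cast : ℤ → ℤ_[2]) hc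
        linear_combination this
    · push_cast
      refine isQuadraticDiscr_four_mul hsq fun X Y hXY => ?_
      obtain ⟨x, z, hX⟩ := happrox X
      obtain ⟨y, w, hY⟩ := happrox Y
      obtain ⟨h1, h2⟩ := (Int.four_dvd_sq_sub_iff (hred hX hY hXY)).2 (by omega) h
      have h4 : (2 : ℤ_[2]) ∣ 4 := ⟨2, by norm_num⟩
      rw [hX, hY]
      exact ⟨dvd_add (hcast h1) (h4.mul_right _), dvd_add (hcast h2) (h4.mul_right _)⟩
  · have h2u : IsUnit (2 : ℤ_[p]) := by
      rw [PadicInt.isUnit_iff]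
      have h2p : ¬ (p : ℤ) ∣ 2 := by
        intro h
        have h3 : p ∣ 2 := by exact_mod_cast h
        exact hp2 ((Nat.prime_dvd_prime_iff_eq hp.out Nat.prime_two).1 h3)
      have := (PadicInt.norm_intCast_eq_one_iff (p := p) (z := 2)).2
        (((Nat.prime_iff_prime_int.1 hp.out).coprime_iff_not_dvd.2 h2p).symm)
      exact_mod_cast this
    rw [fundDisc]
    split_ifs with h
    · refine isQuadraticDiscr_self (E := ((D / 4 : ℤ) : ℤ_[p])) ?_ hsq fun X Y _ => h2u.dvd
      have : D = 1 + 4 * (D / 4) := by omega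
      exact_mod_cast congrArg (Int.cast : ℤ → ℤ_[p]) this
    · push_cast
      exact isQuadraticDiscr_four_mul hsq fun X Y _ => ⟨h2u.dvd, h2u.dvd⟩

/-- The discriminant ideal attached to the class of `D`. -/
theorem localDiscriminant_eq {p : ℕ} [hp : Fact p.Prime] {D : ℤ} (hD : ¬ (p : ℤ) ^ 2 ∣ D)
    (ξ : SquareClass ℚ_[p]) (u : ℚ_[p]ˣ) (hu : (u : ℚ_[p]) = D)
    (hξ : (QuotientGroup.mk u : SquareClass ℚ_[p]) = ξ) :
    localDiscriminant p ξ = Ideal.span {((fundDisc D : ℤ) : ℤ_[p])} := by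
  obtain ⟨e⟩ := (nonempty_algEquiv_quadraticAlgebra_iff u ξ).2 hξ
  have hu' : (u : ℚ_[p]) = algebraMap ℤ_[p] ℚ_[p] (D : ℤ_[p]) := by simp [hu]
  rw [hu'] at e
  obtain ⟨h1, b, hb, hbΔ⟩ := isQuadraticDiscr_padic hD
  apply le_antisymm
  · rw [localDiscriminant, Ideal.span_le]
    rintro x ⟨c, hc, hx⟩
    obtain ⟨t, ht⟩ := h1 (e.symm ∘ c) fun i => (hc i).map (e.symm.toAlgHom.restrictScalars ℤ_[p])
    rw [← Algebra.discr_eq_discr_of_algEquiv, ← hx] at ht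
    have hx' : x = (fundDisc D : ℤ) * t ^ 2 := by
      apply PadicInt.ext
      exact ht
    rw [SetLike.mem_coe, Ideal.mem_span_singleton, hx']
    exact dvd_mul_right _ _
  · rw [Ideal.span_le, Set.singleton_subset_iff]
    refine Ideal.subset_span ⟨e ∘ b, fun i => (hb i).map (e.toAlgHom.restrictScalars ℤ_[p]), ?_⟩
    rw [← Algebra.discr_eq_discr_of_algEquiv, hbΔ]
    rfl

theorem localWeight_finite {p : Nat.Primes} {D : ℤ} (hD : ¬ ((p : ℕ) : ℤ) ^ 2 ∣ D)
    (ξ : SquareClass ℚ_[(p : ℕ)]) (u : ℚ_[(p : ℕ)]ˣ) (hu : (u : ℚ_[(p : ℕ)]) = D)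
    (hξ : (QuotientGroup.mk u : SquareClass ℚ_[(p : ℕ)]) = ξ) :
    localWeight (.finite p) ξ = 1 / 2 * ‖((fundDisc D : ℤ) : ℚ_[(p : ℕ)])‖ := by
  have h := localDiscriminant_eq hD ξ u hu hξ
  have h1 : Ideal.span {Submodule.IsPrincipal.generator (localDiscriminant (p : ℕ) ξ)} =
      Ideal.span {((fundDisc D : ℤ) : ℤ_[(p : ℕ)])} := by
    rw [Ideal.span_singleton_generator, h]
  rw [Ideal.span_singleton_eq_span_singleton] at h1
  obtain ⟨w, hw⟩ := h1
  change 1 / 2 * ‖Submodule.IsPrincipal.generator (localDiscriminant (p : ℕ) ξ)‖ = _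
  have h2 := congrArg norm hw
  rw [norm_mul, PadicInt.norm_units, mul_one] at h2
  rw [h2, PadicInt.norm_intCast_eq_padic_norm]


/-! ### The sum over quadratic fields as a sum over squarefree integers -/

namespace RatPlace

/-- The integers used to represent square classes at `v`: `±1` at the archimedean place, and the
integers not divisible by `p²` at `p`. -/
def IsNormalized : RatPlace → ℤ → Prop
  | infinite, a => a = 1 ∨ a = -1
  | finite p, a => ¬ ((p : ℕ) : ℤ) ^ 2 ∣ a

/-- `D` and `a` have the same square class in `ℚ_v`. -/
def Matches : RatPlace → ℤ → ℤ → Prop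
  | infinite, a, D => 0 < D * a
  | finite p, a, D => ∃ y : ℚ_[(p : ℕ)], (D : ℚ_[(p : ℕ)]) = a * y ^ 2

/-- The weight `δ_{ξ,v}` of the class `ξ` of the integer `a`. -/
def weight : RatPlace → ℤ → ℝ
  | infinite, _ => 1 / 2
  | finite p, a => 1 / 2 * ‖((fundDisc a : ℤ) : ℚ_[(p : ℕ)])‖

instance charZeroCompletion (v : RatPlace) : CharZero v.Completion :=
  algebraRat.charZero _

theorem _root_.Real.exists_eq_mul_sq_iff {D a : ℤ} (hD : D ≠ 0) (ha : a = 1 ∨ a = -1) :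
    (∃ y : ℝ, (D : ℝ) = a * y ^ 2) ↔ 0 < D * a := by
  have haa : (a : ℝ) * a = 1 := by rcases ha with rfl | rfl <;> norm_num
  constructor
  · rintro ⟨y, hy⟩
    have h1 : (0 : ℝ) ≤ D * a := by
      rw [hy, show (a : ℝ) * y ^ 2 * a = (a * a) * y ^ 2 by ring, haa, one_mul]
      exact sq_nonneg y
    have h2 : D * a ≠ 0 := mul_ne_zero hD (by rcases ha with rfl | rfl <;> norm_num)
    have h3 : (0 : ℤ) ≤ D * a := by exact_mod_cast h1
    omega
  · intro h
    have h1 : (0 : ℝ) < D * a := by exact_mod_cast h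
    refine ⟨√(D * a), ?_⟩
    rw [Real.sq_sqrt h1.le]
    linear_combination -(D : ℝ) * haa

/-- The local condition on `K = ℚ(√D)` says that `D` and a representative `a` of `ξ` have the same
class in `ℚ_v^× / ℚ_v^{×2}`. -/
theorem nonempty_algEquiv_iff_exists {v : RatPlace} {a D : ℤ} {K : Type} [Field K] [Algebra ℚ K]
    (e : K ≃ₐ[ℚ] QuadraticAlgebra ℚ (algebraMap ℤ ℚ D) 0) (hD : D ≠ 0)
    (ξ : SquareClass v.Completion) (u : v.Completionˣ)
    (hu : (u : v.Completion) = algebraMap ℚ v.Completion a)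
    (hξ : (QuotientGroup.mk u : SquareClass v.Completion) = ξ) :
    Nonempty ((v.Completion ⊗[ℚ] K) ≃ₐ[v.Completion] quadraticAlgebra v.Completion ξ) ↔
      ∃ y : v.Completion, algebraMap ℚ v.Completion D = algebraMap ℚ v.Completion a * y ^ 2 := by
  have hD0 : algebraMap ℚ v.Completion (algebraMap ℤ ℚ D) ≠ 0 := by
    rw [Ne, map_eq_zero]; simpa using hD
  have e1 := (Algebra.TensorProduct.congr (AlgEquiv.refl : v.Completion ≃ₐ[v.Completion] _) e).trans
    (tensorQuadraticEquiv (k := v.Completion) (algebraMap ℤ ℚ D))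
  have h := nonempty_algEquiv_quadraticAlgebra_iff (Units.mk0 _ hD0) ξ
  rw [Units.val_mk0, ← hξ, squareClass_eq_iff, Units.val_mk0, hu] at h
  rw [← hξ]
  refine Iff.trans ⟨fun ⟨f⟩ => ⟨e1.symm.trans f⟩, fun ⟨f⟩ => ⟨e1.trans f⟩⟩ h

/-- Every square class `ξ` at `v` is represented by a normalized integer `a`, in terms of which the
weight of `ξ` and the local condition on the field `ℚ(√D)` can be read off. -/
theorem exists_isNormalized (v : RatPlace) (ξ : SquareClass v.Completion) :
    ∃ a : ℤ, v.IsNormalized a ∧ localWeight v ξ = v.weight a ∧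
      ∀ (K : Type) [Field K] [Algebra ℚ K] (D : ℤ), D ≠ 0 →
        (K ≃ₐ[ℚ] QuadraticAlgebra ℚ (algebraMap ℤ ℚ D) 0) →
        (Nonempty ((v.Completion ⊗[ℚ] K) ≃ₐ[v.Completion] quadraticAlgebra v.Completion ξ) ↔
          v.Matches a D) := by
  obtain ⟨w, hw⟩ := QuotientGroup.mk_surjective ξ
  have key : ∀ a : ℤ, (∃ y : v.Completion, (w : v.Completion) = algebraMap ℚ v.Completion a * y ^ 2) →
      ∃ u : v.Completionˣ, (u : v.Completion) = algebraMap ℚ v.Completion a ∧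
        (QuotientGroup.mk u : SquareClass v.Completion) = ξ := by
    rintro a ⟨y, hy⟩
    have ha0 : algebraMap ℚ v.Completion a ≠ 0 := by
      intro h
      rw [h, zero_mul] at hy
      exact w.ne_zero hy
    refine ⟨Units.mk0 _ ha0, rfl, ?_⟩
    rw [← hw]
    exact ((squareClass_eq_iff _ _).2 ⟨y, hy⟩).symm
  cases v with
  | infinite =>
    obtain ⟨z, hz⟩ : ∃ z : ℝ, (w : Completion .infinite) = z := ⟨_, rfl⟩
    obtain ⟨a, ha, y, hy⟩ : ∃ a : ℤ, (a = 1 ∨ a = -1) ∧ ∃ y : ℝ, z = a * y ^ 2 := by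
      rcases le_total 0 z with h | h
      · exact ⟨1, Or.inl rfl, √z, by rw [Real.sq_sqrt h]; simp⟩
      · exact ⟨-1, Or.inr rfl, √(-z), by rw [Real.sq_sqrt (neg_nonneg.2 h)]; simp⟩
    have hcast : ∀ x : ℤ, algebraMap ℚ (Completion .infinite) (x : ℚ) = (x : ℝ) := fun x =>
      map_intCast (algebraMap ℚ ℝ) x
    obtain ⟨u, hu, hξ⟩ := key a ⟨y, by rw [hcast, hz]; exact hy⟩
    refine ⟨a, ha, rfl, fun K _ _ D hD e => ?_⟩
    rw [nonempty_algEquiv_iff_exists e hD ξ u hu hξ, hcast, hcast]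
    exact Real.exists_eq_mul_sq_iff hD ha
  | finite p =>
    obtain ⟨z, hz⟩ : ∃ z : ℚ_[(p : ℕ)], (w : Completion (.finite p)) = z := ⟨_, rfl⟩
    have hz0 : z ≠ 0 := by rw [← hz]; exact w.ne_zero
    obtain ⟨a, ha, y, hy⟩ := Padic.exists_int_mul_sq hz0
    have hcast : ∀ x : ℤ, algebraMap ℚ (Completion (.finite p)) (x : ℚ) = (x : ℚ_[(p : ℕ)]) :=
      fun x => map_intCast (algebraMap ℚ ℚ_[(p : ℕ)]) x
    obtain ⟨u, hu, hξ⟩ := key a ⟨y, by rw [hcast, hz]; exact hy⟩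
    refine ⟨a, ha, localWeight_finite ha ξ u (hu.trans (hcast a)) hξ, fun K _ _ D hD e => ?_⟩
    rw [nonempty_algEquiv_iff_exists e hD ξ u hu hξ, hcast, hcast]
    rfl

end RatPlace

open RatPlace in
/-- The algebraic part of the argument: the sum over the fields `ℚ(√D)` is a sum over squarefree
`D`, with conditions at the places in `𝕊` in terms of representatives of the local classes. -/
theorem exists_discriminantSum_eq {𝕊 : Finset RatPlace} (Ξ : LocalType 𝕊) :
    ∃ a : RatPlace → ℤ, (∀ v ∈ 𝕊, v.IsNormalized (a v)) ∧
      deltaConst Ξ = ∏ v ∈ 𝕊, v.weight (a v) ∧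
      ∀ (g : ArithmeticFunction ℂ) (m : ℕ) (Y : ℝ), discriminantSum Ξ g m Y =
        open Classical in
        ∑ D ∈ (Finset.Icc (-⌊Y⌋) ⌊Y⌋).filter (fun D : ℤ => Squarefree D ∧ D ≠ 1 ∧
          (|fundDisc D| : ℝ) ≤ Y ∧ ∀ v ∈ 𝕊, v.Matches (a v) D),
          (kroneckerSymbol (fundDisc D) m : ℂ) * g (fundDisc D).natAbs := by
  classical
  have h := fun v : 𝕊 => exists_isNormalized v (Ξ v)
  choose a₀ hn hw hm using h
  set a : RatPlace → ℤ := fun v => if hv : v ∈ 𝕊 then a₀ ⟨v, hv⟩ else 0 with ha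
  have haa : ∀ v : 𝕊, a v = a₀ v := fun v => by simp [ha]
  refine ⟨a, fun v hv => ?_, ?_, fun g m Y => ?_⟩
  · have := hn ⟨v, hv⟩
    rwa [← haa] at this
  · rw [deltaConst, ← Finset.prod_coe_sort 𝕊]
    exact Finset.prod_congr rfl fun v _ => by rw [hw v, haa]
  · rw [discriminantSum]
    have hloc : ∀ (K : QuadraticField) (D : ℤ), Squarefree D →
        (K.1 ≃ₐ[ℚ] QuadraticAlgebra ℚ (algebraMap ℤ ℚ D) 0) →
        (K ∈ fieldFamily Ξ Y ↔ ((|fundDisc D| : ℝ) ≤ Y ∧ ∀ v ∈ 𝕊, v.Matches (a v) D)) := by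
      intro K D hD e
      rw [fieldFamily, Set.mem_ofPred_eq, QuadraticField.disc_eq hD e, and_comm]
      refine and_congr Iff.rfl ⟨fun h v hv => ?_, fun h v => ?_⟩
      · have := (hm ⟨v, hv⟩ K.1 D hD.ne_zero e).1 (h ⟨v, hv⟩)
        rwa [← haa] at this
      · refine (hm v K.1 D hD.ne_zero e).2 ?_
        rw [← haa]
        exact h v v.2
    refine Finset.sum_bij (fun K _ => K.exists_equiv.choose) ?_ ?_ ?_ ?_
    · intro K hK
      obtain ⟨hD, h1, ⟨e⟩⟩ := K.exists_equiv.choose_spec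
      rw [Set.Finite.mem_toFinset, hloc K _ hD e] at hK
      refine Finset.mem_filter.2 ⟨?_, hD, h1, hK⟩
      have h2 : |fundDisc K.exists_equiv.choose| ≤ ⌊Y⌋ := Int.le_floor.2 (by exact_mod_cast hK.1)
      rw [Finset.mem_Icc, ← abs_le]
      refine le_trans ?_ h2
      rw [fundDisc]
      split_ifs with h3
      · exact le_rfl
      · rw [abs_mul]; have := abs_nonneg (K.exists_equiv.choose); norm_num; omega
    · intro K hK L hL hKL
      obtain ⟨-, -, ⟨e⟩⟩ := K.exists_equiv.choose_spec
      obtain ⟨-, -, ⟨f⟩⟩ := L.exists_equiv.choose_spec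
      rw [← hKL] at f
      exact QuadraticField.eq_of_equiv e f
    · intro D hD
      obtain ⟨-, hD, h1, h2⟩ := Finset.mem_filter.1 hD
      obtain ⟨K, ⟨e⟩⟩ := exists_quadraticField hD h1
      refine ⟨K, (Set.Finite.mem_toFinset _).2 ((hloc K D hD e).2 h2), ?_⟩
      obtain ⟨hD', -, ⟨e'⟩⟩ := K.exists_equiv.choose_spec
      exact fundDisc_injOn hD' hD ((QuadraticField.disc_eq hD' e').symm.trans
        (QuadraticField.disc_eq hD e))
    · intro K hK
      obtain ⟨hD, h1, ⟨e⟩⟩ := K.exists_equiv.choose_spec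
      rw [QuadraticField.disc_eq hD e]


/-! ### Square classes of integers over the `p`-adic numbers -/

namespace Padic

theorem exists_sq_of_intCast_dvd_sub {p : ℕ} [hp : Fact p.Prime] (hp2 : p ≠ 2) {u w : ℤ}
    (hw : ¬ (p : ℤ) ∣ w) (h : (p : ℤ) ∣ u - w) : ∃ y : ℚ_[p], (u : ℚ_[p]) = w * y ^ 2 := by
  refine exists_sq_of_norm_sub_lt ?_
  have hint : ∀ z : ℤ, ¬ (p : ℤ) ∣ z → ‖(z : ℚ_[p])‖ = 1 := fun z hz =>
    le_antisymm (Padic.norm_int_le_one z) (not_lt.1 fun h => hz (Padic.norm_intCast_lt_one_iff.1 h))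
  have h2 : ¬ (p : ℤ) ∣ 2 := by
    intro h
    have h3 : p ∣ 2 := by exact_mod_cast h
    exact hp2 ((Nat.prime_dvd_prime_iff_eq hp.out Nat.prime_two).1 h3)
  have h22 := hint 2 h2
  push_cast at h22
  rw [hint w hw, h22, one_pow, one_mul]
  have := (Padic.norm_intCast_lt_one_iff (p := p)).2 h
  exact_mod_cast this

/-- At an odd prime, the square class of `c n` is decided by a quadratic residue symbol. -/
theorem exists_jacobiSym_iff {p : ℕ} [hp : Fact p.Prime] (hp2 : p ≠ 2) {c a : ℤ}
    (hc : ¬ (p : ℤ) ^ 2 ∣ c) (ha : ¬ (p : ℤ) ^ 2 ∣ a) (hca : (p : ℤ) ∣ c ↔ (p : ℤ) ∣ a) :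
    ∃ ε : ℤ, (ε = 1 ∨ ε = -1) ∧ ∀ n : ℤ, ¬ (p : ℤ) ∣ n →
      ((∃ y : ℚ_[p], ((c * n : ℤ) : ℚ_[p]) = a * y ^ 2) ↔ jacobiSym n p = ε) := by
  have hpp : Prime (p : ℤ) := Nat.prime_iff_prime_int.1 hp.out
  obtain ⟨q, c', a', hq, rfl, rfl, hc', ha'⟩ : ∃ q c' a' : ℤ, (q = 1 ∨ q = p) ∧ c = q * c' ∧
      a = q * a' ∧ ¬ (p : ℤ) ∣ c' ∧ ¬ (p : ℤ) ∣ a' := by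
    by_cases h : (p : ℤ) ∣ c
    · obtain ⟨c', rfl⟩ := h
      obtain ⟨a', rfl⟩ := hca.1 (dvd_mul_right _ _)
      refine ⟨p, c', a', Or.inr rfl, rfl, rfl, fun h => hc ?_, fun h => ha ?_⟩
      · rw [sq]; exact mul_dvd_mul_left _ h
      · rw [sq]; exact mul_dvd_mul_left _ h
    · exact ⟨1, c, a, Or.inl rfl, by ring, by ring, h, fun h' => h (hca.2 h')⟩
  have hq0 : q ≠ 0 := by
    rcases hq with rfl | rfl
    · exact one_ne_zero
    · exact hpp.ne_zero
  have hqp : q ∣ p := by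
    rcases hq with rfl | rfl
    · exact one_dvd _
    · exact dvd_rfl
  have hcop : ∀ x : ℤ, ¬ (p : ℤ) ∣ x → jacobiSym x p = 1 ∨ jacobiSym x p = -1 := by
    intro x hx
    refine jacobiSym.eq_one_or_neg_one ?_
    rw [Int.gcd_comm, ← Int.isCoprime_iff_gcd_eq_one]
    exact hpp.coprime_iff_not_dvd.2 hx
  have hca' : ¬ (p : ℤ) ∣ c' * a' := fun h => (hpp.dvd_or_dvd h).elim hc' ha'
  refine ⟨jacobiSym (c' * a') p, hcop _ hca', fun n hn => ?_⟩
  have hcx := hcop _ hca'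
  have hiff : jacobiSym n p = jacobiSym (c' * a') p ↔ jacobiSym (c' * n * a') p = 1 := by
    rw [show c' * n * a' = n * (c' * a') by ring, jacobiSym.mul_left n]
    generalize jacobiSym (c' * a') p = x at hcx ⊢
    rcases hcop n hn with h | h <;> rcases hcx with h' | h' <;> rw [h, h'] <;> norm_num
  rw [hiff]
  constructor
  · rintro ⟨y, hy⟩
    have hcn : ¬ (p : ℤ) ^ 2 ∣ q * c' * n := by
      rw [mul_comm]
      intro h
      exact hc ((hpp.coprime_iff_not_dvd.2 hn).pow_left.dvd_of_dvd_mul_left h)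
    obtain ⟨t, ht, hdvd⟩ := exists_int_of_eq_mul_sq hcn ha hy
    have h1 : q * p ∣ q * (c' * n - a' * t ^ 2) := by
      have h2 : q * (c' * n - a' * t ^ 2) = q * c' * n - q * a' * t ^ 2 := by ring
      rw [h2]
      refine Dvd.dvd.trans ?_ hdvd
      calc q * (p : ℤ) ∣ p * p := mul_dvd_mul_right hqp _
        _ = (p : ℤ) ^ 2 := (sq _).symm
        _ ∣ (p : ℤ) ^ 4 := pow_dvd_pow _ (by norm_num)
    have h2 : (p : ℤ) ∣ c' * n - a' * t ^ 2 := (mul_dvd_mul_iff_left hq0).1 h1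
    have h3 : jacobiSym (c' * n * a') p = jacobiSym ((a' * t) ^ 2) p := by
      refine jacobiSym.mod_left' ?_
      refine (Int.modEq_iff_dvd.2 ?_ : _ ≡ _ [ZMOD p]).symm
      rw [show c' * n * a' - (a' * t) ^ 2 = a' * (c' * n - a' * t ^ 2) by ring]
      exact h2.mul_left _
    rw [h3, jacobiSym.pow_left]
    rcases hcop (a' * t) (fun h => (hpp.dvd_or_dvd h).elim ha' ht) with h | h <;> rw [h] <;> norm_num
  · intro h
    have hprod : ¬ (p : ℤ) ∣ c' * n * a' := fun h =>
      (hpp.dvd_or_dvd h).elim (fun h => (hpp.dvd_or_dvd h).elim hc' hn) ha'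
    rw [← jacobiSym.legendreSym.to_jacobiSym, legendreSym.eq_one_iff p
      (by rwa [Ne, ZMod.intCast_zmod_eq_zero_iff_dvd])] at h
    obtain ⟨x, hx⟩ := h
    obtain ⟨t, rfl⟩ := ZMod.intCast_surjective x
    have hdvd : (p : ℤ) ∣ c' * n * a' - t * t := by
      rw [← ZMod.intCast_eq_intCast_iff_dvd_sub, hx]; push_cast; rfl
    have ht : ¬ (p : ℤ) ∣ t * t := fun h => hprod ((dvd_sub_left h).1 hdvd)
    obtain ⟨w, hw⟩ := exists_sq_of_intCast_dvd_sub hp2 ht hdvd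
    have ha0 : (a' : ℚ_[p]) ≠ 0 := by
      have : a' ≠ 0 := by rintro rfl; exact ha' (dvd_zero _)
      exact_mod_cast this
    refine ⟨t * w / a', ?_⟩
    push_cast at hw ⊢
    field_simp
    linear_combination hw

/-- At `2`, the square class of `2 ^ β d` with `d` odd is decided by `β` and `d` modulo `8`. -/
theorem exists_eq_two_pow_mul_sq_iff {d d' : ℤ} (hd : Odd d) (hd' : Odd d') (β β' : Fin 2) :
    (∃ y : ℚ_[2], ((2 ^ (β : ℕ) * d : ℤ) : ℚ_[2]) = (2 ^ (β' : ℕ) * d' : ℤ) * y ^ 2) ↔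
      β = β' ∧ (d : ZMod 8) = d' := by
  have hnd : ∀ (β : Fin 2) {d : ℤ}, Odd d → ¬ ((2 : ℕ) : ℤ) ^ 2 ∣ 2 ^ (β : ℕ) * d := by
    rintro β d ⟨k, rfl⟩
    fin_cases β <;> simp <;> omega
  constructor
  · rintro ⟨y, hy⟩
    obtain ⟨t, ht, hdvd⟩ := exists_int_of_eq_mul_sq (hnd β hd) (hnd β' hd') hy
    obtain ⟨j, hj⟩ : ∃ j, t ^ 2 = 8 * j + 1 := by
      have h1 : Odd t := by rw [← Int.not_even_iff_odd, even_iff_two_dvd]; exact_mod_cast ht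
      have := Int.sq_mod_four_eq_one_of_odd h1
      obtain ⟨k, rfl⟩ := h1
      obtain ⟨l, hl⟩ := Int.even_mul_succ_self k
      exact ⟨l, by linear_combination 4 * hl⟩
    obtain ⟨k, rfl⟩ := hd
    obtain ⟨l, rfl⟩ := hd'
    rw [hj] at hdvd
    rw [show ((2 * k + 1 : ℤ) : ZMod 8) = ((2 * l + 1 : ℤ) : ZMod 8) ↔ _ from
      ZMod.intCast_eq_intCast_iff_dvd_sub _ _ 8]
    obtain ⟨z, hz⟩ := hdvd
    fin_cases β <;> fin_cases β' <;> simp at hz ⊢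
    · exact ⟨-(2 * z) - (2 * l + 1) * j, by linear_combination -hz⟩
    · ring_nf at hz; generalize j * l = x at hz; omega
    · ring_nf at hz; generalize j * l = x at hz; omega
    · have h2 : 2 * k + 1 - (2 * l + 1) * (8 * j + 1) = 8 * z := by linarith
      exact ⟨-z - (2 * l + 1) * j, by linear_combination -h2⟩
  · rintro ⟨rfl, h⟩
    obtain ⟨y, hy⟩ := exists_sq_of_norm_sub_lt (p := 2) (x := (d : ℚ_[2])) (y := (d' : ℚ_[2])) (by
      have h1 : ((2 : ℕ) : ℤ) ^ 3 ∣ d - d' := by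
        have := (ZMod.intCast_eq_intCast_iff_dvd_sub _ _ 8).1 h.symm
        exact_mod_cast this
      have h2 := (Padic.norm_int_le_pow_iff_dvd (p := 2) _ 3).2 h1
      have h3 : ‖(d' : ℚ_[2])‖ = 1 := le_antisymm (Padic.norm_int_le_one _) (not_lt.1 fun h => by
        rw [Padic.norm_intCast_lt_one_iff] at h
        exact (Int.not_even_iff_odd.2 hd') (even_iff_two_dvd.2 (by exact_mod_cast h)))
      have h4 : ‖(2 : ℚ_[2])‖ = 2⁻¹ := by simpa using Padic.norm_p (p := 2)
      rw [h3, h4]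
      push_cast at h2
      refine lt_of_le_of_lt h2 ?_
      norm_num)
    refine ⟨y, ?_⟩
    push_cast
    rw [hy]; ring

theorem exists_eq_two_pow_mul_odd {a : ℤ} (ha : ¬ (4 : ℤ) ∣ a) :
    ∃ (β : Fin 2) (d : ℤ), Odd d ∧ a = 2 ^ (β : ℕ) * d := by
  rcases Int.even_or_odd' a with ⟨k, rfl | rfl⟩
  · refine ⟨1, k, ?_, by simp⟩
    rw [← Int.not_even_iff_odd, even_iff_two_dvd]
    omega
  · exact ⟨0, 2 * k + 1, ⟨k, rfl⟩, by simp⟩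

end Padic


/-! ### Discriminants by sign, power of two, ramified part and cofactor -/

/-- The `2`-part of the discriminant of `ℚ(√(2 ^ β d))` for odd `d` in the class `e` modulo `8`. -/
def twoPart (β : Fin 2) (e : ZMod 8) : ℕ := if β = 1 then 8 else if e = 1 ∨ e = 5 then 1 else 4

theorem twoPart_pos (β : Fin 2) (e : ZMod 8) : 0 < twoPart β e := by
  rw [twoPart]; split_ifs <;> norm_num

theorem fundDisc_two_pow_mul {d : ℤ} (hd : Odd d) (β : Fin 2) :
    fundDisc (2 ^ (β : ℕ) * d) = twoPart β d * d := by
  have h1 : (d : ZMod 8) = 1 ↔ (8 : ℤ) ∣ 1 - d := by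
    exact_mod_cast ZMod.intCast_eq_intCast_iff_dvd_sub d 1 8
  have h5 : (d : ZMod 8) = 5 ↔ (8 : ℤ) ∣ 5 - d := by
    exact_mod_cast ZMod.intCast_eq_intCast_iff_dvd_sub d 5 8
  obtain ⟨k, rfl⟩ := hd
  rw [fundDisc, twoPart]
  simp only [h1, h5]
  fin_cases β
  · simp only [Fin.zero_eta, Fin.isValue, pow_zero, one_mul, zero_ne_one, if_false]
    split_ifs <;> push_cast <;> omega
  · simp only [Fin.mk_one, Fin.isValue, pow_one, if_true]
    split_ifs <;> push_cast <;> omega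

theorem abs_le_abs_fundDisc (D : ℤ) : |D| ≤ |fundDisc D| := by
  rw [fundDisc]
  split_ifs
  · exact le_rfl
  · rw [abs_mul]; have := abs_nonneg D; norm_num; omega

theorem isUnit_intCast_zmod_eight {d : ℤ} (hd : Odd d) : IsUnit (d : ZMod 8) := by
  rw [ZMod.coe_int_isUnit_iff_isCoprime]
  have : IsCoprime (2 : ℤ) d := by
    rw [Int.prime_two.coprime_iff_not_dvd, ← even_iff_two_dvd, Int.not_even_iff_odd]
    exact hd
  exact this.pow_left (m := 3)

theorem odd_of_isUnit_zmod_eight {n : ℕ} (h : IsUnit (n : ZMod 8)) : Odd n := by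
  rw [ZMod.isUnit_iff_coprime] at h
  exact Nat.Coprime.odd_of_right (h.coprime_dvd_right (by norm_num))

open RatPlace

/-- The product of the primes dividing `T` at which the class of `a` is ramified. -/
def ramifiedPart (a : RatPlace → ℤ) (T : ℕ) : ℕ :=
  open Classical in
  ∏ p ∈ T.primeFactors.filter (fun p : ℕ => ∃ hp : p.Prime, (p : ℤ) ∣ a (.finite ⟨p, hp⟩)), p

theorem ramifiedPart_dvd (a : RatPlace → ℤ) {T : ℕ} : ramifiedPart a T ∣ T := by
  classical
  rw [ramifiedPart]
  exact (Finset.prod_dvd_prod_of_subset _ _ _ (Finset.filter_subset _ _)).trans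
    (Nat.prod_primeFactors_dvd T)

theorem prime_dvd_ramifiedPart_iff (a : RatPlace → ℤ) {T : ℕ} (hT : T ≠ 0) (p : Nat.Primes)
    (hpT : (p : ℕ) ∣ T) : (p : ℕ) ∣ ramifiedPart a T ↔ ((p : ℕ) : ℤ) ∣ a (.finite p) := by
  classical
  rw [ramifiedPart, p.2.prime.dvd_finsetProd_iff]
  constructor
  · rintro ⟨q, hq, hpq⟩
    obtain ⟨hq1, hq2, h⟩ := Finset.mem_filter.1 hq
    have := (Nat.prime_dvd_prime_iff_eq p.2 hq2).1 hpq
    subst this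
    exact h
  · intro h
    exact ⟨p, Finset.mem_filter.2 ⟨Nat.mem_primeFactors.2 ⟨p.2, hpT, hT⟩, p.2, h⟩, dvd_rfl⟩

theorem ramifiedPart_dvd_of_forall (a : RatPlace → ℤ) {T N : ℕ}
    (h : ∀ p : Nat.Primes, (p : ℕ) ∣ T → ((p : ℕ) : ℤ) ∣ a (.finite p) → (p : ℕ) ∣ N) :
    ramifiedPart a T ∣ N := by
  classical
  rw [ramifiedPart]
  refine Finset.prod_primes_dvd N (fun p hp => ?_) fun p hp => ?_
  · exact (Nat.prime_of_mem_primeFactors (Finset.mem_filter.1 hp).1).prime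
  · obtain ⟨hp1, hp2, hp3⟩ := Finset.mem_filter.1 hp
    exact h ⟨p, hp2⟩ (Nat.dvd_of_mem_primeFactors hp1) hp3

/-- At a prime dividing `T`, the local condition on the cofactor `n` is the value of a quadratic
residue symbol. -/
theorem exists_matches_iff_jacobiSym (a : RatPlace → ℤ) {T : ℕ} (hT : Odd T) (hTs : Squarefree T)
    (ha : ∀ p : Nat.Primes, (p : ℕ) ∣ T → ¬ ((p : ℕ) : ℤ) ^ 2 ∣ a (.finite p)) :
    ∃ ε : ℤˣ → Fin 2 → ℕ → ℤ, (∀ s β p, ε s β p = 1 ∨ ε s β p = -1) ∧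
      ∀ (s : ℤˣ) (β : Fin 2) (p : Nat.Primes), (p : ℕ) ∣ T → ∀ n : ℤ, ¬ ((p : ℕ) : ℤ) ∣ n →
        (Matches (.finite p) (a (.finite p)) (s * 2 ^ (β : ℕ) * ramifiedPart a T * n) ↔
          jacobiSym n p = ε s β p) := by
  have key : ∀ (s : ℤˣ) (β : Fin 2) (p : ℕ), ∃ ε : ℤ, (ε = 1 ∨ ε = -1) ∧
      ∀ (hp : p.Prime), p ∣ T → ∀ n : ℤ, ¬ (p : ℤ) ∣ n →
        (Matches (.finite ⟨p, hp⟩) (a (.finite ⟨p, hp⟩))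
          (s * 2 ^ (β : ℕ) * ramifiedPart a T * n) ↔ jacobiSym n p = ε) := by
    intro s β p
    by_cases h : p.Prime ∧ p ∣ T
    · obtain ⟨hp, hpT⟩ := h
      have : Fact p.Prime := ⟨hp⟩
      have hp2 : p ≠ 2 := by
        rintro rfl
        exact (Nat.not_even_iff_odd.2 hT) (even_iff_two_dvd.2 hpT)
      have hpp : Prime (p : ℤ) := Nat.prime_iff_prime_int.1 hp
      have hdvd : ∀ x : ℤ, ∀ k : ℕ, (p : ℤ) ^ k ∣ s * 2 ^ (β : ℕ) * x ↔ (p : ℤ) ^ k ∣ x := by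
        intro x k
        refine ⟨fun h => ?_, fun h => h.mul_left _⟩
        rw [mul_assoc] at h
        have h' := (s.isUnit.dvd_mul_left).1 h
        refine IsCoprime.dvd_of_dvd_mul_left (IsCoprime.pow ?_) h'
        rw [hpp.coprime_iff_not_dvd]
        intro h2
        have h3 : p ∣ 2 := by exact_mod_cast h2
        exact hp2 ((Nat.prime_dvd_prime_iff_eq hp Nat.prime_two).1 h3)
      have h1 : ((p : ℤ) ∣ s * 2 ^ (β : ℕ) * ramifiedPart a T ↔ (p : ℤ) ∣ a (.finite ⟨p, hp⟩)) := by
        have := hdvd (ramifiedPart a T) 1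
        rw [pow_one] at this
        rw [this, ← prime_dvd_ramifiedPart_iff a hTs.ne_zero ⟨p, hp⟩ hpT]
        exact Int.natCast_dvd_natCast
      have h2 : ¬ (p : ℤ) ^ 2 ∣ s * 2 ^ (β : ℕ) * ramifiedPart a T := by
        rw [hdvd]
        intro h
        have h3 : p * p ∣ ramifiedPart a T := by rw [← sq]; exact_mod_cast h
        have := (hTs.squarefree_of_dvd (ramifiedPart_dvd a)) p h3
        exact hp.one_lt.ne' (Nat.isUnit_iff.1 this)
      obtain ⟨ε, hε, h⟩ := Padic.exists_jacobiSym_iff hp2 h2 (ha ⟨p, hp⟩ hpT) h1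
      exact ⟨ε, hε, fun _ _ => h⟩
    · exact ⟨1, Or.inl rfl, fun hp hpT => absurd ⟨hp, hpT⟩ h⟩
  choose ε hε h using key
  exact ⟨ε, hε, fun s β p => h s β p p.2⟩

theorem RatPlace.Matches.dvd_iff {p : Nat.Primes} {a D : ℤ} (ha : ¬ ((p : ℕ) : ℤ) ^ 2 ∣ a)
    (hD : ¬ ((p : ℕ) : ℤ) ^ 2 ∣ D) (h : Matches (.finite p) a D) :
    ((p : ℕ) : ℤ) ∣ D ↔ ((p : ℕ) : ℤ) ∣ a := by
  obtain ⟨y, hy⟩ := h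
  obtain ⟨t, ht, hdvd⟩ := Padic.exists_int_of_eq_mul_sq hD ha hy
  have hpp : Prime ((p : ℕ) : ℤ) := Nat.prime_iff_prime_int.1 p.2
  have h1 := (dvd_pow_self ((p : ℕ) : ℤ) (by norm_num : (4 : ℕ) ≠ 0)).trans hdvd
  refine (dvd_iff_dvd_of_dvd_sub h1).trans
    ⟨fun h => (hpp.dvd_or_dvd h).resolve_right fun h => ht (hpp.dvd_of_dvd_pow h),
      fun h => h.mul_right _⟩


theorem odd_units_mul {d : ℕ} (hd : Odd d) (s : ℤˣ) : Odd ((s : ℤ) * d) := by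
  rcases Int.units_eq_one_or s with rfl | rfl
  · simpa using hd
  · simpa using hd

theorem fundDisc_units_mul {d : ℕ} (hd : Odd d) (s : ℤˣ) (β : Fin 2) {e : ZMod 8}
    (he : (((s : ℤ) * d : ℤ) : ZMod 8) = e) :
    fundDisc (s * 2 ^ (β : ℕ) * d) = twoPart β e * (s * d) := by
  rw [show (s : ℤ) * 2 ^ (β : ℕ) * d = 2 ^ (β : ℕ) * (s * d) by ring,
    fundDisc_two_pow_mul (odd_units_mul hd s), he]

theorem natAbs_fundDisc_units_mul {d : ℕ} (hd : Odd d) (s : ℤˣ) (β : Fin 2) {e : ZMod 8}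
    (he : (((s : ℤ) * d : ℤ) : ZMod 8) = e) :
    (fundDisc (s * 2 ^ (β : ℕ) * d)).natAbs = twoPart β e * d := by
  rw [fundDisc_units_mul hd s β he, Int.natAbs_mul, Int.natAbs_mul, Int.natAbs_natCast,
    Int.natAbs_natCast, Int.units_natAbs, one_mul]

theorem natAbs_units_mul (s : ℤˣ) (β : Fin 2) (d : ℕ) :
    ((s : ℤ) * 2 ^ (β : ℕ) * d).natAbs = 2 ^ (β : ℕ) * d := by
  rw [Int.natAbs_mul, Int.natAbs_mul, Int.units_natAbs, Int.natAbs_natCast, Int.natAbs_pow]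
  simp

theorem squarefree_units_mul {d : ℕ} (hd : Odd d) (s : ℤˣ) (β : Fin 2) :
    Squarefree ((s : ℤ) * 2 ^ (β : ℕ) * d) ↔ Squarefree d := by
  rw [← Int.squarefree_natAbs, natAbs_units_mul, Nat.squarefree_mul
    (Nat.Coprime.pow_left _ (Nat.coprime_two_left.2 hd))]
  refine and_iff_right ?_
  fin_cases β
  · simp
  · simpa using Nat.prime_two.prime.squarefree

theorem units_mul_injective {s s' : ℤˣ} {β β' : Fin 2} {d d' : ℕ} (hd : Odd d) (hd' : Odd d')
    (h : (s : ℤ) * 2 ^ (β : ℕ) * d = s' * 2 ^ (β' : ℕ) * d') : s = s' ∧ β = β' ∧ d = d' := by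
  have h1 := congrArg Int.natAbs h
  rw [natAbs_units_mul, natAbs_units_mul] at h1
  have h2 : β = β' ∧ d = d' := by
    obtain ⟨k, rfl⟩ := hd
    obtain ⟨l, rfl⟩ := hd'
    fin_cases β <;> fin_cases β' <;> simp at h1 ⊢ <;> omega
  obtain ⟨rfl, rfl⟩ := h2
  refine ⟨?_, rfl, rfl⟩
  have hd0 : (d : ℤ) ≠ 0 := by
    obtain ⟨k, rfl⟩ := hd
    omega
  have h3 : (2 : ℤ) ^ (β : ℕ) ≠ 0 := by positivity
  exact Units.ext (mul_right_cancel₀ h3 (mul_right_cancel₀ hd0 h))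

theorem exists_units_mul_eq {D : ℤ} (hD : Squarefree D) :
    ∃ (s : ℤˣ) (β : Fin 2) (d : ℕ), Odd d ∧ D = s * 2 ^ (β : ℕ) * d := by
  obtain ⟨β, d, hd, rfl⟩ := Padic.exists_eq_two_pow_mul_odd (Int.not_four_dvd_of_squarefree hD)
  have hd' : Odd d.natAbs := Int.natAbs_odd.2 hd
  rcases Int.natAbs_eq d with h | h
  · refine ⟨1, β, d.natAbs, hd', ?_⟩
    conv_lhs => rw [h]
    simp
  · refine ⟨-1, β, d.natAbs, hd', ?_⟩
    conv_lhs => rw [h]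
    simp

/-- Every admissible `D` is `s 2^β R n` with a sign `s`, the ramified part `R`, and `n` odd,
squarefree and coprime to `T`; the local conditions become conditions on `n` modulo `8` and on its
residue symbols. -/
theorem sum_squarefree_matches_eq (a : RatPlace → ℤ) {T : ℕ} (hT : Odd T) (hTs : Squarefree T)
    (ha : ∀ p : Nat.Primes, (p : ℕ) ∣ T → ¬ ((p : ℕ) : ℤ) ^ 2 ∣ a (.finite p))
    {ε : ℤˣ → Fin 2 → ℕ → ℤ} (hε : ∀ s β p, ε s β p = 1 ∨ ε s β p = -1)
    (hεa : ∀ (s : ℤˣ) (β : Fin 2) (p : Nat.Primes), (p : ℕ) ∣ T → ∀ n : ℤ, ¬ ((p : ℕ) : ℤ) ∣ n →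
        (Matches (.finite p) (a (.finite p)) (s * 2 ^ (β : ℕ) * ramifiedPart a T * n) ↔
          jacobiSym n p = ε s β p))
    (L : ℤ → Prop) (σ : ℤˣ → Fin 2 → (ZMod 8)ˣ → Prop)
    (hL : ∀ (s : ℤˣ) (β : Fin 2) (d : ℕ) (e : (ZMod 8)ˣ), Odd d →
      (((s : ℤ) * d : ℤ) : ZMod 8) = e → (L (s * 2 ^ (β : ℕ) * d) ↔ σ s β e))
    (f : ℤ → ℂ) {Y : ℝ} (hY : 0 ≤ Y) :
    open Classical in
    ∑ D ∈ (Finset.Icc (-⌊Y⌋) ⌊Y⌋).filter (fun D : ℤ => Squarefree D ∧ (|fundDisc D| : ℝ) ≤ Y ∧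
      L D ∧ ∀ p : Nat.Primes, (p : ℕ) ∣ T → Matches (.finite p) (a (.finite p)) D), f D =
    ∑ τ ∈ (Finset.univ : Finset (ℤˣ × Fin 2 × (ZMod 8)ˣ)).filter (fun τ => σ τ.1 τ.2.1 τ.2.2),
      ∑ n ∈ (Finset.Icc 1 ⌊Y / (twoPart τ.2.1 τ.2.2 * ramifiedPart a T : ℕ)⌋₊).filter
        (fun n : ℕ => Squarefree n ∧
          (((τ.1 : ℤ) * (ramifiedPart a T * n : ℕ) : ℤ) : ZMod 8) = τ.2.2 ∧
          ∀ p ∈ T.primeFactors, jacobiSym n p = ε τ.1 τ.2.1 p),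
        f (τ.1 * 2 ^ (τ.2.1 : ℕ) * (ramifiedPart a T * n : ℕ)) := by
  classical
  set R := ramifiedPart a T with hR
  have hRT : R ∣ T := ramifiedPart_dvd a
  have hRo : Odd R := Odd.of_dvd_nat hT hRT
  have hRs : Squarefree R := hTs.squarefree_of_dvd hRT
  have hR0 : 0 < R := hRo.pos
  have hsize : ∀ (s : ℤˣ) (β : Fin 2) (e : (ZMod 8)ˣ) (n : ℕ), Odd (R * n) →
      (((s : ℤ) * (R * n : ℕ) : ℤ) : ZMod 8) = e →
      ((|fundDisc (s * 2 ^ (β : ℕ) * (R * n : ℕ))| : ℝ) ≤ Y ↔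
        n ≤ ⌊Y / (twoPart β e * R : ℕ)⌋₊) := by
    intro s β e n hn he
    have h0 : 0 < twoPart β e * R := Nat.mul_pos (twoPart_pos β e) hR0
    have h1 : ((twoPart β e * R : ℕ) : ℝ) * n =
        |((fundDisc (s * 2 ^ (β : ℕ) * (R * n : ℕ)) : ℤ) : ℝ)| := by
      rw [← Int.cast_abs, ← Nat.cast_natAbs, natAbs_fundDisc_units_mul hn s β he]
      push_cast; ring
    rw [← h1, Nat.le_floor_iff (by positivity), le_div_iff₀ (by exact_mod_cast h0), mul_comm]
  have hmatch : ∀ (s : ℤˣ) (β : Fin 2) (n : ℕ) (p : Nat.Primes), (p : ℕ) ∣ T → ¬ (p : ℕ) ∣ n →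
      (Matches (.finite p) (a (.finite p)) (s * 2 ^ (β : ℕ) * (R * n : ℕ)) ↔
        jacobiSym n p = ε s β p) := by
    intro s β n p hp hn
    rw [← hεa s β p hp n (by exact_mod_cast hn), Nat.cast_mul, mul_assoc _ (R : ℤ)]
  have hodd : ∀ (s : ℤˣ) (e : (ZMod 8)ˣ) (d : ℕ), (((s : ℤ) * d : ℤ) : ZMod 8) = e → Odd d := by
    intro s e d h
    refine odd_of_isUnit_zmod_eight (isUnit_of_mul_isUnit_right (x := ((s : ℤ) : ZMod 8)) ?_)
    rw [← Int.cast_natCast, ← Int.cast_mul, h]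
    exact e.isUnit
  have hcop : ∀ (s : ℤˣ) (β : Fin 2) (n : ℕ), (∀ p ∈ T.primeFactors, jacobiSym n p = ε s β p) →
      ∀ p : Nat.Primes, (p : ℕ) ∣ T → ¬ (p : ℕ) ∣ n := by
    intro s β n h p hp hn
    have h1 := h p (Nat.mem_primeFactors.2 ⟨p.2, hp, hTs.ne_zero⟩)
    have : NeZero (p : ℕ) := ⟨p.2.ne_zero⟩
    have h2 : jacobiSym n p = 0 := by
      rw [jacobiSym.eq_zero_iff_not_coprime, Int.gcd_natCast_natCast, Nat.gcd_eq_right hn]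
      exact p.2.ne_one
    rcases hε s β p with h3 | h3 <;> rw [h2, h3] at h1 <;> norm_num at h1
  rw [Finset.sum_sigma']
  symm
  refine Finset.sum_bij (fun x _ => (x.1.1 : ℤ) * 2 ^ (x.1.2.1 : ℕ) * (R * x.2 : ℕ)) ?_ ?_ ?_ ?_
  · rintro ⟨⟨s, β, e⟩, n⟩ hx
    obtain ⟨h1, h2⟩ := Finset.mem_sigma.1 hx
    have hσ := (Finset.mem_filter.1 h1).2
    obtain ⟨h3, hns, he, hj⟩ := Finset.mem_filter.1 h2
    dsimp only at hσ h3 he hj ⊢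
    have ho := hodd s e (R * n) he
    have hY' := (hsize s β e n ho he).2 (Finset.mem_Icc.1 h3).2
    have hRn : R.Coprime n := by
      refine Nat.Coprime.coprime_dvd_left hRT (Nat.coprime_of_dvd fun p hp hpT => ?_)
      exact hcop s β n hj ⟨p, hp⟩ hpT
    refine Finset.mem_filter.2 ⟨?_, ?_, hY', (hL s β (R * n) e ho he).2 hσ, fun p hp => ?_⟩
    · have h4 : |fundDisc (s * 2 ^ (β : ℕ) * (R * n : ℕ))| ≤ ⌊Y⌋ :=
        Int.le_floor.2 (by exact_mod_cast hY')
      exact Finset.mem_Icc.2 (abs_le.1 ((abs_le_abs_fundDisc _).trans h4))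
    · rw [squarefree_units_mul ho, Nat.squarefree_mul hRn]
      exact ⟨hRs, hns⟩
    · exact (hmatch s β n p hp (hcop s β n hj p hp)).2
        (hj p (Nat.mem_primeFactors.2 ⟨p.2, hp, hTs.ne_zero⟩))
  · rintro ⟨⟨s, β, e⟩, n⟩ hx ⟨⟨s', β', e'⟩, n'⟩ hx' hxx
    have he := (Finset.mem_filter.1 (Finset.mem_sigma.1 hx).2).2.2.1
    have he' := (Finset.mem_filter.1 (Finset.mem_sigma.1 hx').2).2.2.1
    dsimp only at he he' hxx
    obtain ⟨rfl, rfl, h⟩ := units_mul_injective (hodd s e _ he) (hodd s' e' _ he') hxx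
    rw [← h, he] at he'
    obtain rfl := Units.ext he'
    obtain rfl := Nat.eq_of_mul_eq_mul_left hR0 h
    rfl
  · intro D hD
    obtain ⟨-, hDs, hDY, hDL, hDa⟩ := Finset.mem_filter.1 hD
    obtain ⟨s, β, d, hd, rfl⟩ := exists_units_mul_eq hDs
    have hds : Squarefree d := (squarefree_units_mul hd s β).1 hDs
    have hdvd : ∀ p : Nat.Primes, (p : ℕ) ∣ T →
        ((p : ℕ) ∣ d ↔ ((p : ℕ) : ℤ) ∣ a (.finite p)) := by
      intro p hp
      have hp2 : (p : ℕ) ≠ 2 := by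
        intro h
        rw [h] at hp
        exact (Nat.not_even_iff_odd.2 hT) (even_iff_two_dvd.2 hp)
      have hpD : ((p : ℕ) : ℤ) ∣ s * 2 ^ (β : ℕ) * d ↔ (p : ℕ) ∣ d := by
        rw [Int.natCast_dvd, natAbs_units_mul]
        exact Nat.Coprime.dvd_mul_left
          (((Nat.coprime_primes p.2 Nat.prime_two).2 hp2).pow_right _)
      rw [← hpD]
      refine (hDa p hp).dvd_iff (ha p hp) fun h => ?_
      rw [sq] at h
      have := Int.isUnit_iff.1 (hDs _ h)
      have := p.2.two_le
      omega
    obtain ⟨n, rfl⟩ : R ∣ d := ramifiedPart_dvd_of_forall a fun p hp hpa => (hdvd p hp).2 hpa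
    have hn0 : n ≠ 0 := by rintro rfl; exact hds.ne_zero rfl
    have hnT : ∀ p : Nat.Primes, (p : ℕ) ∣ T → ¬ (p : ℕ) ∣ n := by
      intro p hp hpn
      have h1 := (prime_dvd_ramifiedPart_iff a hTs.ne_zero p hp).2
        ((hdvd p hp).1 (hpn.mul_left R))
      exact p.2.one_lt.ne' (Nat.isUnit_iff.1 (hds _ (mul_dvd_mul h1 hpn)))
    obtain ⟨e, he⟩ := isUnit_intCast_zmod_eight (odd_units_mul hd s)
    refine ⟨⟨⟨s, β, e⟩, n⟩, Finset.mem_sigma.2 ⟨?_, Finset.mem_filter.2 ⟨?_, ?_, he.symm, ?_⟩⟩, rfl⟩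
    · exact Finset.mem_filter.2 ⟨Finset.mem_univ _, (hL s β _ e hd he.symm).1 hDL⟩
    · exact Finset.mem_Icc.2 ⟨Nat.one_le_iff_ne_zero.2 hn0, (hsize s β e n hd he.symm).1 hDY⟩
    · exact hds.squarefree_of_dvd (Dvd.intro_left R rfl)
    · intro p hp
      obtain ⟨hpp, hpT, -⟩ := Nat.mem_primeFactors.1 hp
      exact (hmatch s β n ⟨p, hpp⟩ hpT (hnT ⟨p, hpp⟩ hpT)).1 (hDa ⟨p, hpp⟩ hpT)
  · intro x _; rfl


/-! ### The contribution of a residue class -/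

theorem twoPart_eq_two_pow (β : Fin 2) (e : ZMod 8) : ∃ k : ℕ, twoPart β e = 2 ^ k := by
  rw [twoPart]
  split_ifs
  · exact ⟨3, by norm_num⟩
  · exact ⟨0, by norm_num⟩
  · exact ⟨2, by norm_num⟩

theorem chi₈_twoPart_mul (β : Fin 2) (e : ZMod 8) :
    ZMod.χ₈ ((twoPart β e : ZMod 8) * e) = if twoPart β e = 1 then ZMod.χ₈ e else 0 := by
  revert β e
  decide

/-- The constant factor of `χ_Δ(m) g(Δ)` as `Δ` runs over the discriminants with given sign,
`2`-part and ramified part `R`. -/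
def twistCoeff (g : ArithmeticFunction ℂ) (m R : ℕ) (s : ℤˣ) (β : Fin 2) (e : ZMod 8) : ℂ :=
  (((if twoPart β e = 1 then ZMod.χ₈ e else 0) ^ m.factorization 2 *
    jacobiSym (twoPart β e * (s * R)) (m / 2 ^ m.factorization 2) : ℤ) : ℂ) * g (twoPart β e)

/-- The term at `D = s 2^β R n`, as a function of `n`: a constant times `g(n)` times a Jacobi
symbol. -/
theorem kroneckerSymbol_mul_eq {g : ArithmeticFunction ℂ} (hg : g.IsMultiplicative) {R n : ℕ}
    (hgR : g R = 1) (hRn : R.Coprime n) (ho : Odd (R * n)) (m : ℕ) (s : ℤˣ) (β : Fin 2)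
    {e : ZMod 8} (he : (((s : ℤ) * (R * n : ℕ) : ℤ) : ZMod 8) = e) :
    (kroneckerSymbol (fundDisc (s * 2 ^ (β : ℕ) * (R * n : ℕ))) m : ℂ) *
      g (fundDisc (s * 2 ^ (β : ℕ) * (R * n : ℕ))).natAbs =
    twistCoeff g m R s β e * (g n * (jacobiSym n (m / 2 ^ m.factorization 2) : ℂ)) := by
  rw [natAbs_fundDisc_units_mul ho s β he, fundDisc_units_mul ho s β he, kroneckerSymbol]
  obtain ⟨k, hk⟩ := twoPart_eq_two_pow β e
  have h1 : (twoPart β e).Coprime (R * n) := by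
    rw [hk]; exact (Nat.coprime_two_left.2 ho).pow_left _
  rw [hg.map_mul_of_coprime h1, hg.map_mul_of_coprime hRn, hgR, twistCoeff]
  have h2 : (((twoPart β e : ℤ) * (s * (R * n : ℕ)) : ℤ) : ZMod 8) = twoPart β e * e := by
    rw [Int.cast_mul, he]; push_cast; rfl
  have h3 : ((twoPart β e : ℤ) * (s * (R * n : ℕ)) : ℤ) = (twoPart β e * (s * R)) * n := by
    push_cast; ring
  rw [h2, chi₈_twoPart_mul, h3, jacobiSym.mul_left]
  push_cast
  ring

theorem norm_twistCoeff_le {g : ArithmeticFunction ℂ} (hg : g.IsMultiplicative) {A : ℝ}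
    (hA : 0 ≤ A) (hgA : ∀ p : ℕ, p.Prime → ‖g p - 1‖ ≤ A / p) (h4 : g 4 = g 2) (h8 : g 8 = g 2)
    (m R : ℕ) (s : ℤˣ) (β : Fin 2) (e : ZMod 8) : ‖twistCoeff g m R s β e‖ ≤ 1 + A := by
  have h2 : ‖g 2‖ ≤ 1 + A := by
    have h := hgA 2 Nat.prime_two
    have h3 : ‖g 2‖ ≤ ‖g 2 - 1‖ + ‖(1 : ℂ)‖ := by
      simpa using norm_add_le (g 2 - 1) 1
    rw [norm_one] at h3
    push_cast at h
    linarith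
  have hg2 : ‖g (twoPart β e)‖ ≤ 1 + A := by
    rw [twoPart]
    split_ifs
    · rw [h8]; exact h2
    · rw [hg.map_one]; simpa using hA
    · rw [h4]; exact h2
  have h5 : ‖(((if twoPart β e = 1 then ZMod.χ₈ e else 0) ^ m.factorization 2 : ℤ) : ℂ)‖ ≤ 1 := by
    rw [Int.cast_pow, norm_pow]
    refine pow_le_one₀ (norm_nonneg _) ?_
    have h6 : ∀ x : ZMod 8, ZMod.χ₈ x = 0 ∨ ZMod.χ₈ x = 1 ∨ ZMod.χ₈ x = -1 := by decide
    split_ifs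
    · rcases h6 e with h | h | h <;> rw [h] <;> simp
    · simp
  rw [twistCoeff, norm_mul, Int.cast_mul, norm_mul]
  calc _ ≤ 1 * 1 * (1 + A) := by
        gcongr
        exact norm_jacobiSym_le _ _
    _ = 1 + A := by ring

theorem sum_units_zmod_eight {M : Type*} [AddCommMonoid M] (G : ZMod 8 → M) :
    ∑ e : (ZMod 8)ˣ, G e = G 1 + (G 3 + (G 5 + G 7)) := by
  have h : (Finset.univ : Finset (ZMod 8)ˣ).map ⟨Units.val, Units.val_injective⟩ =
      ({1, 3, 5, 7} : Finset (ZMod 8)) := by decide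
  calc ∑ e : (ZMod 8)ˣ, G e
      = ∑ x ∈ (Finset.univ : Finset (ZMod 8)ˣ).map ⟨Units.val, Units.val_injective⟩, G x := by
        rw [Finset.sum_map]; rfl
    _ = _ := by
        rw [h, Finset.sum_insert (by decide), Finset.sum_insert (by decide),
          Finset.sum_insert (by decide), Finset.sum_singleton]

/-- The sum of the main terms over the classes `(β, e)`, with `v` the exponent of `2` in `m`.
For odd `v` the classes `e = 1` and `e = 5` cancel. -/
theorem sum_twoPart_eq {g : ArithmeticFunction ℂ} (h1 : g 1 = 1) (h4 : g 4 = g 2) (h8 : g 8 = g 2)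
    (v : ℕ) :
    ∑ β : Fin 2, ∑ e : (ZMod 8)ˣ,
      (((if twoPart β e = 1 then ZMod.χ₈ e else 0) ^ v : ℤ) : ℂ) * g (twoPart β e) /
        (twoPart β e) =
      2 * (if v = 0 then 1 + g 2 / 2 else if Even v then 1 else 0) := by
  have hG := fun β : Fin 2 => sum_units_zmod_eight (fun e : ZMod 8 =>
    (((if twoPart β e = 1 then ZMod.χ₈ e else 0) ^ v : ℤ) : ℂ) * g (twoPart β e) / (twoPart β e))
  simp only [hG, Fin.sum_univ_two]
  have e1 : twoPart 0 1 = 1 := by decide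
  have e3 : twoPart 0 3 = 4 := by decide
  have e5 : twoPart 0 5 = 1 := by decide
  have e7 : twoPart 0 7 = 4 := by decide
  have f1 : twoPart 1 1 = 8 := by decide
  have f3 : twoPart 1 3 = 8 := by decide
  have f5 : twoPart 1 5 = 8 := by decide
  have f7 : twoPart 1 7 = 8 := by decide
  have c1 : ZMod.χ₈ 1 = 1 := by decide
  have c5 : ZMod.χ₈ 5 = -1 := by decide
  rw [e1, e3, e5, e7, f1, f3, f5, f7, c1, c5, h1, h4, h8]
  rcases Nat.eq_zero_or_pos v with rfl | hv
  · norm_num; ring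
  · rcases Nat.even_or_odd v with h | h
    · simp [hv.ne', h, h.neg_one_pow]; norm_num
    · simp [hv.ne', h.neg_one_pow, Nat.not_even_iff_odd.2 h]


/-! ### The weights -/

theorem finite_mem_iff_dvd_primeProduct {𝕊 : Finset RatPlace} (p : Nat.Primes) :
    RatPlace.finite p ∈ 𝕊 ↔ (p : ℕ) ∣ primeProduct 𝕊 := by
  rw [primeProduct, p.2.prime.dvd_finsetProd_iff]
  refine ⟨fun h => ⟨_, h, dvd_rfl⟩, ?_⟩
  rintro ⟨v, hv, h⟩
  cases v with
  | infinite => exact absurd (Nat.dvd_one.1 h) p.2.ne_one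
  | finite q =>
    have : p = q := Subtype.ext ((Nat.prime_dvd_prime_iff_eq p.2 q.2).1 h)
    rwa [this]

theorem primeProduct_ne_zero (𝕊 : Finset RatPlace) : primeProduct 𝕊 ≠ 0 := by
  rw [primeProduct, Finset.prod_ne_zero_iff]
  rintro (_ | p) -
  · exact one_ne_zero
  · exact p.2.ne_zero

/-- The product of the odd primes in `𝕊`. -/
def oddPrimeProduct (𝕊 : Finset RatPlace) : ℕ := ∏ p ∈ (primeProduct 𝕊).primeFactors.erase 2, p

theorem primeFactors_oddPrimeProduct (𝕊 : Finset RatPlace) :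
    (oddPrimeProduct 𝕊).primeFactors = (primeProduct 𝕊).primeFactors.erase 2 :=
  Nat.primeFactors_prod fun _ hp => Nat.prime_of_mem_primeFactors (Finset.mem_of_mem_erase hp)

theorem oddPrimeProduct_dvd (𝕊 : Finset RatPlace) : oddPrimeProduct 𝕊 ∣ primeProduct 𝕊 :=
  (Finset.prod_dvd_prod_of_subset _ _ _ (Finset.erase_subset _ _)).trans
    (Nat.prod_primeFactors_dvd _)

theorem oddPrimeProduct_ne_zero (𝕊 : Finset RatPlace) : oddPrimeProduct 𝕊 ≠ 0 :=
  ne_zero_of_dvd_ne_zero (primeProduct_ne_zero 𝕊) (oddPrimeProduct_dvd 𝕊)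

theorem prime_dvd_oddPrimeProduct_iff {𝕊 : Finset RatPlace} (p : Nat.Primes) :
    (p : ℕ) ∣ oddPrimeProduct 𝕊 ↔ (p : ℕ) ≠ 2 ∧ RatPlace.finite p ∈ 𝕊 := by
  have h : (p : ℕ) ∈ (oddPrimeProduct 𝕊).primeFactors ↔ (p : ℕ) ∣ oddPrimeProduct 𝕊 := by
    rw [Nat.mem_primeFactors]
    exact ⟨fun h => h.2.1, fun h => ⟨p.2, h, oddPrimeProduct_ne_zero 𝕊⟩⟩
  rw [← h, primeFactors_oddPrimeProduct, Finset.mem_erase, Nat.mem_primeFactors,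
    finite_mem_iff_dvd_primeProduct]
  exact ⟨fun h => ⟨h.1, h.2.2.1⟩, fun h => ⟨h.1, p.2, h.2, primeProduct_ne_zero 𝕊⟩⟩

theorem odd_oddPrimeProduct (𝕊 : Finset RatPlace) : Odd (oddPrimeProduct 𝕊) := by
  rw [← Nat.not_even_iff_odd, even_iff_two_dvd]
  intro h
  exact ((prime_dvd_oddPrimeProduct_iff ⟨2, Nat.prime_two⟩).1 h).1 rfl

theorem squarefree_oddPrimeProduct (𝕊 : Finset RatPlace) : Squarefree (oddPrimeProduct 𝕊) := by
  rw [oddPrimeProduct]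
  refine Finset.squarefree_prod_of_pairwise_isCoprime (fun p hp q hq hpq => ?_) fun p hp => ?_
  · rw [Function.onFun, ← Nat.coprime_iff_isRelPrime]
    exact (Nat.coprime_primes (Nat.prime_of_mem_primeFactors (Finset.mem_of_mem_erase hp))
      (Nat.prime_of_mem_primeFactors (Finset.mem_of_mem_erase hq))).2 hpq
  · exact (Nat.prime_of_mem_primeFactors (Finset.mem_of_mem_erase hp)).prime.squarefree

/-- The product over `𝕊`, split into the contributions of `∞`, of `2`, and of the odd primes. -/
theorem prod_places_eq (𝕊 : Finset RatPlace) (h : RatPlace → ℝ) :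
    open Classical in
    ∏ v ∈ 𝕊, h v = (if .infinite ∈ 𝕊 then h .infinite else 1) *
      (if .finite ⟨2, Nat.prime_two⟩ ∈ 𝕊 then h (.finite ⟨2, Nat.prime_two⟩) else 1) *
      ∏ p ∈ (oddPrimeProduct 𝕊).primeFactors,
        if hp : p.Prime then h (.finite ⟨p, hp⟩) else 1 := by
  classical
  set two : RatPlace := .finite ⟨2, Nat.prime_two⟩ with htwo
  have h1 : ∏ v ∈ (𝕊.erase .infinite).erase two, h v =
      ∏ p ∈ (oddPrimeProduct 𝕊).primeFactors,
        if hp : p.Prime then h (.finite ⟨p, hp⟩) else 1 := by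
    refine Finset.prod_bij (fun v _ => v.residueChar) ?_ ?_ ?_ ?_
    · rintro (_ | p) hv
      · simp at hv
      · rw [Finset.mem_erase, Finset.mem_erase] at hv
        refine Nat.mem_primeFactors.2 ⟨p.2, ?_, oddPrimeProduct_ne_zero 𝕊⟩
        refine (prime_dvd_oddPrimeProduct_iff p).2 ⟨fun h => hv.1 ?_, hv.2.2⟩
        rw [htwo]; congr 1; exact Subtype.ext h
    · rintro (_ | p) hv (_ | q) hw hvw
      · rfl
      · simp at hv
      · simp at hw
      · congr 1; exact Subtype.ext hvw
    · intro p hp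
      obtain ⟨hp, hpT, -⟩ := Nat.mem_primeFactors.1 hp
      obtain ⟨h2, hS⟩ := (prime_dvd_oddPrimeProduct_iff ⟨p, hp⟩).1 hpT
      refine ⟨.finite ⟨p, hp⟩, ?_, rfl⟩
      rw [Finset.mem_erase, Finset.mem_erase]
      refine ⟨fun h => h2 ?_, by simp, hS⟩
      rw [htwo] at h
      exact congrArg RatPlace.residueChar h
    · rintro (_ | p) hv
      · simp at hv
      · have : (RatPlace.finite p).residueChar.Prime := p.2
        rw [dif_pos this]; rfl
  rw [← h1]
  have h2 : ∀ (s : Finset RatPlace) (v : RatPlace),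
      ∏ w ∈ s, h w = (if v ∈ s then h v else 1) * ∏ w ∈ s.erase v, h w := by
    intro s v
    split_ifs with hv
    · rw [Finset.mul_prod_erase s h hv]
    · rw [one_mul, Finset.erase_eq_of_notMem hv]
  rw [h2 𝕊 .infinite, h2 (𝕊.erase .infinite) two, mul_assoc]
  have h3 : two ∈ 𝕊.erase .infinite ↔ two ∈ 𝕊 := by simp [htwo]
  simp only [h3]

theorem weight_finite_of_ne_two {p : Nat.Primes} (hp2 : (p : ℕ) ≠ 2) {a : ℤ}
    (ha : ¬ ((p : ℕ) : ℤ) ^ 2 ∣ a) :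
    weight (.finite p) a = 1 / 2 * (if ((p : ℕ) : ℤ) ∣ a then ((p : ℕ) : ℝ)⁻¹ else 1) := by
  have h4 : ‖(4 : ℚ_[(p : ℕ)])‖ = 1 := by
    have h2 : ¬ (p : ℕ) ∣ 4 := fun h => hp2 ((Nat.prime_dvd_prime_iff_eq p.2 Nat.prime_two).1
      (p.2.dvd_of_dvd_pow (show (p : ℕ) ∣ 2 ^ 2 by simpa using h)))
    have := (Padic.norm_natCast_eq_one_iff (p := (p : ℕ)) (n := 4)).2
      ((Nat.Prime.coprime_iff_not_dvd p.2).2 h2)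
    exact_mod_cast this
  have hfund : ‖((fundDisc a : ℤ) : ℚ_[(p : ℕ)])‖ = ‖(a : ℚ_[(p : ℕ)])‖ := by
    rw [fundDisc]
    split_ifs
    · rfl
    · push_cast; rw [norm_mul, h4, one_mul]
  rw [weight, hfund, Padic.norm_eq_zpow_neg_valuation (Padic.intCast_ne_zero_of_not_dvd ha),
    Padic.valuation_intCast_le_one ha]
  split_ifs <;> simp

theorem weight_two {d : ℤ} (hd : Odd d) (β : Fin 2) :
    weight (.finite ⟨2, Nat.prime_two⟩) (2 ^ (β : ℕ) * d) = 1 / 2 * (twoPart β d : ℝ)⁻¹ := by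
  have h2 : ∀ k : ℕ, ‖((2 ^ k : ℕ) : ℚ_[2])‖ = ((2 ^ k : ℕ) : ℝ)⁻¹ := by
    intro k
    rw [Nat.cast_pow, norm_pow, Padic.norm_p]; push_cast; rw [inv_pow]
  have h3 : ‖(d : ℚ_[2])‖ = 1 := le_antisymm (Padic.norm_int_le_one _) (not_lt.1 fun h => by
    rw [Padic.norm_intCast_lt_one_iff] at h
    exact (Int.not_even_iff_odd.2 hd) (even_iff_two_dvd.2 (by exact_mod_cast h)))
  obtain ⟨k, hk⟩ := twoPart_eq_two_pow β d
  have h4 : (((((2 ^ k : ℕ) : ℤ) * d : ℤ)) : ℚ_[2]) = ((2 ^ k : ℕ) : ℚ_[2]) * (d : ℚ_[2]) := by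
    push_cast; rfl
  change 1 / 2 * ‖((fundDisc (2 ^ (β : ℕ) * d) : ℤ) : ℚ_[2])‖ = _
  rw [fundDisc_two_pow_mul hd, hk, ← h2 k, h4, norm_mul, h3, mul_one]

theorem prod_weight_odd (𝕊 : Finset RatPlace) (a : RatPlace → ℤ)
    (ha : ∀ v ∈ 𝕊, v.IsNormalized (a v)) :
    (∏ p ∈ (oddPrimeProduct 𝕊).primeFactors,
      if hp : p.Prime then weight (.finite ⟨p, hp⟩) (a (.finite ⟨p, hp⟩)) else 1) =
    1 / 2 ^ (oddPrimeProduct 𝕊).primeFactors.card *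
      ((ramifiedPart a (oddPrimeProduct 𝕊) : ℕ) : ℝ)⁻¹ := by
  classical
  rw [ramifiedPart, Nat.cast_prod, ← Finset.prod_inv_distrib, Finset.prod_filter, one_div,
    ← inv_pow, ← Finset.prod_const, ← Finset.prod_mul_distrib]
  refine Finset.prod_congr rfl fun p hp => ?_
  obtain ⟨hpp, hpT, -⟩ := Nat.mem_primeFactors.1 hp
  obtain ⟨h2, hS⟩ := (prime_dvd_oddPrimeProduct_iff ⟨p, hpp⟩).1 hpT
  have h1 : (∃ hp : p.Prime, (p : ℤ) ∣ a (.finite ⟨p, hp⟩)) ↔ (p : ℤ) ∣ a (.finite ⟨p, hpp⟩) :=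
    ⟨fun ⟨_, h⟩ => h, fun h => ⟨hpp, h⟩⟩
  rw [dif_pos hpp, weight_finite_of_ne_two h2 (ha _ hS), one_div]
  simp only [h1]


/-! ### The sum over quadratic fields -/

/-- The place `2`. -/
abbrev RatPlace.two : RatPlace := .finite ⟨2, Nat.prime_two⟩

/-- The contribution of the prime `2` to the main term, relative to `δ_Ξ`: outside `𝕊` it is the
sum of `g(c) / c` over the possible `2`-parts `c` of a discriminant, twisted by `χ_Δ(2) ^ v₂(m)`. -/
def twoFactor (𝕊 : Finset RatPlace) (g : ArithmeticFunction ℂ) (m : ℕ) : ℂ :=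
  open Classical in
  if RatPlace.two ∈ 𝕊 then 1 else
    if m.factorization 2 = 0 then 1 + g 2 / 2 else if Even (m.factorization 2) then 1 else 0

theorem jacobiSym_isSquare_right_of_gcd {b : ℕ} (hb : IsSquare b) {n : ℤ} (hn : n.gcd b = 1) :
    jacobiSym n b = 1 := by
  obtain ⟨c, rfl⟩ := hb
  rw [← sq, jacobiSym.pow_right]
  refine jacobiSym.sq_one ?_
  rw [← Int.isCoprime_iff_gcd_eq_one] at hn ⊢
  push_cast at hn
  exact (IsCoprime.mul_right_iff.1 hn).1

/-- The condition at the place `2` is a condition `Q` on the class `(β, e)`. If `2 ∈ 𝕊`, it selects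
a single class, whose main term is the weight at `2`; otherwise all classes contribute. -/
theorem exists_two_condition {𝕊 : Finset RatPlace} {A : ℝ} {g : ArithmeticFunction ℂ}
    (hg : IsAdmissible 𝕊 A g) {a : ℤ} (ha : RatPlace.two ∈ 𝕊 → ¬ (4 : ℤ) ∣ a) {m : ℕ}
    (hm : m.Coprime (primeProduct 𝕊)) :
    open Classical in
    ∃ Q : Fin 2 → (ZMod 8)ˣ → Prop,
      (∀ (s : ℤˣ) (β : Fin 2) (d : ℕ) (e : (ZMod 8)ˣ), Odd d →
        (((s : ℤ) * d : ℤ) : ZMod 8) = e →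
        ((RatPlace.two ∈ 𝕊 → RatPlace.two.Matches a (s * 2 ^ (β : ℕ) * d)) ↔ Q β e)) ∧
      ∑ β : Fin 2, ∑ e : (ZMod 8)ˣ, (if Q β e then
        (((if twoPart β e = 1 then ZMod.χ₈ e else 0) ^ m.factorization 2 : ℤ) : ℂ) *
          g (twoPart β e) / (twoPart β e) else 0) =
        2 * (if RatPlace.two ∈ 𝕊 then (RatPlace.two.weight a : ℂ) else 1) * twoFactor 𝕊 g m := by
  classical
  have h1 : g 1 = 1 := hg.multiplicative.map_one
  by_cases h : RatPlace.two ∈ 𝕊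
  · obtain ⟨β₀, d₀, hd₀, rfl⟩ := Padic.exists_eq_two_pow_mul_odd (ha h)
    obtain ⟨e₀, he₀⟩ := isUnit_intCast_zmod_eight hd₀
    refine ⟨fun β e => β = β₀ ∧ e = e₀, fun s β d e hd he => ?_, ?_⟩
    · have h2 := Padic.exists_eq_two_pow_mul_sq_iff (odd_units_mul hd s) hd₀ β β₀
      rw [he, ← he₀, Units.val_inj] at h2
      refine Iff.trans ?_ h2
      rw [show (s : ℤ) * 2 ^ (β : ℕ) * d = 2 ^ (β : ℕ) * (s * d) by ring]
      exact ⟨fun h' => h' h, fun h' _ => h'⟩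
    · have hv : m.factorization 2 = 0 := by
        refine Nat.factorization_eq_zero_of_not_dvd fun h2 => ?_
        have h3 := Nat.dvd_gcd h2 ((finite_mem_iff_dvd_primeProduct ⟨2, Nat.prime_two⟩).1 h)
        rw [hm] at h3
        exact absurd (Nat.dvd_one.1 h3) (by norm_num)
      have hg2 : g 2 = 1 := hg.eq_one ⟨2, Nat.prime_two⟩ h
      have hgc : g (twoPart β₀ e₀) = 1 := by
        rw [twoPart]
        split_ifs
        · rw [hg.eight, hg2]
        · exact h1
        · rw [hg.four, hg2]
      rw [Finset.sum_eq_single_of_mem β₀ (Finset.mem_univ _) (fun β _ hβ => by simp [hβ]),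
        Finset.sum_eq_single_of_mem e₀ (Finset.mem_univ _) (fun e _ he => by simp [he]),
        if_pos ⟨rfl, rfl⟩, if_pos h, hv, hgc, weight_two hd₀, twoFactor, if_pos h, ← he₀]
      push_cast
      ring
  · refine ⟨fun _ _ => True, fun s β d e _ _ => by simp [h], ?_⟩
    simp only [if_true, if_neg h]
    rw [sum_twoPart_eq h1 hg.four hg.eight, twoFactor, if_neg h]
    ring

theorem sum_sign_condition {𝕊 : Finset RatPlace} {a : ℤ}
    (ha : RatPlace.infinite ∈ 𝕊 → a = 1 ∨ a = -1) :
    open Classical in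
    ∑ s : ℤˣ, (if RatPlace.infinite ∈ 𝕊 → 0 < (s : ℤ) * a then (1 : ℂ) else 0) =
      2 * (if RatPlace.infinite ∈ 𝕊 then (RatPlace.infinite.weight a : ℂ) else 1) := by
  classical
  have huniv : (Finset.univ : Finset ℤˣ) = {1, -1} := rfl
  rw [huniv, Finset.sum_pair (by decide)]
  by_cases h : RatPlace.infinite ∈ 𝕊
  · rcases ha h with rfl | rfl <;> simp [h, weight]
  · simp [h]; norm_num

theorem map_ramifiedPart_eq_one {𝕊 : Finset RatPlace} {A : ℝ} {g : ArithmeticFunction ℂ}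
    (hg : IsAdmissible 𝕊 A g) (a : RatPlace → ℤ) :
    g (ramifiedPart a (oddPrimeProduct 𝕊)) = 1 := by
  classical
  rw [ramifiedPart, hg.multiplicative.map_prod_of_subset_primeFactors (oddPrimeProduct 𝕊) _
    (Finset.filter_subset _ _)]
  refine Finset.prod_eq_one fun p hp => ?_
  obtain ⟨hpp, hpT, -⟩ := Nat.mem_primeFactors.1 (Finset.mem_filter.1 hp).1
  exact hg.eq_one ⟨p, hpp⟩ ((prime_dvd_oddPrimeProduct_iff ⟨p, hpp⟩).1 hpT).2

theorem forall_matches_iff {𝕊 : Finset RatPlace} (a : RatPlace → ℤ) (D : ℤ) :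
    (∀ v ∈ 𝕊, v.Matches (a v) D) ↔
      ((RatPlace.infinite ∈ 𝕊 → 0 < D * a .infinite) ∧
        (RatPlace.two ∈ 𝕊 → RatPlace.two.Matches (a .two) D)) ∧
      ∀ p : Nat.Primes, (p : ℕ) ∣ oddPrimeProduct 𝕊 →
        Matches (.finite p) (a (.finite p)) D := by
  constructor
  · intro h
    exact ⟨⟨fun hv => h _ hv, fun hv => h _ hv⟩, fun p hp =>
      h _ ((prime_dvd_oddPrimeProduct_iff p).1 hp).2⟩
  · rintro ⟨⟨h1, h2⟩, h3⟩ (_ | p) hv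
    · exact h1 hv
    · by_cases hp : (p : ℕ) = 2
      · obtain rfl : p = ⟨2, Nat.prime_two⟩ := Subtype.ext hp
        exact h2 hv
      · exact h3 p ((prime_dvd_oddPrimeProduct_iff p).2 ⟨hp, hv⟩)

theorem sign_condition_iff (s : ℤˣ) (β : Fin 2) {d : ℕ} (hd : 0 < d) (a : ℤ) :
    0 < (s : ℤ) * 2 ^ (β : ℕ) * d * a ↔ 0 < (s : ℤ) * a := by
  rw [show (s : ℤ) * 2 ^ (β : ℕ) * d * a = (2 ^ (β : ℕ) * d) * (s * a) by ring]
  exact mul_pos_iff_of_pos_left (by positivity)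

/-- For fixed sign `s` and ramified part `R`, the class of `s R n` modulo `8` determines that of
`n`. -/
theorem residueSum_congr_class {g : ArithmeticFunction ℂ} {T b R : ℕ} {ε : ℕ → ℤ} (hR : Odd R)
    (s : ℤˣ) (e : (ZMod 8)ˣ) (X : ℝ) : ∃ r : ZMod 8, IsUnit r ∧
      open Classical in
      ∑ n ∈ (Finset.Icc 1 ⌊X⌋₊).filter (fun n : ℕ => Squarefree n ∧
          (((s : ℤ) * (R * n : ℕ) : ℤ) : ZMod 8) = e ∧ ∀ p ∈ T.primeFactors, jacobiSym n p = ε p),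
        g n * (jacobiSym n b : ℂ) = residueSum g T b ε r X := by
  classical
  obtain ⟨u, hu⟩ := isUnit_intCast_zmod_eight (odd_units_mul hR s)
  refine ⟨(e * u⁻¹ : (ZMod 8)ˣ), Units.isUnit _, ?_⟩
  rw [residueSum]
  refine Finset.sum_congr (Finset.filter_congr fun n _ => ?_) fun _ _ => rfl
  rw [Units.val_mul, Units.eq_mul_inv_iff_mul_eq, hu]
  push_cast
  rw [mul_comm (n : ZMod 8), mul_assoc]


theorem kroneckerSymbol_one (m : ℕ) : kroneckerSymbol 1 m = 1 := by
  rw [kroneckerSymbol, jacobiSym.one_left]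
  simp

theorem twistCoeff_of_isSquare {g : ArithmeticFunction ℂ} {m R : ℕ}
    (hm : IsSquare (m / 2 ^ m.factorization 2)) (ho : Odd (m / 2 ^ m.factorization 2))
    (hR : R.Coprime (m / 2 ^ m.factorization 2)) (s : ℤˣ) (β : Fin 2) (e : ZMod 8) :
    twistCoeff g m R s β e =
      (((if twoPart β e = 1 then ZMod.χ₈ e else 0) ^ m.factorization 2 : ℤ) : ℂ) *
        g (twoPart β e) := by
  rw [twistCoeff, jacobiSym_isSquare_right_of_gcd hm, mul_one]
  obtain ⟨k, hk⟩ := twoPart_eq_two_pow β e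
  rw [Int.gcd_eq_natAbs, Int.natAbs_natCast, Int.natAbs_mul, Int.natAbs_mul, Int.units_natAbs,
    one_mul, Int.natAbs_natCast, Int.natAbs_natCast, hk]
  exact Nat.Coprime.mul_left ((Nat.coprime_two_left.2 ho).pow_left _) hR

/-- The sum over quadratic fields, given a bound `M` for the character sums: the main term occurs
only if the odd part of `m` is a square. -/
theorem exists_discriminantSum_sub_le (A : ℝ) (hA : 0 ≤ A) : ∃ C : ℝ, 0 < C ∧
    ∀ (𝕊 : Finset RatPlace) (Ξ : LocalType 𝕊) (g : ArithmeticFunction ℂ), IsAdmissible 𝕊 A g →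
    ∀ m : ℕ, 1 ≤ m → m.Coprime (primeProduct 𝕊) →
    ∀ (T b : ℕ), T = oddPrimeProduct 𝕊 → b = m / 2 ^ m.factorization 2 →
    ∀ M : ℝ, (∀ (ψ : DirichletCharacter ℂ 8) (s : Finset ℕ), s ⊆ T.primeFactors →
        (ψ ≠ 1 ∨ ¬ IsSquare ((∏ p ∈ s, p) * b)) →
        HasMeanValue (coprimePart T (jacobiTwist ψ ((∏ p ∈ s, p) * b))) 0 M) →
      ((2 * T * b).divisors.card : ℝ) ≤ M →
    ∀ Y : ℝ, 1 ≤ Y →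
      ‖discriminantSum Ξ g m Y - (if IsSquare b then deltaConst Ξ * twoFactor 𝕊 g m *
        (Y * coprimeDensity (2 * T * b) * cofactorSeries g (2 * T * b)) else 0)‖ ≤
        C * Real.sqrt (Y * M) := by
  classical
  obtain ⟨C₀, hC₀, hmain⟩ := exists_residueSum_le A hA
  refine ⟨16 * ((1 + A) * C₀) + 1, by positivity, ?_⟩
  rintro 𝕊 Ξ g hg m hm1 hmS T b rfl hb M hM1 hM2 Y hY
  have hY0 : 0 ≤ Y := by linarith
  set T := oddPrimeProduct 𝕊 with hTdef
  have hT : Odd T := odd_oddPrimeProduct 𝕊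
  have hTs : Squarefree T := squarefree_oddPrimeProduct 𝕊
  have hbo : Odd b := by
    rw [hb, ← Nat.not_even_iff_odd, even_iff_two_dvd]
    exact Nat.not_dvd_ordCompl Nat.prime_two (by omega)
  have hbm : b ∣ m := by rw [hb]; exact Nat.ordCompl_dvd m 2
  have hTb : T.Coprime b :=
    (Nat.Coprime.coprime_dvd_left hbm (hmS.coprime_dvd_right (oddPrimeProduct_dvd 𝕊))).symm
  have hM : 1 ≤ M := by
    refine le_trans ?_ hM2
    have : (2 * T * b).divisors.Nonempty :=
      Nat.nonempty_divisors.2 (by have := hT.pos; have := hbo.pos; positivity)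
    exact_mod_cast this.card_pos
  obtain ⟨a, han, hδ, hsum⟩ := exists_discriminantSum_eq Ξ
  have haT : ∀ p : Nat.Primes, (p : ℕ) ∣ T → ¬ ((p : ℕ) : ℤ) ^ 2 ∣ a (.finite p) := fun p hp =>
    han _ ((prime_dvd_oddPrimeProduct_iff p).1 hp).2
  set R := ramifiedPart a T with hR
  have hRT : R ∣ T := ramifiedPart_dvd a
  have hRo : Odd R := Odd.of_dvd_nat hT hRT
  have hRb : R.Coprime b := hTb.coprime_dvd_left hRT
  have hgR : g R = 1 := map_ramifiedPart_eq_one hg a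
  obtain ⟨ε, hε, hεa⟩ := exists_matches_iff_jacobiSym a hT hTs haT
  obtain ⟨Q, hQ, hQsum⟩ := exists_two_condition hg (a := a .two)
    (fun h => by have := han _ h; exact_mod_cast this) hmS
  set P : ℤˣ → Prop := fun s => RatPlace.infinite ∈ 𝕊 → 0 < (s : ℤ) * a .infinite with hP
  have hPsum := sum_sign_condition (𝕊 := 𝕊) (a := a .infinite) fun h => han _ h
  -- the sum over all `D`, including `D = 1`, whose single term is absorbed by the error
  set f : ℤ → ℂ := fun D => (kroneckerSymbol (fundDisc D) m : ℂ) * g (fundDisc D).natAbs with hf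
  set L : ℤ → Prop := fun D => (RatPlace.infinite ∈ 𝕊 → 0 < D * a .infinite) ∧
    (RatPlace.two ∈ 𝕊 → RatPlace.two.Matches (a .two) D) with hL
  have hall := sum_squarefree_matches_eq a hT hTs haT hε hεa L (fun s β e => P s ∧ Q β e)
    (fun s β d e hd he => by
      refine and_congr ?_ (hQ s β d e hd he)
      rw [sign_condition_iff s β hd.pos]) f hY0
  set F₁ := (Finset.Icc (-⌊Y⌋) ⌊Y⌋).filter (fun D : ℤ => Squarefree D ∧
    (|fundDisc D| : ℝ) ≤ Y ∧ L D ∧ ∀ p : Nat.Primes, (p : ℕ) ∣ T →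
      Matches (.finite p) (a (.finite p)) D) with hF₁
  have hdS : discriminantSum Ξ g m Y = ∑ D ∈ F₁.erase 1, f D := by
    rw [hsum]
    refine Finset.sum_congr ?_ fun _ _ => rfl
    ext D
    rw [hF₁, Finset.mem_erase, Finset.mem_filter, Finset.mem_filter, forall_matches_iff]
    tauto
  have hone : ‖discriminantSum Ξ g m Y - ∑ D ∈ F₁, f D‖ ≤ 1 := by
    rw [hdS]
    by_cases h1 : (1 : ℤ) ∈ F₁
    · rw [Finset.sum_erase_eq_sub h1]
      have hf1 : f 1 = 1 := by
        have h2 : fundDisc 1 = 1 := by decide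
        rw [hf]
        simp [h2, kroneckerSymbol_one, hg.multiplicative.map_one]
      rw [hf1]; simp
    · rw [Finset.erase_eq_of_notMem h1]; simp
  -- the contribution of one class `(s, β, e)`
  set Ω := (Finset.univ : Finset (ℤˣ × Fin 2 × (ZMod 8)ˣ)).filter
    (fun τ => P τ.1 ∧ Q τ.2.1 τ.2.2) with hΩ
  set X : ℤˣ × Fin 2 × (ZMod 8)ˣ → ℝ := fun τ => Y / (twoPart τ.2.1 τ.2.2 * R : ℕ) with hX
  set main : ℤˣ × Fin 2 × (ZMod 8)ˣ → ℂ := fun τ => if IsSquare b then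
    1 / 4 * (1 / 2 ^ T.primeFactors.card) * (X τ * coprimeDensity (2 * T * b) *
      cofactorSeries g (2 * T * b)) else 0 with hmaindef
  have hall' : ∑ D ∈ F₁, f D = ∑ τ ∈ Ω, ∑ n ∈ (Finset.Icc 1 ⌊X τ⌋₊).filter
      (fun n : ℕ => Squarefree n ∧ (((τ.1 : ℤ) * (R * n : ℕ) : ℤ) : ZMod 8) = τ.2.2 ∧
        ∀ p ∈ T.primeFactors, jacobiSym n p = ε τ.1 τ.2.1 p),
        f (τ.1 * 2 ^ (τ.2.1 : ℕ) * (R * n : ℕ)) := by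
    convert hall
  have hclass : ∀ τ : ℤˣ × Fin 2 × (ZMod 8)ˣ, ∃ r : ZMod 8, IsUnit r ∧
      ∑ n ∈ (Finset.Icc 1 ⌊X τ⌋₊).filter (fun n : ℕ => Squarefree n ∧
        (((τ.1 : ℤ) * (R * n : ℕ) : ℤ) : ZMod 8) = τ.2.2 ∧
        ∀ p ∈ T.primeFactors, jacobiSym n p = ε τ.1 τ.2.1 p),
        f (τ.1 * 2 ^ (τ.2.1 : ℕ) * (R * n : ℕ)) =
      twistCoeff g m R τ.1 τ.2.1 τ.2.2 * residueSum g T b (ε τ.1 τ.2.1) r (X τ) := by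
    rintro ⟨s, β, e⟩
    obtain ⟨r, hr, h⟩ := residueSum_congr_class (g := g) (T := T) (b := b) (ε := ε s β) hRo s e
      (X (s, β, e))
    refine ⟨r, hr, ?_⟩
    rw [← h, Finset.mul_sum]
    refine Finset.sum_congr rfl fun n hn => ?_
    obtain ⟨-, -, he, hj⟩ := Finset.mem_filter.1 hn
    dsimp only at he hj ⊢
    have hno : Odd (R * n) := by
      refine odd_of_isUnit_zmod_eight (isUnit_of_mul_isUnit_right (x := ((s : ℤ) : ZMod 8)) ?_)
      rw [← Int.cast_natCast, ← Int.cast_mul, he]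
      exact e.isUnit
    have hRn : R.Coprime n := by
      refine Nat.Coprime.coprime_dvd_left hRT (Nat.coprime_of_dvd fun p hp hpT hpn => ?_)
      have h1 := hj p (Nat.mem_primeFactors.2 ⟨hp, hpT, hTs.ne_zero⟩)
      have : NeZero p := ⟨hp.ne_zero⟩
      have h2 : jacobiSym n p = 0 := by
        rw [jacobiSym.eq_zero_iff_not_coprime, Int.gcd_natCast_natCast, Nat.gcd_eq_right hpn]
        exact hp.ne_one
      rcases hε s β p with h3 | h3 <;> rw [h2, h3] at h1 <;> norm_num at h1
    rw [hb]
    exact kroneckerSymbol_mul_eq hg.multiplicative hgR hRn hno m s β he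
  have hcR : ∀ τ : ℤˣ × Fin 2 × (ZMod 8)ˣ, (1 : ℝ) ≤ (twoPart τ.2.1 τ.2.2 * R : ℕ) := by
    intro τ
    exact_mod_cast Nat.mul_pos (twoPart_pos _ _) hRo.pos
  have hbound : ‖∑ D ∈ F₁, f D - ∑ τ ∈ Ω, twistCoeff g m R τ.1 τ.2.1 τ.2.2 * main τ‖ ≤
      16 * ((1 + A) * (C₀ * √(Y * M))) := by
    rw [hall', ← Finset.sum_sub_distrib]
    refine (norm_sum_le _ _).trans ?_
    have hterm : ∀ τ ∈ Ω, ‖(∑ n ∈ (Finset.Icc 1 ⌊X τ⌋₊).filter (fun n : ℕ => Squarefree n ∧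
        (((τ.1 : ℤ) * (R * n : ℕ) : ℤ) : ZMod 8) = τ.2.2 ∧
        ∀ p ∈ T.primeFactors, jacobiSym n p = ε τ.1 τ.2.1 p),
        f (τ.1 * 2 ^ (τ.2.1 : ℕ) * (R * n : ℕ))) -
        twistCoeff g m R τ.1 τ.2.1 τ.2.2 * main τ‖ ≤ (1 + A) * (C₀ * √(Y * M)) := by
      intro τ _
      obtain ⟨r, hr, h⟩ := hclass τ
      rw [h, ← mul_sub, norm_mul]
      have hX0 : 0 ≤ X τ := div_nonneg hY0 (zero_le_one.trans (hcR τ))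
      refine mul_le_mul (norm_twistCoeff_le hg.multiplicative hA hg.bound hg.four hg.eight _ _ _ _ _)
        ?_ (norm_nonneg _) (by linarith)
      refine (hmain g hg.multiplicative hg.bound T b hbo hTs hTb M hM1 hM2 (ε τ.1 τ.2.1)
        (fun p _ => hε _ _ _) r hr (X τ) hX0).trans ?_
      gcongr
      exact div_le_self hY0 (hcR τ)
    refine (Finset.sum_le_sum hterm).trans ?_
    rw [Finset.sum_const, nsmul_eq_mul]
    have hcard : Ω.card ≤ 16 := (Finset.card_filter_le _ _).trans (by decide)
    gcongr
    exact_mod_cast hcard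
  -- the main terms: the sums over the sign, over the class at `2`, and the factors at the odd
  -- primes make up the product `δ_Ξ`
  have hmainsum : ∑ τ ∈ Ω, twistCoeff g m R τ.1 τ.2.1 τ.2.2 * main τ =
      if IsSquare b then deltaConst Ξ * twoFactor 𝕊 g m *
        (Y * coprimeDensity (2 * T * b) * cofactorSeries g (2 * T * b)) else 0 := by
    by_cases hsq : IsSquare b
    · rw [if_pos hsq]
      set K : ℂ := 1 / 4 * (1 / 2 ^ T.primeFactors.card) * (Y / R * coprimeDensity (2 * T * b) *
        cofactorSeries g (2 * T * b)) with hK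
      have hR0 : (R : ℂ) ≠ 0 := by exact_mod_cast hRo.pos.ne'
      have hterm : ∀ (s : ℤˣ) (β : Fin 2) (e : (ZMod 8)ˣ),
          (if P s ∧ Q β e then twistCoeff g m R s β e * main (s, β, e) else 0) =
            (if P s then (1 : ℂ) else 0) * (if Q β e then
              (((if twoPart β e = 1 then ZMod.χ₈ e else 0) ^ m.factorization 2 : ℤ) : ℂ) *
                g (twoPart β e) / (twoPart β e) else 0) * K := by
        intro s β e
        by_cases hPs : P s
        · by_cases hQs : Q β e
          · have hc0 : (twoPart β e : ℂ) ≠ 0 := by exact_mod_cast (twoPart_pos β e).ne'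
            rw [if_pos ⟨hPs, hQs⟩, if_pos hPs, if_pos hQs,
              twistCoeff_of_isSquare (hb ▸ hsq) (hb ▸ hbo) (hb ▸ hRb), hmaindef, hK, hX]
            simp only [if_pos hsq]
            push_cast
            field_simp
          · simp [hQs]
        · simp [hPs]
      have hsumQ : ∀ s : ℤˣ, ∑ β : Fin 2, ∑ e : (ZMod 8)ˣ,
          (if P s ∧ Q β e then twistCoeff g m R s β e * main (s, β, e) else 0) =
          (if P s then (1 : ℂ) else 0) * ((2 * (if RatPlace.two ∈ 𝕊 then
            (RatPlace.two.weight (a .two) : ℂ) else 1) * twoFactor 𝕊 g m) * K) := by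
        intro s
        rw [← hQsum, Finset.sum_mul, Finset.mul_sum]
        refine Finset.sum_congr rfl fun β _ => ?_
        rw [Finset.sum_mul, Finset.mul_sum]
        refine Finset.sum_congr rfl fun e _ => ?_
        rw [hterm, mul_assoc]
      have hw := prod_weight_odd 𝕊 a han
      rw [← hTdef, ← hR] at hw
      rw [hΩ, Finset.sum_filter, Fintype.sum_prod_type]
      simp only [Fintype.sum_prod_type]
      rw [Finset.sum_congr rfl fun s _ => hsumQ s, ← Finset.sum_mul, hPsum, hδ, prod_places_eq,
        ← hTdef, hw, hK]
      push_cast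
      have hite : ∀ (p : Prop) [Decidable p] (x : ℝ),
          (((if p then x else 1 : ℝ)) : ℂ) = if p then (x : ℂ) else 1 := by
        intro p _ x; split_ifs <;> simp
      rw [hite, hite]
      field_simp
      ring
    · rw [if_neg hsq]
      exact Finset.sum_eq_zero fun τ _ => by rw [hmaindef]; simp [hsq]
  rw [← hmainsum]
  have hYM : 1 ≤ √(Y * M) := Real.one_le_sqrt.2 (by nlinarith)
  calc ‖discriminantSum Ξ g m Y - ∑ τ ∈ Ω, twistCoeff g m R τ.1 τ.2.1 τ.2.2 * main τ‖
      ≤ ‖discriminantSum Ξ g m Y - ∑ D ∈ F₁, f D‖ +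
        ‖∑ D ∈ F₁, f D - ∑ τ ∈ Ω, twistCoeff g m R τ.1 τ.2.1 τ.2.2 * main τ‖ :=
        norm_sub_le_norm_sub_add_norm_sub _ _ _
    _ ≤ √(Y * M) + 16 * ((1 + A) * (C₀ * √(Y * M))) := add_le_add (hone.trans hYM) hbound
    _ = _ := by ring


/-! ### The Euler product of the main term -/

/-- The finite products of the main term; the prime `2` is treated apart, because the cofactor `n`
is always odd. -/
theorem coprimeDensity_mul_twoFactor {𝕊 : Finset RatPlace} (g : ArithmeticFunction ℂ) {m : ℕ}
    (hm : 1 ≤ m) (hv : Even (m.factorization 2)) :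
    open Classical in
    coprimeDensity (2 * oddPrimeProduct 𝕊 * (m / 2 ^ m.factorization 2)) * twoFactor 𝕊 g m =
      (if RatPlace.two ∉ 𝕊 ∧ ¬ 2 ∣ m then localFactor g 2 else 1) *
        ((∏ p ∈ (primeProduct 𝕊).primeFactors, (1 - 1 / (p : ℂ))) *
          ∏ p ∈ m.primeFactors with ¬ p ∣ primeProduct 𝕊, (1 - 1 / (p : ℂ))) := by
  classical
  set S := primeProduct 𝕊 with hS
  set b := m / 2 ^ m.factorization 2 with hb
  have hm0 : m ≠ 0 := by omega
  have hS0 : S ≠ 0 := primeProduct_ne_zero 𝕊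
  have hb0 : b ≠ 0 := (Nat.ordCompl_pos 2 hm0).ne'
  have hT0 := oddPrimeProduct_ne_zero 𝕊
  have hbp : b.primeFactors = m.primeFactors.erase 2 := by
    rw [hb, ← Nat.support_factorization, Nat.factorization_ordCompl, Finsupp.support_erase,
      Nat.support_factorization]
  have h2S : RatPlace.two ∈ 𝕊 ↔ 2 ∈ S.primeFactors := by
    refine (finite_mem_iff_dvd_primeProduct ⟨2, Nat.prime_two⟩).trans ?_
    rw [Nat.mem_primeFactors]
    exact ⟨fun h => ⟨Nat.prime_two, h, hS0⟩, fun h => h.2.1⟩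
  have h2m : 2 ∣ m ↔ 2 ∈ m.primeFactors := by
    rw [Nat.mem_primeFactors]
    exact ⟨fun h => ⟨Nat.prime_two, h, hm0⟩, fun h => h.2.1⟩
  have hpf : (2 * oddPrimeProduct 𝕊 * b).primeFactors = insert 2 (S.primeFactors ∪ m.primeFactors) := by
    rw [Nat.primeFactors_mul (mul_ne_zero two_ne_zero hT0) hb0,
      Nat.primeFactors_mul two_ne_zero hT0, primeFactors_oddPrimeProduct, hbp,
      Nat.Prime.primeFactors Nat.prime_two]
    ext p
    simp only [Finset.mem_union, Finset.mem_singleton, Finset.mem_erase, Finset.mem_insert]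
    tauto
  have hunion : ∏ p ∈ S.primeFactors ∪ m.primeFactors, (1 - 1 / (p : ℂ)) =
      (∏ p ∈ S.primeFactors, (1 - 1 / (p : ℂ))) *
        ∏ p ∈ m.primeFactors with ¬ p ∣ S, (1 - 1 / (p : ℂ)) := by
    rw [← Finset.prod_union]
    · refine Finset.prod_congr ?_ fun _ _ => rfl
      ext p
      simp only [Finset.mem_union, Finset.mem_filter, Nat.mem_primeFactors]
      tauto
    · rw [Finset.disjoint_left]
      intro p hp hp'
      exact (Finset.mem_filter.1 hp').2 (Nat.dvd_of_mem_primeFactors hp)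
  rw [coprimeDensity, hpf, ← hunion]
  have hv0 : m.factorization 2 = 0 ↔ ¬ 2 ∣ m := by
    rw [Nat.factorization_eq_zero_iff]
    simp [Nat.prime_two, hm0]
  by_cases h : RatPlace.two ∉ 𝕊 ∧ ¬ 2 ∣ m
  · rw [if_pos h, Finset.prod_insert (by
      rw [Finset.mem_union, ← h2S, ← h2m]; tauto), twoFactor, if_neg h.1, if_pos (hv0.2 h.2),
      localFactor]
    push_cast
    ring
  · rw [if_neg h, one_mul, Finset.insert_eq_of_mem (by
      rw [Finset.mem_union, ← h2S, ← h2m]; tauto)]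
    have h1 : twoFactor 𝕊 g m = 1 := by
      rw [twoFactor]
      split_ifs with h3 h4
      · rfl
      · exact absurd ⟨h3, hv0.1 h4⟩ h
      · rfl
    rw [h1, mul_one]

/-- The Euler factor at `2` is not part of the cofactor series, whose terms are odd. -/
theorem hasProd_eulerFactor {𝕊 : Finset RatPlace} {g : ArithmeticFunction ℂ}
    (hg : g.IsMultiplicative)
    (hsum : Summable fun k : ℕ => ‖ArithmeticFunction.squarefreeCofactor g k‖ / k) (m : ℕ) :
    open Classical in
    HasProd (eulerFactor 𝕊 g m)
      ((if RatPlace.two ∉ 𝕊 ∧ ¬ 2 ∣ m then localFactor g 2 else 1) *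
        cofactorSeries g (2 * oddPrimeProduct 𝕊 * (m / 2 ^ m.factorization 2))) := by
  classical
  set b := m / 2 ^ m.factorization 2 with hb
  set c : ℂ := if RatPlace.two ∉ 𝕊 ∧ ¬ 2 ∣ m then localFactor g 2 else 1 with hc
  have h1 := hasProd_squarefreeCofactor hg hsum (2 * oddPrimeProduct 𝕊 * b)
  have h2 : ∀ q : Nat.Primes, HasProd (fun p : Nat.Primes => if p = q then c else 1) c :=
    fun q => by convert hasProd_ite_eq q c
  set E : Set Nat.Primes := {p | RatPlace.finite p ∉ 𝕊 ∧ ¬ (p : ℕ) ∣ m} with hE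
  have hmem : ∀ p : Nat.Primes, p ∈ E ↔ RatPlace.finite p ∉ 𝕊 ∧ ¬ (p : ℕ) ∣ m := fun _ => Iff.rfl
  have hind : ∀ p : Nat.Primes, E.mulIndicator (fun p : Nat.Primes => localFactor g p) p =
      (if p = ⟨2, Nat.prime_two⟩ then c else 1) *
        (if (p : ℕ) ∣ 2 * oddPrimeProduct 𝕊 * b then 1 else localFactor g p) := by
    intro p
    by_cases hp : p = ⟨2, Nat.prime_two⟩
    · have h5 : (p : ℕ) ∣ 2 * oddPrimeProduct 𝕊 * b := by
        rw [hp, mul_assoc]; exact dvd_mul_right _ _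
      have h6 : p ∈ E ↔ RatPlace.two ∉ 𝕊 ∧ ¬ 2 ∣ m := by rw [hmem, hp]
      have h7 : localFactor g p = localFactor g 2 := by rw [hp]
      rw [if_pos hp, if_pos h5, mul_one, hc]
      by_cases h : p ∈ E
      · rw [if_pos (h6.1 h), Set.mulIndicator_of_mem h, h7]
      · rw [if_neg (fun h' => h (h6.2 h')), Set.mulIndicator_of_notMem h]
    · have hp2 : (p : ℕ) ≠ 2 := fun h => hp (Subtype.ext h)
      have hpb : (p : ℕ) ∣ b ↔ (p : ℕ) ∣ m := by
        refine ⟨fun h => h.trans (Nat.ordCompl_dvd m 2), fun h => ?_⟩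
        have h6 : (p : ℕ) ∣ 2 ^ m.factorization 2 * b := by
          rwa [hb, Nat.ordProj_mul_ordCompl_eq_self]
        exact (((Nat.coprime_primes p.2 Nat.prime_two).2 hp2).pow_right _).dvd_of_dvd_mul_left h6
      have h5 : (p : ℕ) ∣ 2 * oddPrimeProduct 𝕊 * b ↔ ¬ p ∈ E := by
        rw [p.2.dvd_mul, p.2.dvd_mul, prime_dvd_oddPrimeProduct_iff, hpb,
          Nat.prime_dvd_prime_iff_eq p.2 Nat.prime_two, hmem]
        tauto
      rw [if_neg hp, one_mul]
      by_cases h : p ∈ E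
      · rw [if_neg (fun h' => h5.1 h' h), Set.mulIndicator_of_mem h]
      · rw [if_pos (h5.2 h), Set.mulIndicator_of_notMem h]
  have h4 : HasProd (E.mulIndicator fun p : Nat.Primes => localFactor g p)
      (c * cofactorSeries g (2 * oddPrimeProduct 𝕊 * b)) := by
    convert (h2 ⟨2, Nat.prime_two⟩).mul h1 using 2 with p
    · refine (hind p).trans ?_
      congr
    · rfl
  exact (hasProd_subtype_iff_mulIndicator (f := fun p : Nat.Primes => localFactor g p)
    (s := E)).2 h4

theorem mainTerm_eq {𝕊 : Finset RatPlace} (Ξ : LocalType 𝕊) {g : ArithmeticFunction ℂ}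
    (hg : g.IsMultiplicative)
    (hsum : Summable fun k : ℕ => ‖ArithmeticFunction.squarefreeCofactor g k‖ / k) {m : ℕ}
    (hm : 1 ≤ m) (hv : Even (m.factorization 2)) (Y : ℝ) :
    deltaConst Ξ * twoFactor 𝕊 g m *
      (Y * coprimeDensity (2 * oddPrimeProduct 𝕊 * (m / 2 ^ m.factorization 2)) *
        cofactorSeries g (2 * oddPrimeProduct 𝕊 * (m / 2 ^ m.factorization 2))) =
      mainTerm Ξ g m Y := by
  classical
  rw [mainTerm, (hasProd_eulerFactor hg hsum m).tprod_eq]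
  linear_combination ((deltaConst Ξ : ℂ) * Y *
    cofactorSeries g (2 * oddPrimeProduct 𝕊 * (m / 2 ^ m.factorization 2))) *
      coprimeDensity_mul_twoFactor (𝕊 := 𝕊) g hm hv

/-! ### The divisor function -/

/-- The divisor bound `d(n) ≪ n ^ ε`: in the product over the primes dividing `n`, only the primes
`p < 2 ^ (1 / ε)` contribute a constant larger than `1`. -/
theorem exists_card_divisors_le_rpow {ε : ℝ} (hε : 0 < ε) :
    ∃ C : ℝ, 1 ≤ C ∧ ∀ n : ℕ, n ≠ 0 → (n.divisors.card : ℝ) ≤ C * (n : ℝ) ^ ε := by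
  obtain ⟨B, hB1, hB⟩ : ∃ B : ℝ, 1 ≤ B ∧ ∀ k : ℕ, (k : ℝ) + 1 ≤ B * (2 : ℝ) ^ (k * ε) := by
    have hl : 0 < Real.log 2 := Real.log_pos one_lt_two
    refine ⟨1 + 1 / (ε * Real.log 2), by linarith [show 0 < 1 / (ε * Real.log 2) by positivity],
      fun k => ?_⟩
    have h1 : Real.log 2 * (k * ε) + 1 ≤ (2 : ℝ) ^ (k * ε) := by
      rw [Real.rpow_def_of_pos two_pos]
      exact Real.add_one_le_exp _
    have h2 : (k : ℝ) + 1 ≤ (1 + 1 / (ε * Real.log 2)) * (Real.log 2 * (k * ε) + 1) := by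
      have h3 : (1 + 1 / (ε * Real.log 2)) * (Real.log 2 * (k * ε) + 1) =
          k + 1 + Real.log 2 * (k * ε) + 1 / (ε * Real.log 2) := by field_simp; ring
      rw [h3]
      have : 0 ≤ Real.log 2 * (k * ε) := by positivity
      have : 0 < 1 / (ε * Real.log 2) := by positivity
      linarith
    refine h2.trans ?_
    gcongr
  obtain ⟨N, hN⟩ := exists_nat_ge ((2 : ℝ) ^ (1 / ε))
  refine ⟨B ^ N, one_le_pow₀ hB1, fun n hn => ?_⟩
  have hn' : (n : ℝ) ^ ε = ∏ p ∈ n.primeFactors, (p : ℝ) ^ (n.factorization p * ε) := by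
    conv_lhs => rw [← Nat.prod_factorization_pow_eq_self hn, Finsupp.prod, Nat.cast_prod]
    rw [← Real.finsetProd_rpow _ _ (fun _ _ => by positivity)]
    refine Finset.prod_congr rfl fun p _ => ?_
    rw [Nat.cast_pow, ← Real.rpow_natCast, ← Real.rpow_mul (Nat.cast_nonneg p)]
  have hterm : ∀ p ∈ n.primeFactors, ((n.factorization p + 1 : ℕ) : ℝ) ≤
      (if p < N then B else 1) * (p : ℝ) ^ (n.factorization p * ε) := by
    intro p hp
    have hp2 : (2 : ℝ) ≤ p := by exact_mod_cast (Nat.prime_of_mem_primeFactors hp).two_le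
    split_ifs with h
    · push_cast
      refine (hB _).trans ?_
      gcongr
    · -- here `p ^ ε ≥ 2`
      have h1 : (2 : ℝ) ≤ (p : ℝ) ^ ε := by
        have h3 : (2 : ℝ) ^ (1 / ε) ≤ p := hN.trans (by exact_mod_cast not_lt.1 h)
        calc (2 : ℝ) = ((2 : ℝ) ^ (1 / ε)) ^ ε := by
              rw [← Real.rpow_mul two_pos.le, one_div_mul_cancel hε.ne', Real.rpow_one]
          _ ≤ (p : ℝ) ^ ε := by gcongr
      rw [one_mul, mul_comm, Real.rpow_mul (Nat.cast_nonneg p), Real.rpow_natCast]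
      calc ((n.factorization p + 1 : ℕ) : ℝ) ≤ ((2 ^ n.factorization p : ℕ) : ℝ) := by
            exact_mod_cast Nat.lt_two_pow_self
        _ = (2 : ℝ) ^ n.factorization p := by push_cast; rfl
        _ ≤ _ := by gcongr
  rw [Nat.card_divisors hn, Nat.cast_prod, hn']
  refine (Finset.prod_le_prod (fun _ _ => by positivity) hterm).trans ?_
  rw [Finset.prod_mul_distrib]
  refine mul_le_mul_of_nonneg_right ?_ (Finset.prod_nonneg fun _ _ => by positivity)
  rw [← Finset.prod_filter, Finset.prod_const]
  refine pow_le_pow_right₀ hB1 ?_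
  calc (n.primeFactors.filter (· < N)).card ≤ (Finset.range N).card := by
        refine Finset.card_le_card fun p hp => ?_
        exact Finset.mem_range.2 (Finset.mem_filter.1 hp).2
    _ = N := Finset.card_range N


/-! ### The bounds for the character sums -/

theorem prod_dvd_of_subset_primeFactors {T : ℕ} {s : Finset ℕ} (hs : s ⊆ T.primeFactors) :
    (∏ p ∈ s, p) ∣ T :=
  (Finset.prod_dvd_prod_of_subset _ _ _ hs).trans (Nat.prod_primeFactors_dvd T)

/-- The Pólya–Vinogradov bound for the modulus `8 Q`. -/
def characterBound (Q : ℕ) : ℝ := 2 * √(8 * Q : ℕ) * (1 + Real.log (8 * Q : ℕ))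

theorem two_mul_sqrt_le_characterBound {Q : ℕ} (hQ : Q ≠ 0) :
    2 * √(2 * Q : ℕ) ≤ characterBound Q := by
  have h1 : (0 : ℝ) ≤ Real.log (8 * Q : ℕ) := Real.log_natCast_nonneg _
  rw [characterBound]
  calc 2 * √(2 * Q : ℕ) ≤ 2 * √(8 * Q : ℕ) := by gcongr; norm_num
    _ ≤ _ := le_mul_of_one_le_right (by positivity) (by linarith)

theorem hasMeanValue_of_odd {T b : ℕ} (hT : Odd T) (hb : Odd b) (ψ : DirichletCharacter ℂ 8)
    {s : Finset ℕ} (hs : s ⊆ T.primeFactors) (h : ψ ≠ 1 ∨ ¬ IsSquare ((∏ p ∈ s, p) * b)) :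
    HasMeanValue (coprimePart T (jacobiTwist ψ ((∏ p ∈ s, p) * b))) 0 (characterBound (T * b)) := by
  refine hasMeanValue_jacobiTwist (hT.mul hb)
    (mul_dvd_mul_right (prod_dvd_of_subset_primeFactors hs) b) (dvd_mul_right T b)
    (fun n h1 h2 => ?_) h
  exact h2.mul_right (h1.coprime_dvd_right (dvd_mul_left _ _))

/-- If `b` is a square, the symbol `(n / b)` only expresses that `n` is coprime to `b`, so that the
modulus of the character sum does not involve `b`. -/
theorem hasMeanValue_of_isSquare {T b : ℕ} (hT : Odd T) (hb0 : b ≠ 0) (hb : IsSquare b)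
    (ψ : DirichletCharacter ℂ 8) {s : Finset ℕ} (hs : s ⊆ T.primeFactors)
    (h : ψ ≠ 1 ∨ ¬ IsSquare ((∏ p ∈ s, p) * b)) :
    HasMeanValue (coprimePart T (jacobiTwist ψ ((∏ p ∈ s, p) * b))) 0
      (b.divisors.card * characterBound T) := by
  have h1 : HasMeanValue (coprimePart T (jacobiTwist ψ (∏ p ∈ s, p))) 0 (characterBound T) := by
    refine hasMeanValue_jacobiTwist hT (prod_dvd_of_subset_primeFactors hs) dvd_rfl
      (fun n _ h2 => h2) (h.imp_right fun h3 h4 => h3 (h4.mul hb))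
  have h2 := h1.coprimePart (fun n => (norm_coprimePart_le _ _ _).trans (norm_jacobiTwist_le _ _ _))
    hb0
  rw [zero_mul] at h2
  convert h2 using 2
  have hb' : NeZero b := ⟨hb0⟩
  have hs' : NeZero (∏ p ∈ s, p) := ⟨Finset.prod_ne_zero_iff.2 fun p hp =>
    (Nat.prime_of_mem_primeFactors (hs hp)).ne_zero⟩
  refine MonoidWithZeroHom.ext fun n => ?_
  rw [coprimePart_apply, coprimePart_apply, coprimePart_apply, jacobiTwist_apply,
    jacobiTwist_apply, jacobiSym.mul_right]
  by_cases h3 : n.Coprime b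
  · rw [if_pos h3, jacobiSym_isSquare_right hb h3, mul_one]
  · rw [if_neg h3, jacobiSym.eq_zero_iff_not_coprime (a := n) (b := b) |>.2 (by simpa using h3)]
    simp

theorem characterBound_le {Q N : ℕ} (hQ : Q ≠ 0) (h : Q ≤ N) :
    characterBound Q ≤ 18 * (√N * Real.log (4 * N)) := by
  have hQ1 : (1 : ℝ) ≤ Q := by exact_mod_cast Nat.one_le_iff_ne_zero.2 hQ
  have hQN : (Q : ℝ) ≤ N := by exact_mod_cast h
  have hN : (1 : ℝ) ≤ N := hQ1.trans hQN
  have hlog1 : 1 ≤ Real.log (4 * N) := by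
    rw [Real.le_log_iff_exp_le (by positivity)]
    have := Real.exp_one_lt_d9
    linarith
  have hlog2 : Real.log (8 * Q : ℕ) ≤ 2 * Real.log (4 * N) := by
    rw [← Real.log_rpow (by positivity)]
    refine Real.log_le_log (by push_cast; positivity) ?_
    rw [Real.rpow_two]
    push_cast
    nlinarith
  have hsqrt : √(8 * Q : ℕ) ≤ 3 * √N := by
    rw [Real.sqrt_le_left (by positivity), mul_pow, Real.sq_sqrt (by positivity)]
    push_cast
    linarith
  rw [characterBound]
  calc 2 * √(8 * Q : ℕ) * (1 + Real.log (8 * Q : ℕ))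
      ≤ 2 * (3 * √N) * (1 * Real.log (4 * N) + 2 * Real.log (4 * N)) := by
        have := Real.log_natCast_nonneg (8 * Q)
        gcongr
        linarith
    _ = _ := by ring

theorem IsAdmissible.mono {𝕊 : Finset RatPlace} {A B : ℝ} {g : ArithmeticFunction ℂ}
    (hg : IsAdmissible 𝕊 A g) (h : A ≤ B) : IsAdmissible 𝕊 B g :=
  ⟨hg.multiplicative, fun p hp => (hg.bound p hp).trans (by gcongr), hg.eq_one, hg.four, hg.eight⟩

/-- If `m` is not a square, there is no main term: either its odd part is not a square, or the
exponent of `2` is odd. -/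
theorem exists_discriminantSum_le (A : ℝ) (hA : 0 ≤ A) : ∃ C : ℝ, 0 < C ∧
    ∀ (𝕊 : Finset RatPlace) (Ξ : LocalType 𝕊) (g : ArithmeticFunction ℂ), IsAdmissible 𝕊 A g →
    ∀ m : ℕ, 1 ≤ m → m.Coprime (primeProduct 𝕊) → ¬ IsSquare m → ∀ Y : ℝ, 1 ≤ Y →
      ‖discriminantSum Ξ g m Y‖ ≤
        C * (primeProduct 𝕊 : ℝ) ^ (1 / 4 : ℝ) *
          ((m : ℝ) ^ (1 / 4 : ℝ) * Real.sqrt (Real.log (4 * m * primeProduct 𝕊)) * Real.sqrt Y) := by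
  obtain ⟨C, hC, hmain⟩ := exists_discriminantSum_sub_le A hA
  refine ⟨C * √18, by positivity, fun 𝕊 Ξ g hg m hm hmS hsq Y hY => ?_⟩
  set T := oddPrimeProduct 𝕊 with hT
  set b := m / 2 ^ m.factorization 2 with hb
  have hTo : Odd T := odd_oddPrimeProduct 𝕊
  have hbo : Odd b := by
    rw [hb, ← Nat.not_even_iff_odd, even_iff_two_dvd]
    exact Nat.not_dvd_ordCompl Nat.prime_two (by omega)
  have hTb0 : T * b ≠ 0 := mul_ne_zero hTo.pos.ne' hbo.pos.ne'
  have hcard : ((2 * T * b).divisors.card : ℝ) ≤ characterBound (T * b) := by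
    rw [mul_assoc]
    exact (card_divisors_le_two_mul_sqrt _).trans (two_mul_sqrt_le_characterBound hTb0)
  have h := hmain 𝕊 Ξ g hg m hm hmS T b hT hb _
    (fun ψ s hs h => hasMeanValue_of_odd hTo hbo ψ hs h) hcard Y hY
  have hzero : (if IsSquare b then deltaConst Ξ * twoFactor 𝕊 g m *
      (Y * coprimeDensity (2 * T * b) * cofactorSeries g (2 * T * b)) else 0) = 0 := by
    split_ifs with h1
    · -- the exponent of `2` in `m` is odd, and the symbols at `2` cancel
      have hv : ¬ Even (m.factorization 2) := by
        rintro ⟨k, hk⟩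
        obtain ⟨c, hc⟩ := h1
        refine hsq ⟨2 ^ k * c, ?_⟩
        rw [← Nat.ordProj_mul_ordCompl_eq_self m 2, ← hb, hc, hk, pow_add]
        ring
      have hv0 : m.factorization 2 ≠ 0 := fun h => hv (by rw [h]; exact Even.zero)
      have htwo : RatPlace.two ∉ 𝕊 := by
        intro h2
        have h3 := Nat.dvd_gcd (Nat.dvd_of_factorization_pos hv0)
          ((finite_mem_iff_dvd_primeProduct ⟨2, Nat.prime_two⟩).1 h2)
        rw [hmS] at h3
        exact absurd (Nat.dvd_one.1 h3) (by norm_num)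
      rw [twoFactor, if_neg htwo, if_neg hv0, if_neg hv]
      ring
    · rfl
  rw [hzero, sub_zero] at h
  refine h.trans ?_
  have hle : T * b ≤ m * primeProduct 𝕊 := by
    rw [mul_comm]
    exact Nat.mul_le_mul (Nat.le_of_dvd (by omega) (Nat.ordCompl_dvd m 2))
      (Nat.le_of_dvd (Nat.pos_of_ne_zero (primeProduct_ne_zero 𝕊)) (oddPrimeProduct_dvd 𝕊))
  have hM := characterBound_le hTb0 hle
  push_cast at hM
  have hq : ∀ x : ℝ, 0 ≤ x → √√x = x ^ (1 / 4 : ℝ) := by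
    intro x hx
    rw [Real.sqrt_eq_rpow, Real.sqrt_eq_rpow, ← Real.rpow_mul hx]
    norm_num
  calc C * √(Y * characterBound (T * b))
      ≤ C * √(Y * (18 * (√(m * primeProduct 𝕊) * Real.log (4 * (m * primeProduct 𝕊))))) := by
        gcongr
    _ = _ := by
        rw [Real.sqrt_mul (by linarith), Real.sqrt_mul (by norm_num), Real.sqrt_mul (by positivity),
          hq _ (by positivity), Real.mul_rpow (by positivity) (by positivity), ← mul_assoc 4]
        ring

/-- If `m` is a square, the moduli of the characters do not involve `m`, which enters the error only
through its number of divisors. -/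
theorem exists_discriminantSum_sub_mainTerm_le (A : ℝ) (hA : 0 ≤ A) {ε : ℝ} (hε : 0 < ε) :
    ∃ C : ℝ, 0 < C ∧
    ∀ (𝕊 : Finset RatPlace) (Ξ : LocalType 𝕊) (g : ArithmeticFunction ℂ), IsAdmissible 𝕊 A g →
    ∀ m : ℕ, 1 ≤ m → m.Coprime (primeProduct 𝕊) → IsSquare m →
      Multipliable (eulerFactor 𝕊 g m) ∧
      ∀ Y : ℝ, 1 ≤ Y →
        ‖discriminantSum Ξ g m Y - mainTerm Ξ g m Y‖ ≤
          C * (primeProduct 𝕊 : ℝ) ^ (1 / 4 : ℝ) *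
            (((m : ℝ) * primeProduct 𝕊) ^ ε * Y ^ (1 / 2 + ε)) := by
  obtain ⟨C, hC, hmain⟩ := exists_discriminantSum_sub_le A hA
  obtain ⟨C₁, hC₁, hdiv⟩ := exists_card_divisors_le_rpow (ε := 2 * ε) (by positivity)
  obtain ⟨C₂, hC₂, hsq⟩ := exists_sum_squarefreePart_le A hA
  obtain ⟨C₃, hC₃, hlog⟩ : ∃ C₃ : ℝ, 0 < C₃ ∧ ∀ x : ℝ, 1 ≤ x →
      Real.log (4 * x) ≤ C₃ * x ^ (2 * ε) := by
    refine ⟨4 ^ (2 * ε) / (2 * ε), by positivity, fun x hx => ?_⟩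
    refine (Real.log_le_rpow_div (by positivity) (by positivity : 0 < 2 * ε)).trans_eq ?_
    rw [Real.mul_rpow (by norm_num) (by positivity)]
    ring
  refine ⟨C * √(18 * C₁ * C₃), by positivity, fun 𝕊 Ξ g hg m hm hmS hmsq => ?_⟩
  set T := oddPrimeProduct 𝕊 with hT
  set b := m / 2 ^ m.factorization 2 with hb
  have hTo : Odd T := odd_oddPrimeProduct 𝕊
  have hbo : Odd b := by
    rw [hb, ← Nat.not_even_iff_odd, even_iff_two_dvd]
    exact Nat.not_dvd_ordCompl Nat.prime_two (by omega)
  have hv : Even (m.factorization 2) := by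
    obtain ⟨c, rfl⟩ := hmsq
    have hc : c ≠ 0 := by rintro rfl; omega
    rw [Nat.factorization_mul hc hc]
    exact ⟨_, rfl⟩
  have hbsq : IsSquare b := by
    obtain ⟨c, rfl⟩ := hmsq
    refine ⟨c / 2 ^ c.factorization 2, ?_⟩
    rw [hb, Nat.ordCompl_mul]
  have hbm : b ∣ m := Nat.ordCompl_dvd m 2
  have hSpos : 0 < primeProduct 𝕊 := Nat.pos_of_ne_zero (primeProduct_ne_zero 𝕊)
  have hTb : (2 * T).Coprime b := by
    refine Nat.Coprime.mul_left (Nat.coprime_two_left.2 hbo) ?_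
    exact (Nat.Coprime.coprime_dvd_left hbm (hmS.coprime_dvd_right (oddPrimeProduct_dvd 𝕊))).symm
  have hsum := (hsq g hg.multiplicative hg.bound).1
  have hcard : ((2 * T * b).divisors.card : ℝ) ≤ b.divisors.card * characterBound T := by
    rw [hTb.card_divisors_mul, Nat.cast_mul, mul_comm]
    gcongr
    exact (card_divisors_le_two_mul_sqrt _).trans (two_mul_sqrt_le_characterBound hTo.pos.ne')
  refine ⟨(hasProd_eulerFactor hg.multiplicative hsum m).multipliable, fun Y hY => ?_⟩
  have h := hmain 𝕊 Ξ g hg m hm hmS T b hT hb _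
    (fun ψ s hs h => hasMeanValue_of_isSquare hTo hbo.pos.ne' hbsq ψ hs h) hcard Y hY
  rw [if_pos hbsq, hT, hb, mainTerm_eq Ξ hg.multiplicative hsum hm hv, ← hb, ← hT] at h
  refine h.trans ?_
  have hS1 : (1 : ℝ) ≤ primeProduct 𝕊 := by exact_mod_cast hSpos
  have hM := characterBound_le hTo.pos.ne' (Nat.le_of_dvd hSpos (oddPrimeProduct_dvd 𝕊))
  have hq : ∀ x : ℝ, 0 ≤ x → √√x = x ^ (1 / 4 : ℝ) := by
    intro x hx
    rw [Real.sqrt_eq_rpow, Real.sqrt_eq_rpow, ← Real.rpow_mul hx]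
    norm_num
  have hq' : ∀ x : ℝ, 0 ≤ x → √(x ^ (2 * ε)) = x ^ ε := by
    intro x hx
    rw [Real.sqrt_eq_rpow, ← Real.rpow_mul hx]
    congr 1; ring
  have hd : (b.divisors.card : ℝ) ≤ C₁ * (m : ℝ) ^ (2 * ε) := by
    refine (hdiv b hbo.pos.ne').trans ?_
    gcongr
    exact Nat.le_of_dvd (by omega) hbm
  have hcb : characterBound T ≤ 18 * (√(primeProduct 𝕊) * (C₃ * (primeProduct 𝕊 : ℝ) ^ (2 * ε))) :=
    hM.trans (by gcongr; exact hlog _ hS1)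
  have hcb0 : 0 ≤ characterBound T := le_trans (by positivity)
    (two_mul_sqrt_le_characterBound hTo.pos.ne')
  calc C * √(Y * (b.divisors.card * characterBound T))
      ≤ C * √(Y * ((C₁ * (m : ℝ) ^ (2 * ε)) *
          (18 * (√(primeProduct 𝕊) * (C₃ * (primeProduct 𝕊 : ℝ) ^ (2 * ε)))))) := by
        gcongr
    _ = C * √((18 * C₁ * C₃) * (√(primeProduct 𝕊) * ((m : ℝ) ^ (2 * ε) *
          ((primeProduct 𝕊 : ℝ) ^ (2 * ε) * Y)))) := by
        congr 2; ring
    _ = C * √(18 * C₁ * C₃) * (primeProduct 𝕊 : ℝ) ^ (1 / 4 : ℝ) *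
          (((m : ℝ) * primeProduct 𝕊) ^ ε * √Y) := by
        rw [Real.sqrt_mul (x := 18 * C₁ * C₃) (by positivity),
          Real.sqrt_mul (x := √(primeProduct 𝕊)) (by positivity),
          Real.sqrt_mul (x := (m : ℝ) ^ (2 * ε)) (by positivity),
          Real.sqrt_mul (x := (primeProduct 𝕊 : ℝ) ^ (2 * ε)) (by positivity), hq _ (by positivity),
          hq' _ (by positivity), hq' _ (by positivity), Real.mul_rpow (by positivity) (by positivity)]
        ring
    _ ≤ _ := by
        gcongr
        rw [Real.sqrt_eq_rpow]
        exact Real.rpow_le_rpow_of_exponent_le hY (by linarith)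

end

theorem mainTheorem8 (A : ℝ) :
    (∃ C : ℝ, 0 < C ∧
      ∀ (𝕊 : Finset RatPlace) (Ξ : LocalType 𝕊) (g : ArithmeticFunction ℂ), IsAdmissible 𝕊 A g →
      ∀ m : ℕ, 1 ≤ m → m.Coprime (primeProduct 𝕊) → ¬ IsSquare m → ∀ Y : ℝ, 1 ≤ Y →
        ‖discriminantSum Ξ g m Y‖ ≤
          C * (primeProduct 𝕊 : ℝ) ^ (1 / 4 : ℝ) *
            ((m : ℝ) ^ (1 / 4 : ℝ) * Real.sqrt (Real.log (4 * m * primeProduct 𝕊)) * Real.sqrt Y)) ∧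
    (∀ ε : ℝ, 0 < ε → ∃ C : ℝ, 0 < C ∧
      ∀ (𝕊 : Finset RatPlace) (Ξ : LocalType 𝕊) (g : ArithmeticFunction ℂ), IsAdmissible 𝕊 A g →
      ∀ m : ℕ, 1 ≤ m → m.Coprime (primeProduct 𝕊) → IsSquare m →
        Multipliable (eulerFactor 𝕊 g m) ∧
        ∀ Y : ℝ, 1 ≤ Y →
          ‖discriminantSum Ξ g m Y - mainTerm Ξ g m Y‖ ≤
            C * (primeProduct 𝕊 : ℝ) ^ (1 / 4 : ℝ) *
              (((m : ℝ) * primeProduct 𝕊) ^ ε * Y ^ (1 / 2 + ε))) := by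
  obtain ⟨C, hC, h⟩ := exists_discriminantSum_le (max A 0) (le_max_right _ _)
  refine ⟨⟨C, hC, fun 𝕊 Ξ g hg => h 𝕊 Ξ g (hg.mono (le_max_left _ _))⟩, fun ε hε => ?_⟩
  obtain ⟨C', hC', h'⟩ := exists_discriminantSum_sub_mainTerm_le (max A 0) (le_max_right _ _) hε
  exact ⟨C', hC', fun 𝕊 Ξ g hg => h' 𝕊 Ξ g (hg.mono (le_max_left _ _))⟩
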